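/- Let $d\ge 1$, let $\mu$ be a finite measure on the unit sphere $\mathbb S^{d-1}$ and let $\kappa\ge 1$ be such that (ND) $\ \kappa^{-1}|\xi|\le \int_{\mathbb S^{d-1}}|\langle \xi,\theta\rangle|\,\mu(d\theta)\le \kappa|\xi|$ for all $\xi\in\mathbb R^d$. Let $Z=(Z_t)_{t\ge 0}$ be a symmetric stable process of order $1$ in $\mathbb R^d$ with spectral measure $\mu$, i.e. a Lévy process with $\mathbb E\, e^{i\langle \xi,Z_t\rangle}=\exp\big(-t\int_{\mathbb S^{d-1}}|\langle \xi,\theta\rangle|\,\mu(d\theta)\big)$. Let $b:\mathbb R^d\to\mathbb R^d$ be continuous and bounded and suppose that (C$_\varepsilon$) there are $\varepsilon\in(0,1)$ and $b_0\in\mathbb R^d$ with $|b(x)-b_0|\le\varepsilon$ for all $x\in\mathbb R^d$. Let $\lambda\ge 1$ and, for $f\in C_0^\infty(\mathbb R^d)$ (smooth, real-valued, compactly supported), put $$\tilde R^\lambda f(x)=\int_0^\infty e^{-\lambda t}\,\mathbb E\big[f(x+b_0t+Z_t)\big]\,dt,\qquad \mathcal R f(x)=\langle b(x)-b_0,\,D\tilde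 R^\lambda f(x)\rangle .$$ Then, for every $p\in(1,\infty)$, there are constants $C_p>0$ and $\varepsilon_p>0$ depending only on $p$, $d$, $\kappa$ and an upper bound for $\|b\|_\infty$ (and so not on $\mu$ otherwise, nor on $b_0$, $\varepsilon$, $\lambda$, $f$) such that: (i) for every $f\in C_0^\infty(\mathbb R^d)$ the integral defining $\tilde R^\lambda f$ converges absolutely, $\tilde R^\lambda f$ is differentiable, $\mathcal Rf\in L^p(\mathbb R^d)$ and $$\|\mathcal R f\|_{L^p(\mathbb R^d)}\le C_p\,\varepsilon\,\|f\|_{L^p(\mathbb R^d)};$$ (ii) $\mathcal R$ extends uniquely to a bounded linear operator on $L^p(\mathbb R^d)$, of norm at most $C_p\,\varepsilon$, and if $\varepsilon\le\varepsilon_p$ then $I-\mathcal R$ is invertible on $L^p(\mathbb R^d)$ (with bounded inverse). -/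

import Mathlib

open MeasureTheory ProbabilityTheory Filter Topology
open scoped NNReal ENNReal ContDiff

noncomputable section

namespace CriticalStable

/-- The Euclidean space `ℝ^d`. -/
abbrev Euc (d : ℕ) : Type := EuclideanSpace ℝ (Fin d)

/-- The unit sphere of `ℝ^d`. -/
abbrev USphere (d : ℕ) : Type := Metric.sphere (0 : Euc d) 1

/-- The exponent `ξ ↦ ∫_{S^{d-1}} |⟨ξ, θ⟩| m(dθ)` attached to a spectral measure `m`. -/
def spectralExponent {d : ℕ} (m : Measure (USphere d)) (ξ : Euc d) : ℝ :=
  ∫ θ : USphere d, |inner ℝ ξ (θ : Euc d)| ∂m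

/-- Non-degeneracy of the spectral measure, with constant `κ`. -/
def NonDegenerate {d : ℕ} (m : Measure (USphere d)) (κ : ℝ) : Prop :=
  ∀ ξ : Euc d, κ⁻¹ * ‖ξ‖ ≤ spectralExponent m ξ ∧ spectralExponent m ξ ≤ κ * ‖ξ‖

/-- `Z` is a symmetric `d`-dimensional stable Lévy process of order one with spectral measure `m`:
it starts at zero, has càdlàg paths and independent increments, and `Z t - Z s` (`s ≤ t`) has the
characteristic function `ξ ↦ exp (-(t - s) ∫ |⟨ξ, θ⟩| m(dθ))`. -/
structure IsStableProcess {d : ℕ} {Ω : Type*} [MeasurableSpace Ω]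
    (m : Measure (USphere d)) (P : Measure Ω) (Z : ℝ≥0 → Ω → Euc d) : Prop where
  measurable : ∀ t, Measurable (Z t)
  zero : ∀ᵐ w ∂P, Z 0 w = 0
  cadlag : ∀ᵐ w ∂P, ∀ t : ℝ≥0, ContinuousWithinAt (fun s => Z s w) (Set.Ici t) t ∧
    ∃ l : Euc d, Tendsto (fun s => Z s w) (𝓝[<] t) (𝓝 l)
  indep : HasIndepIncrements Z P
  charFun_increment : ∀ s t : ℝ≥0, s ≤ t → ∀ ξ : Euc d,
    charFun (P.map (fun w => Z t w - Z s w)) ξ =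
      (Real.exp (-((t : ℝ) - (s : ℝ)) * spectralExponent m ξ) : ℂ)

/-- The integrand `t ↦ e^{-lam t} E[f (x + b₀ t + Z_t)]` of the resolvent of the process
`t ↦ x + b₀ t + Z_t`. -/
def resolventIntegrand {d : ℕ} {Ω : Type*} [MeasurableSpace Ω] (P : Measure Ω)
    (Z : ℝ≥0 → Ω → Euc d) (b₀ : Euc d) (lam : ℝ) (f : Euc d → ℝ) (x : Euc d) (t : ℝ) : ℝ :=
  Real.exp (-lam * t) * ∫ w, f (x + t • b₀ + Z t.toNNReal w) ∂P

/-- The resolvent `x ↦ ∫_0^∞ e^{-lam t} E[f (x + b₀ t + Z_t)] dt` of the frozen process. -/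
def resolvent {d : ℕ} {Ω : Type*} [MeasurableSpace Ω] (P : Measure Ω)
    (Z : ℝ≥0 → Ω → Euc d) (b₀ : Euc d) (lam : ℝ) (f : Euc d → ℝ) (x : Euc d) : ℝ :=
  ∫ t in Set.Ioi (0 : ℝ), resolventIntegrand P Z b₀ lam f x t

/-- The remainder `x ↦ ⟨b x - b₀, D (resolvent f) x⟩`. -/
def remainder {d : ℕ} {Ω : Type*} [MeasurableSpace Ω] (P : Measure Ω)
    (Z : ℝ≥0 → Ω → Euc d) (b : Euc d → Euc d) (b₀ : Euc d) (lam : ℝ)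
    (f : Euc d → ℝ) (x : Euc d) : ℝ :=
  inner ℝ (b x - b₀) (gradient (resolvent P Z b₀ lam f) x)

/-- The bounded operator `T` on `L^p(ℝ^d)` coincides with the remainder operator on
`C_0^∞(ℝ^d)`. -/
def ExtendsRemainder {d : ℕ} {Ω : Type*} [MeasurableSpace Ω] (P : Measure Ω)
    (Z : ℝ≥0 → Ω → Euc d) (b : Euc d → Euc d) (b₀ : Euc d) (lam : ℝ)
    (p : ℝ≥0∞) [Fact (1 ≤ p)]
    (T : Lp ℝ p (volume : Measure (Euc d)) →L[ℝ] Lp ℝ p (volume : Measure (Euc d))) : Prop :=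
  ∀ (f : Euc d → ℝ) (hf : ContDiff ℝ ∞ f) (hfc : HasCompactSupport f),
    T ((hf.continuous.memLp_of_hasCompactSupport hfc).toLp f) =ᵐ[volume]
      remainder P Z b b₀ lam f

end CriticalStable

end

/-! The exponent `∫ |⟨ξ, θ⟩| μ(dθ)` is homogeneous of degree one, so `b₀ t + Z_t` has the law of `t
Y` with `Y = b₀ + Z₁`: at order one, drift and noise scale alike. Hence `D_e R̃f(x) = ∫₀^∞ e^{-λt}
E[∂_e f(x + tY)] dt`, and of the factor `e^{-λt}` only the bound by one is ever used. It suffices to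
bound this operator on `L^p` in terms of `p`, `d`, `κ` and `‖b₀‖`: pairing with `b - b₀` gains the
factor `ε`, and `‖b₀‖ ≤ ‖b‖_∞ + 1`. Density and a Neumann series give the rest.

The spectral measure may be singular, so the density of `Z₁` need not have good pointwise bounds.
The remedy is the splitting `-|s| = (φ(s) - 1) - (√(1 + s²) - 1)` with `φ(s) = √(1 + s²) - |s|`,
where `φ` is the characteristic function of a probability measure on the line, a mixture of centred
Gaussians. With `s = ⟨ξ, θ⟩` integrated against `μ`, the law of `Z₁` factors into a compound Poisson
law and a factor `exp (-G)` with `G` smooth (`charFun_compoundPoisson_mul_exp_smoothExponent`). The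
smooth factor decays exponentially together with its derivatives, uniformly in `μ`, so its
directional derivative has a kernel `K` with a first moment and an `L¹` Lipschitz bound
(`exists_gradient_kernel`). The compound Poisson law shifted by `b₀`, called `ν`, absorbs the
roughness of `μ` and only needs a moment of order `1/2`. This yields `E[∂_e f(x + tY)] = t⁻¹ ∬ K(y)
f(x + t(y + z)) dy ν(dz)`.

Calderón–Zygmund theory applies to the integral of this in `t` (`truncatedOp_eLpNorm_le`). On `L²`
the symbol is at most `2π|ξ| ∫₀^∞ e^{-2πt|ξ|/κ} dt = κ`. For a function of mean zero in a ball of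
radius `r`, observed off the doubled ball, scales `t ≤ r` gain `(t/r)^{1/2}` from the moments and
scales `t > r` gain `r/t` from the smoothness of `K`; both gains are integrable against `dt/t`. This
gives `1 < p < 2` by interpolation and `p > 2` by duality, the adjoint being the same superposition
with reversed translations. The scales are truncated to `(δ, N]` so that all integrals converge
absolutely; Fatou's lemma removes the truncation. -/

namespace CriticalStable

/-! ### Calderón–Zygmund operators and stopping balls. -/

section CalderonZygmund

set_option linter.unusedSectionVars false

variable {E : Type*} [NormedAddCommGroup E] [InnerProductSpace ℝ E] [FiniteDimensional ℝ E]
  [MeasurableSpace E] [BorelSpace E]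

/-- Bounded measurable functions with compact support. -/
structure IsTest (f : E → ℝ) : Prop where
  measurable : Measurable f
  bounded : ∃ C, ∀ x, |f x| ≤ C
  compact : HasCompactSupport f

namespace IsTest

lemma integrable {f : E → ℝ} (hf : IsTest f) : Integrable f := by
  obtain ⟨C, hC⟩ := hf.bounded
  have h : IntegrableOn f (tsupport f) :=
    Measure.integrableOn_of_bounded hf.compact.measure_lt_top.ne hf.measurable.aestronglyMeasurable
      (M := C) (Eventually.of_forall fun x => hC x)
  exact (integrableOn_iff_integrable_of_support_subset (subset_tsupport f)).1 h

lemma of_continuous {f : E → ℝ} (hf : Continuous f) (hc : HasCompactSupport f) : IsTest f :=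
  ⟨hf.measurable, by simpa using hc.exists_bound_of_continuous hf, hc⟩

lemma add {f g : E → ℝ} (hf : IsTest f) (hg : IsTest g) : IsTest (f + g) := by
  obtain ⟨C, hC⟩ := hf.bounded
  obtain ⟨D, hD⟩ := hg.bounded
  exact ⟨hf.measurable.add hg.measurable,
    ⟨C + D, fun x => (abs_add_le _ _).trans (add_le_add (hC x) (hD x))⟩, hf.compact.add hg.compact⟩

lemma zero : IsTest (0 : E → ℝ) :=
  ⟨measurable_zero, ⟨0, by simp⟩, HasCompactSupport.zero⟩

lemma mul {f g : E → ℝ} (hf : IsTest f) (hg : Measurable g) {D : ℝ} (hD : ∀ x, |g x| ≤ D) :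
    IsTest (fun x => f x * g x) := by
  obtain ⟨C, hC⟩ := hf.bounded
  refine ⟨hf.measurable.mul hg, ⟨C * D, fun x => ?_⟩, hf.compact.mul_right⟩
  rw [abs_mul]
  exact mul_le_mul (hC x) (hD x) (abs_nonneg _) ((abs_nonneg _).trans (hC x))

lemma sum {ι : Type*} (s : Finset ι) {f : ι → E → ℝ} (hf : ∀ i ∈ s, IsTest (f i)) :
    IsTest (∑ i ∈ s, f i) := by
  classical
  induction s using Finset.induction_on with
  | empty => simpa using zero
  | insert a s ha ih =>
    rw [Finset.sum_insert ha]
    exact (hf a (by simp)).add (ih fun i hi => hf i (by simp [hi]))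

lemma indicator_closedBall (c : ℝ) (x : E) (r : ℝ) :
    IsTest ((Metric.closedBall x r).indicator fun _ => c) := by
  refine ⟨measurable_const.indicator measurableSet_closedBall, ⟨|c|, fun y => ?_⟩, ?_⟩
  · by_cases hy : y ∈ Metric.closedBall x r <;> simp [hy]
  · exact HasCompactSupport.intro (isCompact_closedBall x r) fun y hy => by simp [hy]

lemma neg {f : E → ℝ} (hf : IsTest f) : IsTest (-f) := by
  simpa using! hf.mul (g := fun _ => -1) measurable_const (D := 1) (by simp)

lemma sub {f g : E → ℝ} (hf : IsTest f) (hg : IsTest g) : IsTest (f - g) := by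
  rw [sub_eq_add_neg]; exact hf.add hg.neg

end IsTest

/-- `T` is additive, bounded on `L²` and satisfies the integrated Hörmander condition. -/
structure IsCalderonZygmund (T : (E → ℝ) → E → ℝ) (A : ℝ≥0) : Prop where
  map_add : ∀ f g, IsTest f → IsTest g → T (f + g) = T f + T g
  measurable : ∀ f, IsTest f → Measurable (T f)
  l2_bound : ∀ f, IsTest f → ∫⁻ x, ‖T f x‖ₑ ^ 2 ≤ A * ∫⁻ x, ‖f x‖ₑ ^ 2
  cancellation : ∀ (c : E) (r : ℝ) (f : E → ℝ), 0 < r → IsTest f →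
    Function.support f ⊆ Metric.closedBall c r → ∫ x, f x = 0 →
    ∫⁻ x in (Metric.closedBall c (2 * r))ᶜ, ‖T f x‖ₑ ≤ A * ∫⁻ x, ‖f x‖ₑ

lemma IsCalderonZygmund.map_sum {T : (E → ℝ) → E → ℝ} {A : ℝ≥0} (hT : IsCalderonZygmund T A)
    {ι : Type*} (s : Finset ι) {f : ι → E → ℝ} (hf : ∀ i ∈ s, IsTest (f i)) :
    T (∑ i ∈ s, f i) = ∑ i ∈ s, T (f i) := by
  classical
  induction s using Finset.induction_on with
  | empty =>
    have h := hT.map_add 0 0 IsTest.zero IsTest.zero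
    rw [add_zero] at h
    simpa using h
  | insert a s ha ih =>
    rw [Finset.sum_insert ha, Finset.sum_insert ha, hT.map_add _ _ (hf a (by simp))
      (IsTest.sum s fun i hi => hf i (by simp [hi])), ih fun i hi => hf i (by simp [hi])]

lemma volume_real_closedBall_mul (x : E) {k : ℝ} (hk : 0 < k) (r : ℝ) :
    volume.real (Metric.closedBall x (k * r)) =
      k ^ Module.finrank ℝ E * volume.real (Metric.closedBall x r) := by
  have h1 := Measure.addHaar_closedBall_mul_of_pos (volume : Measure E) x hk r
  have h2 := Measure.addHaar_closedBall_center (volume : Measure E) x r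
  rw [measureReal_def, h1, measureReal_def, h2, ENNReal.toReal_mul,
    ENNReal.toReal_ofReal (by positivity)]

lemma volume_real_closedBall_pos (x : E) {r : ℝ} (hr : 0 < r) :
    0 < volume.real (Metric.closedBall x r) :=
  ENNReal.toReal_pos (Metric.measure_closedBall_pos volume x hr).ne'
    measure_closedBall_lt_top.ne

/-- The average of `F` exceeds `β` on a small ball, by continuity, and falls below `β` on huge ones,
by integrability; `r` is the last radius of the form `5 ^ n * ε` before the drop. The ratio `5` is
the Vitali enlargement factor, so the ball with controlled average is exactly the one that the
covering lemma produces. -/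
lemma exists_stopping_ball [Nontrivial E] {F : E → ℝ} (hF : Continuous F) (h0 : ∀ x, 0 ≤ F x)
    (hi : Integrable F) {β : ℝ} (hβ : 0 < β) {x : E} (hx : β < F x) :
    ∃ r > 0, β * volume.real (Metric.closedBall x r) ≤ ∫ y in Metric.closedBall x r, F y ∧
      ∫ y in Metric.closedBall x (5 * r), F y ≤ β * volume.real (Metric.closedBall x (5 * r)) := by
  classical
  obtain ⟨β', hβ', hβx⟩ := exists_between hx
  obtain ⟨ε, hε, hball⟩ : ∃ ε > 0, ∀ y ∈ Metric.closedBall x ε, β' < F y :=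
    Metric.nhds_basis_closedBall.eventually_iff.1 (hF.continuousAt.eventually (lt_mem_nhds hβx))
  have hvε := volume_real_closedBall_pos x hε
  set v := volume.real (Metric.closedBall x ε) with hv
  have hex : ∃ n : ℕ, ∫ y in Metric.closedBall x (5 ^ n * ε), F y ≤
      β * volume.real (Metric.closedBall x (5 ^ n * ε)) := by
    -- Since the dimension is at least one, the ball of radius `5 ^ n * ε` has volume at least `5 ^
    -- n * v`, which eventually outweighs the total mass of `F`.
    obtain ⟨n, hn⟩ := pow_unbounded_of_one_lt ((∫ y, F y) / (β * v)) (by norm_num : (1 : ℝ) < 5)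
    refine ⟨n, ?_⟩
    rw [volume_real_closedBall_mul x (by positivity)]
    have h1 : ∫ y in Metric.closedBall x (5 ^ n * ε), F y ≤ ∫ y, F y :=
      setIntegral_le_integral hi (Eventually.of_forall h0)
    have h2 : (5 : ℝ) ^ n ≤ (5 ^ n) ^ Module.finrank ℝ E :=
      le_self_pow₀ (one_le_pow₀ (by norm_num)) Module.finrank_pos.ne'
    rw [div_lt_iff₀ (by positivity)] at hn
    nlinarith [mul_le_mul_of_nonneg_right h2 (by positivity : 0 ≤ β * v)]
  -- At the initial scale `F > β' > β` on the whole ball, so the search does not stop there and a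
  -- preceding scale exists.
  have hpos : Nat.find hex ≠ 0 := by
    intro h
    have h1 := Nat.find_spec hex
    rw [h] at h1
    simp only [pow_zero, one_mul] at h1
    have h2 : β' * v ≤ ∫ y in Metric.closedBall x ε, F y := by
      have := setIntegral_mono_on (μ := volume) (s := Metric.closedBall x ε) (f := fun _ => β')
        (g := F) (by simp [integrableOn_const_iff, measure_closedBall_lt_top]) hi.integrableOn
        measurableSet_closedBall fun y hy => (hball y hy).le
      simpa [mul_comm, hv] using this
    nlinarith
  obtain ⟨n, hn⟩ := Nat.exists_eq_succ_of_ne_zero hpos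
  have hlt := Nat.find_min hex (m := n) (by omega)
  have hsp := Nat.find_spec hex
  rw [hn, Nat.succ_eq_add_one, pow_succ', mul_assoc] at hsp
  exact ⟨5 ^ n * ε, by positivity, (not_le.1 hlt).le, hsp⟩

/-- The gap `β < γ` leaves room for a compact level set `{γ ≤ F}` inside the open set `{β < F}`, so
finitely many balls suffice. Finiteness matters later: the operator is only assumed additive, so
infinite sums of bad parts could not be passed through it. -/
lemma exists_stopping_family [Nontrivial E] {F : E → ℝ} (hF : Continuous F) (h0 : ∀ x, 0 ≤ F x)
    (hc : HasCompactSupport F) {β γ : ℝ} (hβ : 0 < β) (hγ : β < γ) :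
    ∃ (u : Finset E) (r : E → ℝ),
      (∀ i ∈ u, 0 < r i ∧
        β * volume.real (Metric.closedBall i (r i)) ≤ ∫ y in Metric.closedBall i (r i), F y ∧
        ∫ y in Metric.closedBall i (5 * r i), F y ≤
          β * volume.real (Metric.closedBall i (5 * r i))) ∧
      (u : Set E).PairwiseDisjoint (fun i => Metric.closedBall i (r i)) ∧
      ∀ x, γ ≤ F x → ∃ i ∈ u, x ∈ Metric.closedBall i (5 * r i) := by
  classical
  have hi : Integrable F := hF.integrable_of_hasCompactSupport hc
  have hK : IsCompact {x | γ ≤ F x} := by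
    refine hc.isCompact.of_isClosed_subset (isClosed_le continuous_const hF) fun x hx => ?_
    exact subset_tsupport F (ne_of_gt (hβ.trans (hγ.trans_le hx)))
  choose! r hr using fun x (hx : β < F x) => exists_stopping_ball hF h0 hi hβ hx
  obtain ⟨t, htK, htc⟩ := hK.elim_nhds_subcover (fun x => Metric.closedBall x (r x))
    fun x hx => Metric.closedBall_mem_nhds x (hr x (hγ.trans_le hx)).1
  obtain ⟨R, hR⟩ := (t.image r).bddAbove
  obtain ⟨u, hut, hud, huc⟩ := Vitali.exists_disjoint_subfamily_covering_enlargement_closedBall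
    (t : Set E) (fun x => x) r R (fun a ha => hR (by simpa using ⟨a, ha, rfl⟩)) 5 (by norm_num)
  have hfin : u.Finite := t.finite_toSet.subset hut
  refine ⟨hfin.toFinset, r, fun i hi => hr i ?_, by simpa using hud, fun x hx => ?_⟩
  · exact hγ.trans_le (htK i (hut (by simpa using hi)))
  · obtain ⟨a, ha, hxa⟩ := Set.mem_iUnion₂.1 (htc hx)
    obtain ⟨b, hb, hab⟩ := huc a ha
    exact ⟨b, by simpa using hb, hab hxa⟩

end CalderonZygmund
-- The decomposition into good and bad parts.
section CalderonZygmund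

set_option linter.unusedSectionVars false

variable {E : Type*} [NormedAddCommGroup E] [InnerProductSpace ℝ E] [FiniteDimensional ℝ E]
  [MeasurableSpace E] [BorelSpace E]

/-- Each indicator is divided by the number of sets covering the point. This replaces the
disjointness of dyadic cubes, since the enlarged balls may overlap. -/
lemma exists_measurable_partition {ι X : Type*} [MeasurableSpace X] (u : Finset ι) (S : ι → Set X)
    (hS : ∀ i ∈ u, MeasurableSet (S i)) :
    ∃ φ : ι → X → ℝ, (∀ i ∈ u, Measurable (φ i)) ∧ (∀ i x, 0 ≤ φ i x) ∧
      (∀ i x, φ i x ≤ (S i).indicator 1 x) ∧ (∀ x, ∑ i ∈ u, φ i x ≤ 1) ∧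
      ∀ i ∈ u, ∀ x ∈ S i, ∑ i ∈ u, φ i x = 1 := by
  classical
  have hind : ∀ i x, (0 : ℝ) ≤ (S i).indicator 1 x := fun i x =>
    Set.indicator_nonneg (fun _ _ => zero_le_one) x
  have hN : ∀ x, (0 : ℝ) ≤ ∑ j ∈ u, (S j).indicator 1 x := fun x =>
    Finset.sum_nonneg fun j _ => hind j x
  have hN1 : ∀ i ∈ u, ∀ x ∈ S i, (1 : ℝ) ≤ ∑ j ∈ u, (S j).indicator 1 x := fun i hi x hx => by
    have := Finset.single_le_sum (f := fun j => (S j).indicator (1 : X → ℝ) x)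
      (fun j _ => hind j x) hi
    simpa [hx] using this
  refine ⟨fun i x => if i ∈ u then (S i).indicator 1 x / ∑ j ∈ u, (S j).indicator 1 x else 0,
    fun i hi => ?_, fun i x => ?_, fun i x => ?_, fun x => ?_, fun i hi x hx => ?_⟩
  · simp only [hi, if_true]
    exact (measurable_one.indicator (hS i hi)).div
      (Finset.measurable_fun_sum _ fun j hj => measurable_one.indicator (hS j hj))
  · dsimp only
    split_ifs
    · exact div_nonneg (hind i x) (hN x)
    · rfl
  · dsimp only
    split_ifs with h
    · by_cases hx : x ∈ S i
      · exact div_le_self (hind i x) (hN1 i h x hx)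
      · simp [hx]
    · exact hind i x
  · rw [Finset.sum_congr rfl fun i hi => if_pos hi, ← Finset.sum_div]
    exact div_self_le_one _
  · rw [Finset.sum_congr rfl fun i hi => if_pos hi, ← Finset.sum_div]
    exact div_self (by linarith [hN1 i hi x hx])

/-- The Calderón–Zygmund decomposition of a continuous function with compact support at
height `t`, with bad parts carried by balls. -/
lemma exists_calderonZygmund_decomposition [Nontrivial E] {f : E → ℝ} (hf : Continuous f)
    (hc : HasCompactSupport f) {t : ℝ} (ht : 0 < t) :
    ∃ (u : Finset E) (r : E → ℝ) (g : E → ℝ) (b : E → E → ℝ), IsTest g ∧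
      (∀ i ∈ u, 0 < r i ∧ IsTest (b i) ∧
        Function.support (b i) ⊆ Metric.closedBall i (5 * r i) ∧ ∫ x, b i x = 0) ∧
      f = g + ∑ i ∈ u, b i ∧
      ∑ i ∈ u, volume.real (Metric.closedBall i (r i)) ≤
        8 / t * ∫ x in {x | t / 8 < |f x|}, |f x| ∧
      ∑ i ∈ u, ∫ x, |b i x| ≤
        2 * (1 + 5 ^ Module.finrank ℝ E) * ∫ x in {x | t / 8 < |f x|}, |f x| ∧
      ∫⁻ x, ‖g x‖ₑ ^ 2 ≤ (∫⁻ x in {x | |f x| ≤ t}, ‖f x‖ₑ ^ 2) +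
        ENNReal.ofReal ((5 ^ Module.finrank ℝ E * (t / 4)) ^ 2 *
          ∑ i ∈ u, volume.real (Metric.closedBall i (r i))) := by
  classical
  have hfi : Integrable f := hf.integrable_of_hasCompactSupport hc
  have hft := IsTest.of_continuous hf hc
  -- The levels are `t/8 < t/4 < t/2 < t`. Cutting `|f|` at `t/8` leaves a remainder of at most
  -- `t/8` per unit volume, which half of the lower average `t/4` absorbs; off the enlarged balls
  -- `|f| < t/2`, which is below `t`.
  obtain ⟨u, r, hr, hdisj, hcov⟩ := exists_stopping_family (F := fun x => |f x|) hf.abs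
    (fun x => abs_nonneg _) hc.norm (β := t / 4) (γ := t / 2) (by positivity) (by linarith)
  set D : ℝ := 5 ^ Module.finrank ℝ E with hD
  have hDpos : 0 < D := by positivity
  set B : E → Set E := fun i => Metric.closedBall i (r i) with hB
  set B' : E → Set E := fun i => Metric.closedBall i (5 * r i) with hB'
  have hBB' : ∀ i ∈ u, B i ⊆ B' i := fun i hi =>
    Metric.closedBall_subset_closedBall (by linarith [(hr i hi).1])
  set I : ℝ := ∫ x in {x | t / 8 < |f x|}, |f x| with hI
  set V : ℝ := ∑ i ∈ u, volume.real (B i) with hV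
  have hmL : MeasurableSet {x | t / 8 < |f x|} := measurableSet_lt measurable_const hf.abs.measurable
  have hIint : Integrable ({x | t / 8 < |f x|}.indicator fun x => |f x|) :=
    hfi.abs.indicator hmL
  have hIeq : I = ∫ x, ({x | t / 8 < |f x|}.indicator fun x => |f x|) x :=
    (integral_indicator hmL).symm
  have hsplit : ∀ x, |f x| ≤ ({x | t / 8 < |f x|}.indicator fun x => |f x|) x + t / 8 := by
    intro x
    by_cases h : t / 8 < |f x|
    · rw [Set.indicator_of_mem (by exact h)]; linarith
    · rw [Set.indicator_of_notMem (by exact h)]; linarith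
  have hBm : ∀ i, MeasurableSet (B i) := fun i => measurableSet_closedBall
  have hB'm : ∀ i, MeasurableSet (B' i) := fun i => measurableSet_closedBall
  have hBi : ∀ i, Integrable ((B i).indicator (1 : E → ℝ)) := fun i =>
    (IsTest.indicator_closedBall 1 i (r i)).integrable
  have hB'i : ∀ i, Integrable ((B' i).indicator (1 : E → ℝ)) := fun i =>
    (IsTest.indicator_closedBall 1 i (5 * r i)).integrable
  have hBint : ∀ i, ∫ x, (B i).indicator (1 : E → ℝ) x = volume.real (B i) := fun i =>
    integral_indicator_one (hBm i)
  have hB'int : ∀ i, ∫ x, (B' i).indicator (1 : E → ℝ) x = D * volume.real (B i) := fun i => by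
    rw [integral_indicator_one (hB'm i)]
    exact volume_real_closedBall_mul i (by norm_num) _
  have hdisj1 : ∀ x, ∑ i ∈ u, (B i).indicator (1 : E → ℝ) x ≤ 1 := by
    intro x
    by_cases h : ∃ i ∈ u, x ∈ B i
    · obtain ⟨i, hi, hx⟩ := h
      rw [Finset.sum_eq_single_of_mem i hi]
      · simp [hx]
      · intro j hj hji
        exact Set.indicator_of_notMem (fun hxj => Set.disjoint_left.1 (hdisj hj hi hji) hxj hx) _
    · push Not at h
      rw [Finset.sum_eq_zero fun i hi => Set.indicator_of_notMem (h i hi) _]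
      exact zero_le_one
  have hVI : V ≤ 8 / t * I := by
    have h1 : t / 4 * V ≤ ∑ i ∈ u, ∫ x, (B i).indicator (1 : E → ℝ) x * |f x| := by
      rw [hV, Finset.mul_sum]
      refine Finset.sum_le_sum fun i hi => ((hr i hi).2.1).trans_eq ?_
      rw [← integral_indicator (hBm i)]
      refine integral_congr_ae (Eventually.of_forall fun x => ?_)
      by_cases hx : x ∈ B i <;> simp [hx]
    have hint : ∀ i ∈ u, Integrable fun x => (B i).indicator (1 : E → ℝ) x * |f x| := fun i _ => by
      refine (hfi.abs.indicator (hBm i)).congr (Eventually.of_forall fun x => ?_)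
      by_cases hx : x ∈ B i <;> simp [hx]
    rw [← integral_finsetSum _ hint] at h1
    have h2 : ∫ x, ∑ i ∈ u, (B i).indicator (1 : E → ℝ) x * |f x| ≤
        ∫ x, (({x | t / 8 < |f x|}.indicator fun x => |f x|) x +
          t / 8 * ∑ i ∈ u, (B i).indicator (1 : E → ℝ) x) := by
      refine integral_mono (integrable_finsetSum _ hint)
        (hIint.add ((integrable_finsetSum _ fun i _ => hBi i).const_mul _)) fun x => ?_
      dsimp only
      rw [← Finset.sum_mul]
      have h3 := hdisj1 x
      have h4 : 0 ≤ ∑ i ∈ u, (B i).indicator (1 : E → ℝ) x :=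
        Finset.sum_nonneg fun i _ => Set.indicator_nonneg (fun _ _ => zero_le_one) x
      have h5 := hsplit x
      have h6 : 0 ≤ ({x | t / 8 < |f x|}.indicator fun x => |f x|) x :=
        Set.indicator_nonneg (fun _ _ => abs_nonneg _) x
      nlinarith
    rw [integral_add hIint ((integrable_finsetSum _ fun i _ => hBi i).const_mul _),
      integral_const_mul, integral_finsetSum _ fun i _ => hBi i, ← hIeq] at h2
    simp only [hBint] at h2
    have h3 : t / 8 * V ≤ I := by linarith
    rw [div_mul_eq_mul_div, le_div_iff₀ ht]
    linarith
  obtain ⟨φ, hφm, hφ0, hφ1, hφs, hφe⟩ := exists_measurable_partition u B' fun i _ => hB'm i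
  have hφle : ∀ i x, |φ i x| ≤ 1 := fun i x => by
    rw [abs_of_nonneg (hφ0 i x)]
    exact (hφ1 i x).trans (Set.indicator_le_self' (fun _ _ => zero_le_one) x)
  have hfφ : ∀ i ∈ u, IsTest fun x => f x * φ i x := fun i hi => hft.mul (hφm i hi) (hφle i)
  -- The mass of `f φᵢ`, spread over the enlarged ball, is put back on the small ball. The small
  -- balls are disjoint, so the compensating constants do not add up, at the price of the volume
  -- ratio `D` in their size.
  set c : E → ℝ := fun i => (∫ x, f x * φ i x) / volume.real (B i) with hcdef
  have hvB : ∀ i ∈ u, 0 < volume.real (B i) := fun i hi =>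
    volume_real_closedBall_pos i (hr i hi).1
  have hcle : ∀ i ∈ u, |c i| ≤ D * (t / 4) := by
    intro i hi
    rw [hcdef]
    dsimp only
    rw [abs_div, abs_of_pos (hvB i hi), div_le_iff₀ (hvB i hi)]
    calc |∫ x, f x * φ i x| ≤ ∫ x, |f x * φ i x| := abs_integral_le_integral_abs
      _ ≤ ∫ x, (B' i).indicator (fun x => |f x|) x := by
          refine integral_mono (hfφ i hi).integrable.abs (hfi.abs.indicator (hB'm i)) fun x => ?_
          dsimp only
          rw [abs_mul, abs_of_nonneg (hφ0 i x)]
          have := hφ1 i x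
          by_cases hx : x ∈ B' i
          · simp only [hx, Set.indicator_of_mem, Pi.one_apply] at this ⊢
            exact mul_le_of_le_one_right (abs_nonneg _) this
          · simp only [hx, not_false_eq_true, Set.indicator_of_notMem] at this ⊢
            rw [le_antisymm this (hφ0 i x), mul_zero]
      _ ≤ t / 4 * volume.real (B' i) := by
          rw [integral_indicator (hB'm i)]; exact (hr i hi).2.2
      _ = D * (t / 4) * volume.real (B i) := by
          rw [hB', volume_real_closedBall_mul i (by norm_num)]; ring
  set b : E → E → ℝ := fun i x => f x * φ i x - (B i).indicator (fun _ => c i) x with hb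
  set g : E → ℝ := f - ∑ i ∈ u, b i with hg
  have hbt : ∀ i ∈ u, IsTest (b i) := fun i hi =>
    (hfφ i hi).sub (IsTest.indicator_closedBall (c i) i (r i))
  refine ⟨u, r, g, b, hft.sub (IsTest.sum u hbt), fun i hi => ⟨(hr i hi).1, hbt i hi, ?_, ?_⟩,
    by rw [hg, sub_add_cancel], hVI, ?_, ?_⟩
  · intro x hx
    by_contra hxB
    apply hx
    have h1 : x ∉ B i := fun h => hxB (hBB' i hi h)
    have h2 := hφ1 i x
    rw [Set.indicator_of_notMem (by exact hxB)] at h2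
    simp [hb, h1, le_antisymm h2 (hφ0 i x)]
  · rw [hb]
    dsimp only
    rw [integral_sub (hfφ i hi).integrable
      (IsTest.indicator_closedBall (c i) i (r i)).integrable, integral_indicator (hBm i),
      setIntegral_const, hcdef, smul_eq_mul, mul_div_cancel₀ _ (hvB i hi).ne', sub_self]
  · have h1 : ∀ i ∈ u, ∫ x, |b i x| ≤ 2 * ∫ x, |f x| * φ i x := by
      intro i hi
      have hfφa : Integrable fun x => |f x| * φ i x :=
        (hfφ i hi).integrable.abs.congr (Eventually.of_forall fun x => by
          simp [abs_mul, abs_of_nonneg (hφ0 i x)])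
      have h2 : |c i| * volume.real (B i) ≤ ∫ x, |f x| * φ i x := by
        rw [hcdef]
        dsimp only
        rw [abs_div, abs_of_pos (hvB i hi), div_mul_cancel₀ _ (hvB i hi).ne']
        refine abs_integral_le_integral_abs.trans_eq (integral_congr_ae
          (Eventually.of_forall fun x => ?_))
        simp [abs_mul, abs_of_nonneg (hφ0 i x)]
      calc ∫ x, |b i x| ≤ ∫ x, (|f x| * φ i x + (B i).indicator (fun _ => |c i|) x) := by
            refine integral_mono (hbt i hi).integrable.abs
              (hfφa.add (IsTest.indicator_closedBall |c i| i (r i)).integrable) fun x => ?_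
            dsimp only [hb]
            refine (abs_sub _ _).trans (add_le_add (le_of_eq ?_) (le_of_eq ?_))
            · rw [abs_mul, abs_of_nonneg (hφ0 i x)]
            · by_cases hx : x ∈ B i <;> simp [hx]
        _ ≤ 2 * ∫ x, |f x| * φ i x := by
            rw [integral_add hfφa (IsTest.indicator_closedBall |c i| i (r i)).integrable,
              integral_indicator (hBm i), setIntegral_const, smul_eq_mul]
            linarith
    have hfφa : ∀ i ∈ u, Integrable fun x => |f x| * φ i x := fun i hi =>
      (hfφ i hi).integrable.abs.congr (Eventually.of_forall fun x => by
        simp [abs_mul, abs_of_nonneg (hφ0 i x)])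
    have h2 : ∑ i ∈ u, ∫ x, |f x| * φ i x ≤ I + t / 8 * (D * V) := by
      rw [← integral_finsetSum _ hfφa]
      calc ∫ x, ∑ i ∈ u, |f x| * φ i x ≤
          ∫ x, (({x | t / 8 < |f x|}.indicator fun x => |f x|) x +
            t / 8 * ∑ i ∈ u, (B' i).indicator (1 : E → ℝ) x) := by
            refine integral_mono (integrable_finsetSum _ hfφa)
              (hIint.add ((integrable_finsetSum _ fun i _ => hB'i i).const_mul _)) fun x => ?_
            dsimp only
            rw [← Finset.mul_sum]
            have h3 := hφs x
            have h4 : ∑ i ∈ u, φ i x ≤ ∑ i ∈ u, (B' i).indicator (1 : E → ℝ) x :=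
              Finset.sum_le_sum fun i _ => hφ1 i x
            have h5 := hsplit x
            have h6 : 0 ≤ ({x | t / 8 < |f x|}.indicator fun x => |f x|) x :=
              Set.indicator_nonneg (fun _ _ => abs_nonneg _) x
            have h7 : 0 ≤ ∑ i ∈ u, φ i x := Finset.sum_nonneg fun i _ => hφ0 i x
            nlinarith
        _ = I + t / 8 * (D * V) := by
            rw [integral_add hIint ((integrable_finsetSum _ fun i _ => hB'i i).const_mul _),
              integral_const_mul, integral_finsetSum _ fun i _ => hB'i i, ← hIeq]
            simp only [hB'int, hV, Finset.mul_sum]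
    have h3 : t / 8 * V ≤ I := by
      rw [div_mul_eq_mul_div, le_div_iff₀ ht] at hVI
      linarith
    calc ∑ i ∈ u, ∫ x, |b i x| ≤ ∑ i ∈ u, 2 * ∫ x, |f x| * φ i x := Finset.sum_le_sum h1
      _ ≤ 2 * (I + t / 8 * (D * V)) := by rw [← Finset.mul_sum]; linarith
      _ ≤ 2 * (1 + D) * I := by nlinarith
  -- On the union of the enlarged balls the partition sums to one and `f` cancels, which leaves at
  -- most one constant `c i`; elsewhere `g = f` and `|f| ≤ t`.
  · have hpt : ∀ x, ‖g x‖ₑ ^ 2 ≤ ({x | |f x| ≤ t}.indicator fun x => ‖f x‖ₑ ^ 2) x +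
        ∑ i ∈ u, (B i).indicator (fun _ => ENNReal.ofReal ((D * (t / 4)) ^ 2)) x := by
      intro x
      have hgx : g x = f x - ∑ i ∈ u, f x * φ i x + ∑ i ∈ u, (B i).indicator (fun _ => c i) x := by
        simp only [hg, Pi.sub_apply, Finset.sum_apply, hb, Finset.sum_sub_distrib]
        ring
      by_cases hx : ∃ i ∈ u, x ∈ B' i
      · obtain ⟨j, hj, hxj⟩ := hx
        rw [← Finset.mul_sum, hφe j hj x hxj, mul_one, sub_self, zero_add] at hgx
        refine le_trans ?_ le_add_self
        by_cases hx2 : ∃ i ∈ u, x ∈ B i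
        · obtain ⟨i, hi, hxi⟩ := hx2
          have hne : ∀ k ∈ u, k ≠ i → x ∉ B k := fun k hk hki hxk =>
            Set.disjoint_left.1 (hdisj hk hi hki) hxk hxi
          rw [hgx, Finset.sum_eq_single_of_mem i hi fun k hk hki =>
            Set.indicator_of_notMem (hne k hk hki) _, Finset.sum_eq_single_of_mem i hi
            fun k hk hki => Set.indicator_of_notMem (hne k hk hki) _,
            Set.indicator_of_mem hxi, Set.indicator_of_mem hxi, Real.enorm_eq_ofReal_abs,
            ← ENNReal.ofReal_pow (abs_nonneg _)]
          exact ENNReal.ofReal_le_ofReal (pow_le_pow_left₀ (abs_nonneg _) (hcle i hi) 2)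
        · push Not at hx2
          rw [hgx, Finset.sum_eq_zero fun i hi => Set.indicator_of_notMem (hx2 i hi) _]
          simp
      · push Not at hx
        have h1 : |f x| ≤ t := by
          by_contra hlt
          obtain ⟨i, hi, hxi⟩ := hcov x (by linarith)
          exact hx i hi hxi
        have h2 : ∀ i ∈ u, φ i x = 0 := fun i hi => by
          have := hφ1 i x
          rw [Set.indicator_of_notMem (hx i hi)] at this
          exact le_antisymm this (hφ0 i x)
        rw [Finset.sum_eq_zero fun i hi => by rw [h2 i hi, mul_zero],
          Finset.sum_eq_zero fun i hi =>
            Set.indicator_of_notMem (fun h => hx i hi (hBB' i hi h)) _, sub_zero, add_zero] at hgx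
        rw [hgx, Set.indicator_of_mem (by exact h1)]
        exact le_self_add
    have hmt : MeasurableSet {x | |f x| ≤ t} := measurableSet_le hf.abs.measurable measurable_const
    calc ∫⁻ x, ‖g x‖ₑ ^ 2 ≤ _ := lintegral_mono hpt
      _ = (∫⁻ x in {x | |f x| ≤ t}, ‖f x‖ₑ ^ 2) +
          ∑ i ∈ u, ENNReal.ofReal ((D * (t / 4)) ^ 2) * volume (B i) := by
          rw [lintegral_add_left ((hf.measurable.enorm.pow_const 2).indicator hmt),
            lintegral_indicator hmt, lintegral_finsetSum _ fun i _ =>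
              measurable_const.indicator (hBm i)]
          simp only [lintegral_indicator (hBm _), setLIntegral_const]
      _ ≤ _ := by
          rw [ENNReal.ofReal_mul (by positivity), ENNReal.ofReal_sum_of_nonneg
            fun _ _ => measureReal_nonneg, Finset.mul_sum]
          gcongr with i hi
          rw [ofReal_measureReal measure_closedBall_lt_top.ne]

end CalderonZygmund
-- The distributional inequality and interpolation.
section CalderonZygmund

set_option linter.unusedSectionVars false

variable {E : Type*} [NormedAddCommGroup E] [InnerProductSpace ℝ E] [FiniteDimensional ℝ E]
  [MeasurableSpace E] [BorelSpace E]

/-- The constant in the distributional inequality for Calderón–Zygmund operators in dimension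
`n`. -/
noncomputable def distributionConst (n : ℕ) (A : ℝ≥0) : ℝ≥0 :=
  4 * A + (2 * A * (5 ^ n) ^ 2 + 8 * 10 ^ n + 4 * A * (1 + 5 ^ n))

/-- The good part is handled by Chebyshev in `L²`, the bad parts by the cancellation estimate off
their doubled balls and by volume on them. Keeping the truncations of `f` at heights comparable to
`t`, rather than full norms, builds the interpolation into the inequality: it only remains to
integrate it in `t`. -/
lemma IsCalderonZygmund.distribution_le [Nontrivial E] {T : (E → ℝ) → E → ℝ} {A : ℝ≥0}
    (hT : IsCalderonZygmund T A) {f : E → ℝ} (hf : Continuous f) (hc : HasCompactSupport f)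
    {t : ℝ} (ht : 0 < t) :
    volume {x | t < |T f x|} ≤ distributionConst (Module.finrank ℝ E) A *
      (ENNReal.ofReal (t ^ 2)⁻¹ * (∫⁻ x in {x | |f x| ≤ t}, ‖f x‖ₑ ^ 2) +
        ENNReal.ofReal t⁻¹ * ∫⁻ x in {x | t / 8 < |f x|}, ‖f x‖ₑ) := by
  classical
  obtain ⟨u, r, g, b, hg, hb, hfgb, hV, hbI, hg2⟩ :=
    exists_calderonZygmund_decomposition hf hc ht
  set n := Module.finrank ℝ E with hn
  set I : ℝ := ∫ x in {x | t / 8 < |f x|}, |f x| with hI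
  set V : ℝ := ∑ i ∈ u, volume.real (Metric.closedBall i (r i)) with hVdef
  have hI0 : 0 ≤ I := integral_nonneg fun x => abs_nonneg _
  have hV0 : 0 ≤ V := Finset.sum_nonneg fun i _ => measureReal_nonneg
  have hIl : ∫⁻ x in {x | t / 8 < |f x|}, ‖f x‖ₑ = ENNReal.ofReal I :=
    (ofReal_integral_norm_eq_lintegral_enorm
      (hf.integrable_of_hasCompactSupport hc).integrableOn).symm
  set L := ∫⁻ x in {x | |f x| ≤ t}, ‖f x‖ₑ ^ 2 with hL
  rw [hIl]
  have hTf : T f = T g + ∑ i ∈ u, T (b i) := by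
    conv_lhs => rw [hfgb]
    rw [hT.map_add _ _ hg (IsTest.sum u fun i hi => (hb i hi).2.1),
      hT.map_sum u fun i hi => (hb i hi).2.1]
  -- The bad parts live on radius `5 * r i`, and the cancellation estimate holds off twice that
  -- radius.
  set Ω := ⋃ i ∈ u, Metric.closedBall i (10 * r i) with hΩ
  have hΩm : MeasurableSet Ω := Finset.measurableSet_biUnion u fun i _ => measurableSet_closedBall
  have hsub : {x | t < |T f x|} ⊆ {x | ENNReal.ofReal (t ^ 2 / 4) ≤ ‖T g x‖ₑ ^ 2} ∪ (Ω ∪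
      {x | ENNReal.ofReal (t / 2) ≤ Ωᶜ.indicator (fun x => ∑ i ∈ u, ‖T (b i) x‖ₑ) x}) := by
    intro x hx
    by_contra hcon
    simp only [Set.mem_union, Set.mem_ofPred_eq, not_or, not_le] at hcon
    obtain ⟨h1, h2, h3⟩ := hcon
    rw [Set.indicator_of_mem (by exact h2)] at h3
    have h4 : |T g x| < t / 2 := by
      rw [Real.enorm_eq_ofReal_abs, ← ENNReal.ofReal_pow (abs_nonneg _),
        ENNReal.ofReal_lt_ofReal_iff (by positivity)] at h1
      nlinarith [abs_nonneg (T g x)]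
    have h5 : ∑ i ∈ u, |T (b i) x| < t / 2 := by
      simp only [Real.enorm_eq_ofReal_abs] at h3
      rw [← ENNReal.ofReal_sum_of_nonneg fun _ _ => abs_nonneg _,
        ENNReal.ofReal_lt_ofReal_iff (by positivity)] at h3
      exact h3
    have h6 : |T f x| ≤ |T g x| + ∑ i ∈ u, |T (b i) x| := by
      rw [hTf, Pi.add_apply, Finset.sum_apply]
      exact (abs_add_le _ _).trans (by gcongr; exact Finset.abs_sum_le_sum_abs _ _)
    have : t < |T f x| := hx
    linarith
  have hm1 : volume {x | ENNReal.ofReal (t ^ 2 / 4) ≤ ‖T g x‖ₑ ^ 2} ≤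
      ENNReal.ofReal (4 * (t ^ 2)⁻¹) *
        (A * (L + ENNReal.ofReal ((5 ^ n * (t / 4)) ^ 2 * V))) := by
    have hpos : ENNReal.ofReal (t ^ 2 / 4) ≠ 0 := by
      simp only [ne_eq, ENNReal.ofReal_eq_zero, not_le]; positivity
    refine (meas_ge_le_lintegral_div ((hT.measurable g hg).enorm.pow_const 2).aemeasurable hpos
      ENNReal.ofReal_ne_top).trans ?_
    rw [div_eq_mul_inv, mul_comm, ← ENNReal.ofReal_inv_of_pos (by positivity)]
    gcongr
    · apply le_of_eq; field_simp
    · exact (hT.l2_bound g hg).trans (by gcongr)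
  have hm2 : volume Ω ≤ ENNReal.ofReal (10 ^ n * V) := by
    refine (measure_biUnion_finset_le u _).trans ?_
    rw [hVdef, Finset.mul_sum, ENNReal.ofReal_sum_of_nonneg fun i _ =>
      mul_nonneg (by positivity) measureReal_nonneg]
    refine Finset.sum_le_sum fun i _ => ?_
    rw [← volume_real_closedBall_mul i (by norm_num), ofReal_measureReal
      measure_closedBall_lt_top.ne]
  have hm3 : volume {x | ENNReal.ofReal (t / 2) ≤
      Ωᶜ.indicator (fun x => ∑ i ∈ u, ‖T (b i) x‖ₑ) x} ≤
      ENNReal.ofReal (2 * t⁻¹) * (A * ENNReal.ofReal (2 * (1 + 5 ^ n) * I)) := by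
    have hpos : ENNReal.ofReal (t / 2) ≠ 0 := by
      simp only [ne_eq, ENNReal.ofReal_eq_zero, not_le]; positivity
    have hmeas : ∀ i ∈ u, Measurable fun x => ‖T (b i) x‖ₑ := fun i hi =>
      (hT.measurable _ (hb i hi).2.1).enorm
    refine (meas_ge_le_lintegral_div ((Finset.measurable_fun_sum u hmeas).indicator
      hΩm.compl).aemeasurable hpos ENNReal.ofReal_ne_top).trans ?_
    rw [div_eq_mul_inv, mul_comm, ← ENNReal.ofReal_inv_of_pos (by positivity)]
    gcongr
    · apply le_of_eq; field_simp
    · rw [lintegral_indicator hΩm.compl, lintegral_finsetSum' _ fun i hi =>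
        (hmeas i hi).aemeasurable]
      calc ∑ i ∈ u, ∫⁻ x in Ωᶜ, ‖T (b i) x‖ₑ ≤ ∑ i ∈ u, A * ENNReal.ofReal (∫ x, |b i x|) := by
            refine Finset.sum_le_sum fun i hi => ?_
            have h1 := hT.cancellation i (5 * r i) (b i) (by linarith [(hb i hi).1])
              (hb i hi).2.1 (hb i hi).2.2.1 (hb i hi).2.2.2
            rw [← ofReal_integral_norm_eq_lintegral_enorm (hb i hi).2.1.integrable] at h1
            refine le_trans (lintegral_mono_set ?_) h1
            rw [Set.compl_subset_compl, ← mul_assoc]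
            norm_num
            exact Set.subset_biUnion_of_mem (u := fun i => Metric.closedBall i (10 * r i)) hi
        _ ≤ _ := by
            rw [← Finset.mul_sum, ← ENNReal.ofReal_sum_of_nonneg fun i _ =>
              integral_nonneg fun x => abs_nonneg _]
            gcongr
  have hV' : V ≤ 8 / t * I := hV
  calc volume {x | t < |T f x|} ≤ ENNReal.ofReal (4 * (t ^ 2)⁻¹) *
        (A * (L + ENNReal.ofReal ((5 ^ n * (t / 4)) ^ 2 * V))) + (ENNReal.ofReal (10 ^ n * V) +
        ENNReal.ofReal (2 * t⁻¹) * (A * ENNReal.ofReal (2 * (1 + 5 ^ n) * I))) :=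
        (measure_mono hsub).trans ((measure_union_le _ _).trans (add_le_add hm1
          ((measure_union_le _ _).trans (add_le_add hm2 hm3))))
    _ ≤ (4 * A : ℝ≥0) * (ENNReal.ofReal (t ^ 2)⁻¹ * L) +
        (2 * A * (5 ^ n) ^ 2 + 8 * 10 ^ n + 4 * A * (1 + 5 ^ n) : ℝ≥0) *
          (ENNReal.ofReal t⁻¹ * ENNReal.ofReal I) := by
        have hA : (A : ℝ≥0∞) = ENNReal.ofReal A := by simp
        have h2 : ENNReal.ofReal (4 * (t ^ 2)⁻¹) *
            (A * (L + ENNReal.ofReal ((5 ^ n * (t / 4)) ^ 2 * V))) = (4 * A : ℝ≥0) *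
            (ENNReal.ofReal (t ^ 2)⁻¹ * L) + ENNReal.ofReal (4 * (t ^ 2)⁻¹) * A *
            ENNReal.ofReal ((5 ^ n * (t / 4)) ^ 2 * V) := by
          rw [ENNReal.ofReal_mul (by norm_num)]
          push_cast
          simp only [ENNReal.ofReal_ofNat]
          ring
        rw [h2, add_assoc]
        refine add_le_add le_rfl ?_
        have h3 : ((2 * A * (5 ^ n) ^ 2 + 8 * 10 ^ n + 4 * A * (1 + 5 ^ n) : ℝ≥0) : ℝ≥0∞) =
            ENNReal.ofReal (2 * A * (5 ^ n) ^ 2 + 8 * 10 ^ n + 4 * A * (1 + 5 ^ n)) := by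
          rw [← ENNReal.ofReal_coe_nnreal]; push_cast; rfl
        rw [h3, hA, ← ENNReal.ofReal_mul (by positivity), ← ENNReal.ofReal_mul (by positivity),
          ← ENNReal.ofReal_mul (by positivity), ← ENNReal.ofReal_mul (by positivity),
          ← ENNReal.ofReal_mul (by positivity), ← ENNReal.ofReal_mul (by positivity),
          ← ENNReal.ofReal_add (by positivity) (by positivity),
          ← ENNReal.ofReal_add (by positivity) (by positivity)]
        refine ENNReal.ofReal_le_ofReal ?_
        have e1 : 4 * (t ^ 2)⁻¹ * A * ((5 ^ n * (t / 4)) ^ 2 * V) = A * (5 ^ n) ^ 2 / 4 * V := by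
          field_simp
        have e2 : A * (5 ^ n) ^ 2 / 4 * V ≤ A * (5 ^ n) ^ 2 / 4 * (8 / t * I) := by gcongr
        have e3 : (10 : ℝ) ^ n * V ≤ 10 ^ n * (8 / t * I) := by gcongr
        rw [e1]
        calc _ ≤ A * (5 ^ n) ^ 2 / 4 * (8 / t * I) + (10 ^ n * (8 / t * I) +
              2 * t⁻¹ * (A * (2 * (1 + 5 ^ n) * I))) := by gcongr
          _ = _ := by field_simp; ring
    _ ≤ _ := by
        refine (add_le_add (mul_le_mul_left (ENNReal.coe_le_coe.2 ?_) _)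
          (mul_le_mul_left (ENNReal.coe_le_coe.2 ?_) _)).trans_eq (mul_add _ _ _).symm
        · exact le_self_add
        · exact le_add_self

/-- Integration of a distributional inequality: the diagonal case of real interpolation between
weak type `(1, 1)` and strong type `(2, 2)`. -/
lemma lintegral_rpow_le_of_distribution_le {X : Type*} [MeasurableSpace X] {μ : Measure X}
    [SFinite μ] {f F : X → ℝ} (hf : Measurable f) (hF : Measurable F) {K : ℝ≥0} {p : ℝ}
    (hp1 : 1 < p) (hp2 : p < 2)
    (h : ∀ t : ℝ, 0 < t → μ {x | t < |F x|} ≤ K *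
      (ENNReal.ofReal (t ^ 2)⁻¹ * (∫⁻ x in {x | |f x| ≤ t}, ‖f x‖ₑ ^ 2 ∂μ) +
        ENNReal.ofReal t⁻¹ * ∫⁻ x in {x | t / 8 < |f x|}, ‖f x‖ₑ ∂μ)) :
    ∫⁻ x, ENNReal.ofReal (|F x| ^ p) ∂μ ≤
      ENNReal.ofReal (p * K * ((2 - p)⁻¹ + 8 ^ (p - 1) / (p - 1))) *
        ∫⁻ x, ENNReal.ofReal (|f x| ^ p) ∂μ := by
  have hp0 : 0 < p := by linarith
  have hS1 : MeasurableSet {q : ℝ × X | |f q.2| ≤ q.1} :=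
    measurableSet_le (by fun_prop) measurable_fst
  have hS2 : MeasurableSet {q : ℝ × X | q.1 / 8 < |f q.2|} :=
    measurableSet_lt (by fun_prop) (by fun_prop)
  -- By Tonelli, `t` runs over `[|f x|, ∞)`; the integral of `t ^ (p - 3)` converges at infinity
  -- because `p < 2`.
  have hT1 : ∫⁻ t in Set.Ioi (0 : ℝ), ENNReal.ofReal (t ^ (p - 3)) *
      (∫⁻ x in {x | |f x| ≤ t}, ‖f x‖ₑ ^ 2 ∂μ) =
      ENNReal.ofReal (2 - p)⁻¹ * ∫⁻ x, ENNReal.ofReal (|f x| ^ p) ∂μ := by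
    have e1 : ∀ t : ℝ, ENNReal.ofReal (t ^ (p - 3)) * (∫⁻ x in {x | |f x| ≤ t}, ‖f x‖ₑ ^ 2 ∂μ) =
        ∫⁻ x, ({q : ℝ × X | |f q.2| ≤ q.1}.indicator
          fun q => ENNReal.ofReal (q.1 ^ (p - 3)) * ‖f q.2‖ₑ ^ 2) (t, x) ∂μ := by
      intro t
      rw [← lintegral_const_mul _ (by fun_prop), ← lintegral_indicator
        (measurableSet_le hf.abs measurable_const)]
      rfl
    simp_rw [e1]
    rw [lintegral_lintegral_swap (by
      refine (Measurable.indicator ?_ hS1).aemeasurable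
      fun_prop), ← lintegral_const_mul _ (by fun_prop)]
    refine lintegral_congr fun x => ?_
    rcases eq_or_ne (f x) 0 with hx | hx
    · have : ∀ t : ℝ, ({q : ℝ × X | |f q.2| ≤ q.1}.indicator
          fun q => ENNReal.ofReal (q.1 ^ (p - 3)) * ‖f q.2‖ₑ ^ 2) (t, x) = 0 := fun t => by
        simp [Set.indicator, hx]
      simp [this, hx, Real.zero_rpow hp0.ne']
    · have hfx : 0 < |f x| := abs_pos.2 hx
      have : ∀ t : ℝ, ({q : ℝ × X | |f q.2| ≤ q.1}.indicator
          fun q => ENNReal.ofReal (q.1 ^ (p - 3)) * ‖f q.2‖ₑ ^ 2) (t, x) =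
          (Set.Ici |f x|).indicator (fun t => ENNReal.ofReal (t ^ (p - 3)) * ‖f x‖ₑ ^ 2) t :=
        fun t => rfl
      simp_rw [this]
      rw [lintegral_indicator measurableSet_Ici, Measure.restrict_restrict measurableSet_Ici,
        Set.inter_eq_left.2 (show Set.Ici |f x| ⊆ Set.Ioi 0 from fun t ht => hfx.trans_le ht), lintegral_mul_const _ (by fun_prop),
        setLIntegral_congr Ioi_ae_eq_Ici.symm, ← ofReal_integral_eq_lintegral_ofReal
          (integrableOn_Ioi_rpow_of_lt (by linarith) hfx)
          ((ae_restrict_mem measurableSet_Ioi).mono fun t ht =>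
            Real.rpow_nonneg (hfx.trans ht).le _),
        integral_Ioi_rpow_of_lt (by linarith) hfx, Real.enorm_eq_ofReal_abs,
        ← ENNReal.ofReal_pow (abs_nonneg _), ← ENNReal.ofReal_mul
          (by
            rw [neg_div, ← div_neg]
            exact div_nonneg (by positivity) (by linarith)),
        ← ENNReal.ofReal_mul (by rw [inv_nonneg]; linarith)]
      congr 1
      have e2 : |f x| ^ p = |f x| ^ (p - 3 + 1) * |f x| ^ 2 := by
        rw [← Real.rpow_natCast, ← Real.rpow_add hfx]
        congr 1; push_cast; ring
      rw [e2]
      have : p - 3 + 1 ≠ 0 := by linarith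
      have : 2 - p ≠ 0 := by linarith
      field_simp
      ring
  -- Here `t` runs over `(0, 8 |f x|)`; the integral of `t ^ (p - 2)` converges at zero because `p >
  -- 1`.
  have hT2 : ∫⁻ t in Set.Ioi (0 : ℝ), ENNReal.ofReal (t ^ (p - 2)) *
      (∫⁻ x in {x | t / 8 < |f x|}, ‖f x‖ₑ ∂μ) =
      ENNReal.ofReal (8 ^ (p - 1) / (p - 1)) * ∫⁻ x, ENNReal.ofReal (|f x| ^ p) ∂μ := by
    have e1 : ∀ t : ℝ, ENNReal.ofReal (t ^ (p - 2)) * (∫⁻ x in {x | t / 8 < |f x|}, ‖f x‖ₑ ∂μ) =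
        ∫⁻ x, ({q : ℝ × X | q.1 / 8 < |f q.2|}.indicator
          fun q => ENNReal.ofReal (q.1 ^ (p - 2)) * ‖f q.2‖ₑ) (t, x) ∂μ := by
      intro t
      rw [← lintegral_const_mul _ (by fun_prop), ← lintegral_indicator
        (measurableSet_lt measurable_const hf.abs)]
      rfl
    simp_rw [e1]
    rw [lintegral_lintegral_swap (by
      refine (Measurable.indicator ?_ hS2).aemeasurable
      fun_prop), ← lintegral_const_mul _ (by fun_prop)]
    refine lintegral_congr fun x => ?_
    have : ∀ t : ℝ, ({q : ℝ × X | q.1 / 8 < |f q.2|}.indicator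
        fun q => ENNReal.ofReal (q.1 ^ (p - 2)) * ‖f q.2‖ₑ) (t, x) =
        (Set.Iio (8 * |f x|)).indicator (fun t => ENNReal.ofReal (t ^ (p - 2)) * ‖f x‖ₑ) t := by
      intro t
      simp only [Set.indicator, Set.mem_ofPred_eq, Set.mem_Iio]
      congr 1
      rw [div_lt_iff₀ (by norm_num), mul_comm]
    simp_rw [this]
    rw [lintegral_indicator measurableSet_Iio, Measure.restrict_restrict measurableSet_Iio,
      Set.Iio_inter_Ioi, lintegral_mul_const _ (by fun_prop),
      setLIntegral_congr Ioo_ae_eq_Ioc, ← ofReal_integral_eq_lintegral_ofReal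
        ((intervalIntegrable_iff_integrableOn_Ioc_of_le (by positivity)).1
          (intervalIntegral.intervalIntegrable_rpow' (by linarith)))
        ((ae_restrict_mem measurableSet_Ioc).mono fun t ht => Real.rpow_nonneg ht.1.le _),
      ← intervalIntegral.integral_of_le (by positivity),
      integral_rpow (Or.inl (by linarith)), Real.zero_rpow (by linarith), sub_zero,
      Real.enorm_eq_ofReal_abs, ← ENNReal.ofReal_mul
        (div_nonneg (by positivity) (by linarith)),
      ← ENNReal.ofReal_mul (div_nonneg (by positivity) (by linarith))]
    congr 1
    rcases eq_or_ne (f x) 0 with hx | hx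
    · simp [hx, Real.zero_rpow hp0.ne']
    have hfx : 0 < |f x| := abs_pos.2 hx
    have e2 : |f x| ^ p = |f x| ^ (p - 1) * |f x| := by
      rw [← Real.rpow_add_one hfx.ne']; congr 1; ring
    rw [e2, Real.mul_rpow (by norm_num) hfx.le]
    have e3 : p - 2 + 1 = p - 1 := by ring
    rw [e3]
    ring
  rw [lintegral_rpow_eq_lintegral_meas_lt_mul μ (Eventually.of_forall fun x => abs_nonneg _)
    (by fun_prop) hp0]
  have hL1 : Measurable fun t : ℝ => ∫⁻ x in {x | |f x| ≤ t}, ‖f x‖ₑ ^ 2 ∂μ := by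
    have e1 : ∀ t : ℝ, (∫⁻ x in {x | |f x| ≤ t}, ‖f x‖ₑ ^ 2 ∂μ) =
        ∫⁻ x, ({q : ℝ × X | |f q.2| ≤ q.1}.indicator fun q => ‖f q.2‖ₑ ^ 2) (t, x) ∂μ := by
      intro t
      rw [← lintegral_indicator (measurableSet_le hf.abs measurable_const)]
      rfl
    simp_rw [e1]
    exact (Measurable.indicator (by fun_prop) hS1).lintegral_prod_right'
  calc ENNReal.ofReal p * ∫⁻ t in Set.Ioi 0, μ {x | t < |F x|} * ENNReal.ofReal (t ^ (p - 1))
      ≤ ENNReal.ofReal p * ∫⁻ t in Set.Ioi 0, K * (ENNReal.ofReal (t ^ (p - 3)) *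
        (∫⁻ x in {x | |f x| ≤ t}, ‖f x‖ₑ ^ 2 ∂μ) + ENNReal.ofReal (t ^ (p - 2)) *
        (∫⁻ x in {x | t / 8 < |f x|}, ‖f x‖ₑ ∂μ)) := by
        gcongr ENNReal.ofReal p * ?_
        refine setLIntegral_mono' measurableSet_Ioi fun t ht => ?_
        have ht0 : 0 < t := ht
        refine (mul_le_mul_left (h t ht0) _).trans_eq ?_
        have e3 : ENNReal.ofReal (t ^ (p - 3)) =
            ENNReal.ofReal (t ^ 2)⁻¹ * ENNReal.ofReal (t ^ (p - 1)) := by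
          rw [← ENNReal.ofReal_mul (by positivity), ← Real.rpow_natCast, ← Real.rpow_neg ht0.le,
            ← Real.rpow_add ht0]
          congr 2; push_cast; ring
        have e4 : ENNReal.ofReal (t ^ (p - 2)) =
            ENNReal.ofReal t⁻¹ * ENNReal.ofReal (t ^ (p - 1)) := by
          rw [← ENNReal.ofReal_mul (by positivity), ← Real.rpow_neg_one, ← Real.rpow_add ht0]
          congr 2; ring
        rw [e3, e4]
        ring
    _ = _ := by
        rw [lintegral_const_mul' _ _ ENNReal.coe_ne_top, lintegral_add_left (by fun_prop), hT1, hT2,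
          ← add_mul, ← ENNReal.ofReal_add (by rw [inv_nonneg]; linarith)
            (div_nonneg (by positivity) (by linarith)), ← mul_assoc, ← mul_assoc]
        congr 1
        rw [ENNReal.ofReal_mul (by positivity), ENNReal.ofReal_mul hp0.le]
        simp

end CalderonZygmund
-- Superpositions of translations: approximation and duality.
section Superposition

set_option linter.unusedSectionVars false

variable {E : Type*} [NormedAddCommGroup E] [InnerProductSpace ℝ E] [FiniteDimensional ℝ E]
  [MeasurableSpace E] [BorelSpace E] {W : Type*} [MeasurableSpace W]

/-- The superposition `f ↦ ∫ s(w) f(· + Y(w)) π(dw)` of translations. -/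
noncomputable def superpose (π : Measure W) (s : W → ℝ) (Y : W → E) (f : E → ℝ) (x : E) : ℝ :=
  ∫ w, s w * f (x + Y w) ∂π

variable {π : Measure W} [SFinite π] {s : W → ℝ} {Y : W → E}

lemma integrable_superpose (hs : Integrable s π) (hY : Measurable Y) {f : E → ℝ}
    (hf : Measurable f) {C : ℝ} (hC : ∀ x, |f x| ≤ C) (x : E) :
    Integrable (fun w => s w * f (x + Y w)) π :=
  hs.mul_bdd (c := C) (hf.comp (hY.const_add x)).aestronglyMeasurable
    (Eventually.of_forall fun _ => hC _)

lemma measurable_superpose (hsm : Measurable s) (hY : Measurable Y) {f : E → ℝ}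
    (hf : Measurable f) : Measurable (superpose π s Y f) := by
  have : StronglyMeasurable fun q : E × W => s q.2 * f (q.1 + Y q.2) :=
    Measurable.stronglyMeasurable (by fun_prop)
  exact this.integral_prod_right.measurable

lemma superpose_add (hs : Integrable s π) (hY : Measurable Y) {f g : E → ℝ} (hf : IsTest f)
    (hg : IsTest g) : superpose π s Y (f + g) = superpose π s Y f + superpose π s Y g := by
  ext x
  obtain ⟨C, hC⟩ := hf.bounded
  obtain ⟨D, hD⟩ := hg.bounded
  simp only [superpose, Pi.add_apply, mul_add]
  exact integral_add (integrable_superpose hs hY hf.measurable hC x)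
    (integrable_superpose hs hY hg.measurable hD x)

lemma continuous_superpose (hs : Integrable s π) (hY : Measurable Y) {f : E → ℝ}
    (hf : Continuous f) (hc : HasCompactSupport f) : Continuous (superpose π s Y f) := by
  obtain ⟨C, hC⟩ := hc.exists_bound_of_continuous hf
  refine continuous_of_dominated (bound := fun w => ‖s w‖ * C) (fun x => ?_)
    (fun x => Eventually.of_forall fun w => ?_) (hs.norm.mul_const C)
    (Eventually.of_forall fun w => by fun_prop)
  · exact (integrable_superpose hs hY hf.measurable hC x).aestronglyMeasurable
  · rw [norm_mul]
    exact mul_le_mul_of_nonneg_left (hC _) (norm_nonneg _)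

lemma eLpNorm_two_sq {X : Type*} [MeasurableSpace X] {μ : Measure X} (f : X → ℝ) :
    eLpNorm f 2 μ ^ 2 = ∫⁻ x, ‖f x‖ₑ ^ 2 ∂μ := by
  have h := eLpNorm_nnreal_pow_eq_lintegral (f := f) (μ := μ) (p := 2) (by norm_num)
  simpa using h

/-- Cauchy–Schwarz with the weight `|s|` split evenly between the factors. The constant is the total
mass of `s`, which for the truncated singular integrals is not controlled uniformly in the
truncation; it serves only to control approximation errors that tend to zero. -/
lemma eLpNorm_superpose_two_le (hsm : Measurable s) (hY : Measurable Y)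
    {f : E → ℝ} (hf : Measurable f) :
    eLpNorm (superpose π s Y f) 2 volume ≤ (∫⁻ w, ‖s w‖ₑ ∂π) * eLpNorm f 2 volume := by
  have hpt : ∀ x, ‖superpose π s Y f x‖ₑ ^ 2 ≤
      (∫⁻ w, ‖s w‖ₑ ∂π) * ∫⁻ w, ‖s w‖ₑ * ‖f (x + Y w)‖ₑ ^ 2 ∂π := by
    intro x
    have h1 : ‖superpose π s Y f x‖ₑ ≤
        ∫⁻ w, ((fun w => ‖s w‖ₑ ^ (1 / 2 : ℝ)) * fun w => ‖s w‖ₑ ^ (1 / 2 : ℝ) *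
          ‖f (x + Y w)‖ₑ) w ∂π := by
      refine (enorm_integral_le_lintegral_enorm _).trans_eq (lintegral_congr fun w => ?_)
      rw [Pi.mul_apply, ← mul_assoc, ← ENNReal.rpow_add_of_nonneg _ _ (by norm_num) (by norm_num)]
      norm_num
    have h2 := h1.trans (ENNReal.lintegral_mul_le_Lp_mul_Lq π Real.HolderConjugate.two_two
      (f := fun w => ‖s w‖ₑ ^ (1 / 2 : ℝ)) (g := fun w => ‖s w‖ₑ ^ (1 / 2 : ℝ) * ‖f (x + Y w)‖ₑ)
      (by fun_prop) (by fun_prop))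
    have h3 := pow_le_pow_left₀ (zero_le) h2 2
    rw [mul_pow, ← ENNReal.rpow_natCast (_ ^ _), ← ENNReal.rpow_natCast (_ ^ _),
      ← ENNReal.rpow_mul, ← ENNReal.rpow_mul] at h3
    refine h3.trans_eq ?_
    norm_num
    congr 1
    · refine lintegral_congr fun w => ?_
      rw [← ENNReal.rpow_natCast, ← ENNReal.rpow_mul]; norm_num
    · refine lintegral_congr fun w => ?_
      rw [mul_pow, ← ENNReal.rpow_natCast, ← ENNReal.rpow_mul]; norm_num
  rw [← ENNReal.pow_le_pow_left_iff (n := 2) two_ne_zero, mul_pow, eLpNorm_two_sq, eLpNorm_two_sq]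
  calc ∫⁻ x, ‖superpose π s Y f x‖ₑ ^ 2 ≤ _ := lintegral_mono hpt
    _ = (∫⁻ w, ‖s w‖ₑ ∂π) * ∫⁻ x, ∫⁻ w, ‖s w‖ₑ * ‖f (x + Y w)‖ₑ ^ 2 ∂π := by
        refine lintegral_const_mul _ ?_
        exact Measurable.lintegral_prod_right' (f := fun q : E × W =>
          ‖s q.2‖ₑ * ‖f (q.1 + Y q.2)‖ₑ ^ 2) (by fun_prop)
    _ = (∫⁻ w, ‖s w‖ₑ ∂π) * ∫⁻ w, ‖s w‖ₑ * (∫⁻ x, ‖f x‖ₑ ^ 2) ∂π := by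
        rw [lintegral_lintegral_swap (by fun_prop)]
        congr 1
        refine lintegral_congr fun w => ?_
        rw [lintegral_const_mul _ (by fun_prop),
          lintegral_add_right_eq_self (fun x => ‖f x‖ₑ ^ 2) (Y w)]
    _ = _ := by
        rw [lintegral_mul_const _ (by fun_prop)]; ring

lemma memLp_of_isTest {f : E → ℝ} (hf : IsTest f) (p : ℝ≥0∞) : MemLp f p volume := by
  obtain ⟨C, hC⟩ := hf.bounded
  exact hf.compact.memLp_of_bound hf.measurable.aestronglyMeasurable C (Eventually.of_forall hC)

/-- An `L²` bound on smooth functions extends to bounded measurable functions with compact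
support. -/
lemma eLpNorm_superpose_two_le_of_smooth (hsm : Measurable s) (hs : Integrable s π)
    (hY : Measurable Y) {A : ℝ≥0}
    (h : ∀ f : E → ℝ, ContDiff ℝ ∞ f → HasCompactSupport f →
      eLpNorm (superpose π s Y f) 2 volume ≤ A * eLpNorm f 2 volume)
    {f : E → ℝ} (hf : IsTest f) :
    eLpNorm (superpose π s Y f) 2 volume ≤ A * eLpNorm f 2 volume := by
  set S := ∫⁻ w, ‖s w‖ₑ ∂π with hS
  have hSt : S ≠ ⊤ := hs.hasFiniteIntegral.ne
  -- The crude mass bound `S` multiplies only the error `ε`, so it disappears in the limit and the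
  -- constant `A` survives.
  have key : ∀ ε : ℝ≥0, 0 < ε → eLpNorm (superpose π s Y f) 2 volume ≤
      A * eLpNorm f 2 volume + (A + S) * ε := by
    intro ε hε
    obtain ⟨g, hgc, hgs, hg⟩ := (memLp_of_isTest hf 2).exist_eLpNorm_sub_le (by norm_num)
      (by norm_num) (ε := ε) hε
    rw [ENNReal.ofReal_coe_nnreal] at hg
    have hgt : IsTest g := IsTest.of_continuous hgs.continuous hgc
    have hsplit : superpose π s Y f = superpose π s Y g + superpose π s Y (f - g) := by
      rw [← superpose_add hs hY hgt (hf.sub hgt), add_sub_cancel]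
    have hgf : eLpNorm g 2 volume ≤ eLpNorm f 2 volume + ε := by
      have : g = f - (f - g) := by simp
      rw [this]
      exact (eLpNorm_sub_le hf.measurable.aestronglyMeasurable
        (hf.sub hgt).measurable.aestronglyMeasurable (by norm_num)).trans (by gcongr)
    calc eLpNorm (superpose π s Y f) 2 volume
        ≤ eLpNorm (superpose π s Y g) 2 volume + eLpNorm (superpose π s Y (f - g)) 2 volume := by
          rw [hsplit]
          exact eLpNorm_add_le (measurable_superpose hsm hY hgt.measurable).aestronglyMeasurable
            (measurable_superpose hsm hY (hf.sub hgt).measurable).aestronglyMeasurable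
            (by norm_num)
      _ ≤ A * (eLpNorm f 2 volume + ε) + S * ε := by
          refine add_le_add ((h g hgs hgc).trans (by gcongr))
            ((eLpNorm_superpose_two_le hsm hY (hf.sub hgt).measurable).trans (by gcongr))
      _ = _ := by ring
  have hlim : Tendsto (fun ε : ℝ≥0 => A * eLpNorm f 2 volume + (A + S) * ε) (𝓝[>] 0)
      (𝓝 (A * eLpNorm f 2 volume + (A + S) * (0 : ℝ≥0))) := by
    refine Tendsto.mono_left ?_ nhdsWithin_le_nhds
    refine tendsto_const_nhds.add (ENNReal.Tendsto.const_mul ?_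
      (Or.inr (ENNReal.add_ne_top.2 ⟨ENNReal.coe_ne_top, hSt⟩)))
    exact (ENNReal.continuous_coe.tendsto 0)
  have := ge_of_tendsto hlim (eventually_nhdsWithin_of_forall fun ε hε => key ε hε)
  simpa using this

lemma superpose_neg_apply (g : E → ℝ) (x : E) :
    superpose π s (fun w => -Y w) g x = superpose π s Y (fun y => g (-y)) (-x) := by
  simp only [superpose, neg_add, neg_neg]

/-- The adjoint of a translation is the opposite translation. Up to the reflection `x ↦ -x` the
adjoint is thus the operator itself, so one family of bounds serves both exponents. -/
lemma integral_superpose_mul (hs : Integrable s π) (hY : Measurable Y)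
    {f g : E → ℝ} (hf : IsTest f) (hg : IsTest g) :
    ∫ x, superpose π s Y f x * g x = ∫ x, f x * superpose π s (fun w => -Y w) g x := by
  obtain ⟨C, hC⟩ := hf.bounded
  have hint : Integrable (fun q : E × W => s q.2 * f (q.1 + Y q.2) * g q.1) (volume.prod π) := by
    have h1 : Integrable (fun q : E × W => g q.1 * s q.2) (volume.prod π) := hg.integrable.mul_prod hs
    refine (h1.mul_bdd (c := C) (g := fun q : E × W => f (q.1 + Y q.2)) ?_
      (Eventually.of_forall fun q => hC _)).congr (Eventually.of_forall fun q => by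
        dsimp only; ring)
    have := hf.measurable
    exact Measurable.aestronglyMeasurable (by fun_prop)
  calc ∫ x, superpose π s Y f x * g x = ∫ x, ∫ w, s w * f (x + Y w) * g x ∂π := by
        simp only [superpose, integral_mul_const]
    _ = ∫ w, (∫ x, s w * f (x + Y w) * g x) ∂π := integral_integral_swap hint
    _ = ∫ w, (∫ x, f x * (s w * g (x + -Y w))) ∂π := by
        congr 1; ext w
        rw [← integral_add_right_eq_self (fun x => f x * (s w * g (x + -Y w))) (Y w)]
        refine integral_congr_ae (Eventually.of_forall fun x => ?_)
        simp only [add_neg_cancel_right]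
        ring
    _ = ∫ x, ∫ w, f x * (s w * g (x + -Y w)) ∂π := by
        refine (integral_integral_swap ?_).symm
        obtain ⟨D, hD⟩ := hg.bounded
        have h1 : Integrable (fun q : E × W => f q.1 * s q.2) (volume.prod π) :=
          hf.integrable.mul_prod hs
        refine (h1.mul_bdd (c := D) (g := fun q : E × W => g (q.1 + -Y q.2)) ?_
          (Eventually.of_forall fun q => hD _)).congr (Eventually.of_forall fun q => by
            simp only [Function.uncurry]; ring)
        have := hg.measurable
        exact Measurable.aestronglyMeasurable (by fun_prop)
    _ = _ := by simp only [superpose, integral_const_mul]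

lemma eLpNorm_ofReal {X : Type*} [MeasurableSpace X] {μ : Measure X} {p : ℝ} (hp : 0 < p)
    (f : X → ℝ) : eLpNorm f (ENNReal.ofReal p) μ = (∫⁻ x, ‖f x‖ₑ ^ p ∂μ) ^ (1 / p) := by
  rw [eLpNorm_eq_lintegral_rpow_enorm_toReal (by simpa using hp) ENNReal.ofReal_ne_top,
    ENNReal.toReal_ofReal hp.le]

lemma enorm_rpow_eq_ofReal_abs {p : ℝ} (hp : 0 ≤ p) (a : ℝ) :
    ‖a‖ₑ ^ p = ENNReal.ofReal (|a| ^ p) := by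
  rw [Real.enorm_eq_ofReal_abs, ENNReal.ofReal_rpow_of_nonneg (abs_nonneg _) hp]

/-- The `L^p` bound, `1 < p < 2`, for Calderón–Zygmund operators in dimension `n`. -/
noncomputable def calderonZygmundConst (n : ℕ) (A : ℝ≥0) (p : ℝ) : ℝ≥0∞ :=
  ENNReal.ofReal (p * distributionConst n A * ((2 - p)⁻¹ + 8 ^ (p - 1) / (p - 1))) ^ (1 / p)

lemma calderonZygmundConst_ne_top (n : ℕ) (A : ℝ≥0) {p : ℝ} (hp : 0 < p) :
    calderonZygmundConst n A p ≠ ⊤ :=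
  ENNReal.rpow_ne_top_of_nonneg (by positivity) ENNReal.ofReal_ne_top

lemma IsCalderonZygmund.eLpNorm_le [Nontrivial E] {T : (E → ℝ) → E → ℝ} {A : ℝ≥0}
    (hT : IsCalderonZygmund T A) {p : ℝ} (hp1 : 1 < p) (hp2 : p < 2) {f : E → ℝ}
    (hf : Continuous f) (hc : HasCompactSupport f) :
    eLpNorm (T f) (ENNReal.ofReal p) volume ≤
      calderonZygmundConst (Module.finrank ℝ E) A p * eLpNorm f (ENNReal.ofReal p) volume := by
  have hp0 : 0 < p := by linarith
  have h := lintegral_rpow_le_of_distribution_le (μ := volume) hf.measurable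
    (hT.measurable f (IsTest.of_continuous hf hc)) hp1 hp2
    (fun t ht => hT.distribution_le hf hc ht)
  rw [eLpNorm_ofReal hp0, eLpNorm_ofReal hp0, calderonZygmundConst,
    ← ENNReal.mul_rpow_of_nonneg _ _ (by positivity)]
  simp only [enorm_rpow_eq_ofReal_abs hp0.le]
  gcongr

lemma eLpNorm_comp_neg {p : ℝ≥0∞} {f : E → ℝ} (hf : Measurable f) :
    eLpNorm (fun x => f (-x)) p volume = eLpNorm f p volume :=
  eLpNorm_comp_measurePreserving (ν := volume) hf.aestronglyMeasurable
    (Measure.measurePreserving_neg volume)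

/-- Duality: `L^q` bounds on `C_c` for a superposition of translations imply `L^p` bounds for the
conjugate exponent. -/
lemma eLpNorm_superpose_le_of_conj (hsm : Measurable s) (hs : Integrable s π) (hY : Measurable Y)
    {p q : ℝ} (hpq : p.HolderConjugate q) (hp : 2 ≤ p) {C : ℝ≥0∞}
    (h : ∀ f : E → ℝ, Continuous f → HasCompactSupport f →
      eLpNorm (superpose π s Y f) (ENNReal.ofReal q) volume ≤
        C * eLpNorm f (ENNReal.ofReal q) volume)
    {f : E → ℝ} (hf : Continuous f) (hc : HasCompactSupport f) :
    eLpNorm (superpose π s Y f) (ENNReal.ofReal p) volume ≤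
      C * eLpNorm f (ENNReal.ofReal p) volume := by
  have hp0 := hpq.pos
  have hq0 := hpq.symm.pos
  set F := superpose π s Y f with hF
  have hFc : Continuous F := continuous_superpose hs hY hf hc
  set B := C * eLpNorm f (ENNReal.ofReal p) volume with hB
  have key : ∀ χ : E → ℝ, Continuous χ → HasCompactSupport χ → (∀ x, 0 ≤ χ x) →
      (∀ x, χ x ≤ 1) → (∫⁻ x, ENNReal.ofReal (|F x| ^ p * χ x)) ^ (1 / p) ≤ B := by
    intro χ hχ hχc hχ0 hχ1
    -- The extremal function for the duality of `L^p` and `L^q`, cut off by `χ` to have compact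
    -- support; `2 ≤ p` keeps `|F| ^ (p - 2)` continuous.
    set g : E → ℝ := fun x => F x * |F x| ^ (p - 2) * χ x with hg
    have hgc : Continuous g :=
      (hFc.mul (hFc.abs.rpow_const fun x => Or.inr (by linarith))).mul hχ
    have hgs : HasCompactSupport g := hχc.mul_left
    have hFg : ∀ x, F x * g x = |F x| ^ p * χ x := by
      intro x
      rcases eq_or_ne (F x) 0 with hx | hx
      · simp [hx, Real.zero_rpow hp0.ne']
      · have : |F x| ^ p = |F x| ^ 2 * |F x| ^ (p - 2) := by
          rw [← Real.rpow_natCast, ← Real.rpow_add (abs_pos.2 hx)]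
          congr 1; push_cast; ring
        rw [this, sq_abs]
        simp only [hg]
        ring
    have hgq : ∀ x, ‖g x‖ₑ ^ q ≤ ENNReal.ofReal (|F x| ^ p * χ x) := by
      intro x
      rw [enorm_rpow_eq_ofReal_abs hq0.le]
      refine ENNReal.ofReal_le_ofReal ?_
      have h1 : |g x| = |F x| ^ (p - 1) * χ x := by
        simp only [hg, abs_mul, abs_of_nonneg (hχ0 x),
          abs_of_nonneg (Real.rpow_nonneg (abs_nonneg (F x)) (p - 2))]
        rcases eq_or_ne (F x) 0 with hx | hx
        · simp [hx, Real.zero_rpow hpq.sub_one_pos.ne']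
        · congr 1
          rw [← Real.rpow_one_add' (abs_nonneg _) (by linarith)]
          congr 1; ring
      rw [h1, Real.mul_rpow (by positivity) (hχ0 x), ← Real.rpow_mul (abs_nonneg _),
        hpq.sub_one_mul_conj]
      gcongr
      exact Real.rpow_le_self_of_le_one (hχ0 x) (hχ1 x) hpq.symm.lt.le
    set J := ∫⁻ x, ENNReal.ofReal (|F x| ^ p * χ x) with hJ
    have hint : Integrable fun x => |F x| ^ p * χ x :=
      ((hFc.abs.rpow_const fun x => Or.inr hp0.le).mul hχ).integrable_of_hasCompactSupport
        hχc.mul_left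
    have hJ1 : J = ENNReal.ofReal (∫ x, |F x| ^ p * χ x) :=
      (ofReal_integral_eq_lintegral_ofReal hint (Eventually.of_forall fun x =>
        mul_nonneg (by positivity) (hχ0 x))).symm
    have hJt : J ≠ ⊤ := hJ1 ▸ ENNReal.ofReal_ne_top
    have hS' : eLpNorm (superpose π s (fun w => -Y w) g) (ENNReal.ofReal q) volume ≤
        C * J ^ (1 / q) := by
      have e1 : superpose π s (fun w => -Y w) g =
          fun x => superpose π s Y (fun y => g (-y)) (-x) := by
        ext x; exact superpose_neg_apply g x
      have hgn : Measurable fun y => g (-y) := hgc.measurable.comp measurable_neg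
      rw [e1, eLpNorm_comp_neg (measurable_superpose hsm hY hgn)]
      refine (h _ (hgc.comp continuous_neg)
        (hgs.comp_homeomorph (Homeomorph.neg E))).trans ?_
      gcongr
      refine (eLpNorm_comp_neg hgc.measurable).trans_le ?_
      rw [eLpNorm_ofReal hq0]
      gcongr
      exact lintegral_mono hgq
    have hJ2 : J ≤ eLpNorm f (ENNReal.ofReal p) volume * (C * J ^ (1 / q)) := by
      have hft := IsTest.of_continuous hf hc
      have hgt := IsTest.of_continuous hgc hgs
      calc J = ENNReal.ofReal (∫ x, f x * superpose π s (fun w => -Y w) g x) := by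
            rw [hJ1, ← integral_superpose_mul hs hY hft hgt]
            exact congrArg _ (integral_congr_ae (Eventually.of_forall fun x => (hFg x).symm))
        _ ≤ ∫⁻ x, ‖f x * superpose π s (fun w => -Y w) g x‖ₑ :=
            (ENNReal.ofReal_le_ofReal (le_abs_self _)).trans
              ((Real.enorm_eq_ofReal_abs _).symm.trans_le (enorm_integral_le_lintegral_enorm _))
        _ ≤ eLpNorm f (ENNReal.ofReal p) volume *
            eLpNorm (superpose π s (fun w => -Y w) g) (ENNReal.ofReal q) volume := by
            rw [eLpNorm_ofReal hp0, eLpNorm_ofReal hq0]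
            simp only [enorm_mul]
            exact ENNReal.lintegral_mul_le_Lp_mul_Lq volume hpq hf.measurable.enorm.aemeasurable
              (measurable_superpose hsm hY.neg hgc.measurable).enorm.aemeasurable
        _ ≤ _ := by gcongr
    -- The cutoff made `J` finite, so the factor `J ^ (1 / q)` may be cancelled from `J ≤ B * J ^ (1
    -- / q)`.
    rcases eq_or_ne J 0 with hJ0 | hJ0
    · rw [hJ0, ENNReal.zero_rpow_of_pos (by positivity)]; exact zero_le
    · have e2 : J = J ^ (1 / p) * J ^ (1 / q) := by
        rw [← ENNReal.rpow_add _ _ hJ0 hJt, one_div, one_div, hpq.inv_add_inv_eq_one,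
          ENNReal.rpow_one]
      have hJq0 : J ^ (1 / q) ≠ 0 := by simp [hJ0, hJt]
      have hJqt : J ^ (1 / q) ≠ ⊤ := ENNReal.rpow_ne_top_of_nonneg (by positivity) hJt
      rw [← ENNReal.mul_le_mul_iff_left hJq0 hJqt, ← e2]
      refine hJ2.trans_eq ?_
      rw [hB]; ring
  rw [eLpNorm_ofReal hp0]
  have hball : ∀ n : ℕ, ∫⁻ x in Metric.closedBall (0 : E) n, ‖F x‖ₑ ^ p ≤ B ^ p := by
    intro n
    set χ : E → ℝ := fun x => max 0 (min 1 (n + 1 - ‖x‖)) with hχ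
    have h1 := key χ (by fun_prop) ?_ (fun x => le_max_left _ _)
      (fun x => max_le zero_le_one (min_le_left _ _))
    · rw [one_div, ENNReal.rpow_inv_le_iff hp0] at h1
      refine le_trans ?_ h1
      rw [← lintegral_indicator measurableSet_closedBall]
      refine lintegral_mono fun x => ?_
      by_cases hx : x ∈ Metric.closedBall (0 : E) n
      · rw [Set.indicator_of_mem hx, enorm_rpow_eq_ofReal_abs hp0.le]
        rw [mem_closedBall_zero_iff] at hx
        have : χ x = 1 := by
          simp only [hχ]
          rw [min_eq_left (by linarith)]
          simp
        rw [this, mul_one]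
      · rw [Set.indicator_of_notMem hx]; exact zero_le
    · refine HasCompactSupport.intro (isCompact_closedBall (0 : E) (n + 1)) fun x hx => ?_
      rw [mem_closedBall_zero_iff, not_le] at hx
      exact max_eq_left ((min_le_right _ _).trans (by linarith))
  have hU : ∫⁻ x, ‖F x‖ₑ ^ p = ⨆ n : ℕ, ∫⁻ x in Metric.closedBall (0 : E) n, ‖F x‖ₑ ^ p := by
    rw [← setLIntegral_iUnion_of_directed _ (Monotone.directed_le fun m n hmn =>
      Metric.closedBall_subset_closedBall (by exact_mod_cast hmn)),
      Metric.iUnion_closedBall_nat, setLIntegral_univ]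
  rw [hU]
  calc (⨆ n : ℕ, ∫⁻ x in Metric.closedBall (0 : E) n, ‖F x‖ₑ ^ p) ^ (1 / p) ≤ (B ^ p) ^ (1 / p) := by
        gcongr; exact iSup_le hball
    _ = B := by rw [← ENNReal.rpow_mul, mul_one_div_cancel hp0.ne', ENNReal.rpow_one]

end Superposition
-- Truncated singular integrals and the Hörmander condition.
section Hormander

set_option linter.unusedSectionVars false

variable {E : Type*} [NormedAddCommGroup E] [InnerProductSpace ℝ E] [FiniteDimensional ℝ E]
  [MeasurableSpace E] [BorelSpace E]

/-- The measure space `(δ, N] × E × E ∋ (t, z, y)` indexing the truncated singular integral. -/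
noncomputable def scaleMeasure (ν : Measure E) (δ N : ℝ) : Measure (ℝ × E × E) :=
  (volume.restrict (Set.Ioc δ N)).prod (ν.prod volume)

/-- The truncated singular integral
`f ↦ ∫_δ^N a(t)/t ∫∫ k(y) f(x + t (y + z)) dy ν(dz) dt`. -/
noncomputable def truncatedOp (ν : Measure E) (a : ℝ → ℝ) (k : E → ℝ) (δ N : ℝ) :
    (E → ℝ) → E → ℝ :=
  superpose (scaleMeasure ν δ N) (fun w => a w.1 / w.1 * k w.2.2) fun w => w.1 • (w.2.2 + w.2.1)

variable {ν : Measure E} [IsProbabilityMeasure ν] {a : ℝ → ℝ} {k : E → ℝ} {δ N : ℝ}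

instance : SFinite (scaleMeasure ν δ N) := by
  unfold scaleMeasure; infer_instance

lemma integrable_truncated_weight (ha : Measurable a) (ha1 : ∀ t, 0 < t → |a t| ≤ 1)
    (hki : Integrable k) (hδ : 0 < δ) :
    Integrable (fun w : ℝ × E × E => a w.1 / w.1 * k w.2.2) (scaleMeasure ν δ N) := by
  refine Integrable.mul_prod (f := fun t => a t / t) (g := fun w : E × E => k w.2) ?_ ?_
  · refine Measure.integrableOn_of_bounded (M := δ⁻¹) measure_Ioc_lt_top.ne
      (ha.div measurable_id).aestronglyMeasurable ?_
    filter_upwards [ae_restrict_mem measurableSet_Ioc] with t ht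
    have ht0 : 0 < t := hδ.trans ht.1
    rw [Real.norm_eq_abs, abs_div, abs_of_pos ht0, ← one_div]
    exact div_le_div₀ zero_le_one (ha1 t ht0) hδ ht.1.le
  · exact hki.comp_snd ν

lemma measurable_truncated_weight (ha : Measurable a) (hk : Measurable k) :
    Measurable (fun w : ℝ × E × E => a w.1 / w.1 * k w.2.2) := by fun_prop

/-- To meet the support of `b` from outside the doubled ball, the displacement `t (y + z)` must have
length at least `r`. The factor `(t ‖y + z‖ / r) ^ (1/2)` is then at least one and may be inserted
at no cost. -/
lemma lintegral_superpose_near (hk : Measurable k) {b : E → ℝ} (hb : Measurable b) {c : E}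
    {r t : ℝ} (hr : 0 < r) (ht : 0 < t) (hbs : Function.support b ⊆ Metric.closedBall c r) :
    ∫⁻ x in (Metric.closedBall c (2 * r))ᶜ,
      ‖superpose (ν.prod volume) (fun w : E × E => k w.2) (fun w => t • (w.2 + w.1)) b x‖ₑ ≤
      ENNReal.ofReal ((t / r) ^ (1 / 2 : ℝ)) *
        (∫⁻ z, ∫⁻ y, ‖k y‖ₑ * ENNReal.ofReal (‖y + z‖ ^ (1 / 2 : ℝ)) ∂volume ∂ν) *
        ∫⁻ x, ‖b x‖ₑ := by
  have hFm : MeasurableSet (Metric.closedBall c (2 * r))ᶜ := measurableSet_closedBall.compl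
  calc _ ≤ ∫⁻ x in (Metric.closedBall c (2 * r))ᶜ,
        ∫⁻ w : E × E, ‖k w.2‖ₑ * ‖b (x + t • (w.2 + w.1))‖ₑ ∂(ν.prod volume) := by
        refine lintegral_mono fun x => (enorm_integral_le_lintegral_enorm _).trans_eq ?_
        simp only [enorm_mul]
    _ ≤ ∫⁻ x, ∫⁻ w : E × E, ENNReal.ofReal ((t / r * ‖w.2 + w.1‖) ^ (1 / 2 : ℝ)) *
          (‖k w.2‖ₑ * ‖b (x + t • (w.2 + w.1))‖ₑ) ∂(ν.prod volume) := by
        refine (setLIntegral_mono' hFm fun x hx => lintegral_mono fun w => ?_).trans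
          (setLIntegral_le_lintegral _ _)
        by_cases hw : b (x + t • (w.2 + w.1)) = 0
        · simp only [hw, enorm_zero, mul_zero, le_refl]
        have h1 := hbs hw
        rw [Set.mem_compl_iff, Metric.mem_closedBall, dist_eq_norm, not_le] at hx
        rw [Metric.mem_closedBall, dist_eq_norm] at h1
        have h2 : 1 ≤ t / r * ‖w.2 + w.1‖ := by
          have h3 : ‖x - c‖ ≤ ‖x + t • (w.2 + w.1) - c‖ + ‖t • (w.2 + w.1)‖ := by
            have : x - c = x + t • (w.2 + w.1) - c - t • (w.2 + w.1) := by abel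
            rw [this]; exact norm_sub_le _ _
          rw [norm_smul, Real.norm_eq_abs, abs_of_pos ht] at h3
          rw [div_mul_eq_mul_div, one_le_div hr]
          linarith
        exact le_mul_of_one_le_left (zero_le)
          (by rw [← ENNReal.ofReal_one]
              exact ENNReal.ofReal_le_ofReal (Real.one_le_rpow h2 (by norm_num)))
    _ = ∫⁻ w : E × E, (∫⁻ x, ENNReal.ofReal ((t / r * ‖w.2 + w.1‖) ^ (1 / 2 : ℝ)) *
          (‖k w.2‖ₑ * ‖b (x + t • (w.2 + w.1))‖ₑ)) ∂(ν.prod volume) :=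
        lintegral_lintegral_swap (by fun_prop)
    _ = ∫⁻ w : E × E, ENNReal.ofReal ((t / r) ^ (1 / 2 : ℝ)) * (∫⁻ x, ‖b x‖ₑ) *
          (‖k w.2‖ₑ * ENNReal.ofReal (‖w.2 + w.1‖ ^ (1 / 2 : ℝ))) ∂(ν.prod volume) := by
        refine lintegral_congr fun w => ?_
        rw [lintegral_const_mul _ (by fun_prop), lintegral_const_mul _ (by fun_prop),
          lintegral_add_right_eq_self (fun x => ‖b x‖ₑ),
          Real.mul_rpow (by positivity) (norm_nonneg _), ENNReal.ofReal_mul (by positivity)]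
        ring
    _ = _ := by
        rw [lintegral_const_mul _ (by fun_prop), lintegral_prod _ (by fun_prop)]
        ring

/-- Because `b` has mean zero, `k y` may be replaced by its difference from the value of `k` at the
point where `x + t (y + z) = c`. On the support of `b` the two points differ by at most `r / t`,
which the `L¹` modulus of continuity of `k` measures. -/
lemma lintegral_superpose_far (hk : Measurable k) (hki : Integrable k) {M : ℝ≥0∞}
    (hM : ∀ h : E, ∫⁻ y, ‖k (y + h) - k y‖ₑ ≤ M * ‖h‖ₑ) {b : E → ℝ} (hb : IsTest b) {c : E}
    {r t : ℝ} (ht : 0 < t) (hbs : Function.support b ⊆ Metric.closedBall c r)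
    (hb0 : ∫ x, b x = 0) :
    ∫⁻ x, ‖superpose (ν.prod volume) (fun w : E × E => k w.2) (fun w => t • (w.2 + w.1)) b x‖ₑ ≤
      M * ENNReal.ofReal (r / t) * ∫⁻ x, ‖b x‖ₑ := by
  have hbm := hb.measurable
  obtain ⟨C, hC⟩ := hb.bounded
  have hpt : ∀ x z, ‖∫ y, k y * b (x + t • (y + z))‖ₑ ≤
      ∫⁻ y, ‖k y - k (t⁻¹ • (c - x) - z)‖ₑ * ‖b (x + t • (y + z))‖ₑ := by
    intro x z
    have hbi : Integrable fun y => b (x + t • (y + z)) := by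
      have h1 : Integrable fun y => b (x + t • z + y) := hb.integrable.comp_add_left _
      refine (h1.comp_smul ht.ne').congr (Eventually.of_forall fun y => ?_)
      simp only [smul_add]; congr 1; abel
    have h0 : ∫ y, b (x + t • (y + z)) = 0 := by
      have h1 := Measure.integral_comp_smul volume (fun y => b (x + t • z + y)) t
      rw [integral_add_left_eq_self b, hb0, smul_zero] at h1
      rw [← h1]
      refine integral_congr_ae (Eventually.of_forall fun y => ?_)
      simp only [smul_add]; congr 1; abel
    have h2 : ∫ y, k y * b (x + t • (y + z)) =
        ∫ y, (k y - k (t⁻¹ • (c - x) - z)) * b (x + t • (y + z)) := by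
      simp only [sub_mul]
      rw [integral_sub, integral_const_mul, h0, mul_zero, sub_zero]
      · exact hki.mul_bdd (c := C) hbi.aestronglyMeasurable (Eventually.of_forall fun y => hC _)
      · exact hbi.const_mul _
    rw [h2]
    refine (enorm_integral_le_lintegral_enorm _).trans_eq ?_
    simp only [enorm_mul]
  have hz : ∀ z, ∫⁻ x, ‖∫ y, k y * b (x + t • (y + z))‖ₑ ≤
      M * ENNReal.ofReal (r / t) * ∫⁻ x, ‖b x‖ₑ := by
    intro z
    calc _ ≤ ∫⁻ x, ∫⁻ y, ‖k y - k (t⁻¹ • (c - x) - z)‖ₑ * ‖b (x + t • (y + z))‖ₑ :=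
          lintegral_mono fun x => hpt x z
      _ = ∫⁻ y, ∫⁻ x, ‖k y - k (t⁻¹ • (c - x) - z)‖ₑ * ‖b (x + t • (y + z))‖ₑ :=
          lintegral_lintegral_swap (by fun_prop)
      _ = ∫⁻ y, ∫⁻ x, ‖k y - k (y + t⁻¹ • (c - x))‖ₑ * ‖b x‖ₑ := by
          refine lintegral_congr fun y => ?_
          -- Translating `x` by `t (y + z)` frees the argument of `b` from `y` and `z`, and turns
          -- the subtracted value into `k (y + t⁻¹ (c - x))`, a pure shift.
          rw [← lintegral_add_right_eq_self (fun x => ‖k y - k (y + t⁻¹ • (c - x))‖ₑ * ‖b x‖ₑ)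
            (t • (y + z))]
          refine lintegral_congr fun x => ?_
          congr 4
          rw [sub_add_eq_sub_sub, smul_sub _ (c - x), smul_smul, inv_mul_cancel₀ ht.ne', one_smul]
          abel
      _ = ∫⁻ x, ∫⁻ y, ‖k y - k (y + t⁻¹ • (c - x))‖ₑ * ‖b x‖ₑ :=
          lintegral_lintegral_swap (by fun_prop)
      _ ≤ ∫⁻ x, M * ENNReal.ofReal (r / t) * ‖b x‖ₑ := by
          refine lintegral_mono fun x => ?_
          rw [lintegral_mul_const _ (by fun_prop)]
          by_cases hx : b x = 0
          · simp [hx]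
          have h1 := hbs hx
          rw [Metric.mem_closedBall', dist_eq_norm] at h1
          gcongr
          calc ∫⁻ y, ‖k y - k (y + t⁻¹ • (c - x))‖ₑ = ∫⁻ y, ‖k (y + t⁻¹ • (c - x)) - k y‖ₑ := by
                refine lintegral_congr fun y => ?_
                rw [← enorm_neg, neg_sub]
            _ ≤ M * ‖t⁻¹ • (c - x)‖ₑ := hM _
            _ ≤ _ := by
                gcongr
                rw [← ofReal_norm, norm_smul, norm_inv, Real.norm_eq_abs, abs_of_pos ht]
                apply ENNReal.ofReal_le_ofReal
                rw [div_eq_inv_mul]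
                gcongr
      _ = _ := lintegral_const_mul _ (by fun_prop)
  have hint : ∀ x, Integrable (fun w : E × E => k w.2 * b (x + t • (w.2 + w.1)))
      (ν.prod volume) := fun x =>
    integrable_superpose (hki.comp_snd ν) (by fun_prop) hbm hC x
  calc _ ≤ ∫⁻ x, ∫⁻ z, ‖∫ y, k y * b (x + t • (y + z))‖ₑ ∂ν := by
        refine lintegral_mono fun x => ?_
        rw [superpose, integral_prod _ (hint x)]
        exact enorm_integral_le_lintegral_enorm _
    _ = ∫⁻ z, (∫⁻ x, ‖∫ y, k y * b (x + t • (y + z))‖ₑ) ∂ν := by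
        refine lintegral_lintegral_swap (Measurable.aemeasurable ?_)
        have : StronglyMeasurable fun q : (E × E) × E => k q.2 * b (q.1.1 + t • (q.2 + q.1.2)) :=
          Measurable.stronglyMeasurable (by fun_prop)
        exact this.integral_prod_right.measurable.enorm
    _ ≤ ∫⁻ z, M * ENNReal.ofReal (r / t) * (∫⁻ x, ‖b x‖ₑ) ∂ν := lintegral_mono hz
    _ = _ := by simp

lemma lintegral_scale_near {r : ℝ} (hr : 0 < r) :
    ∫⁻ t in Set.Ioc 0 r, ENNReal.ofReal t⁻¹ * ENNReal.ofReal ((t / r) ^ (1 / 2 : ℝ)) = 2 := by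
  have h1 : ∀ t ∈ Set.Ioc 0 r, ENNReal.ofReal t⁻¹ * ENNReal.ofReal ((t / r) ^ (1 / 2 : ℝ)) =
      ENNReal.ofReal (r ^ (-(1 / 2 : ℝ)) * t ^ (-(1 / 2 : ℝ))) := by
    intro t ht
    rw [← ENNReal.ofReal_mul (by simpa using ht.1.le), Real.div_rpow ht.1.le hr.le,
      Real.rpow_neg hr.le]
    congr 1
    have : t ^ (-(1 / 2 : ℝ)) = t⁻¹ * t ^ (1 / 2 : ℝ) := by
      rw [← Real.rpow_neg_one, ← Real.rpow_add ht.1]; norm_num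
    rw [this]; ring
  rw [setLIntegral_congr_fun measurableSet_Ioc h1, ← ofReal_integral_eq_lintegral_ofReal]
  · rw [← intervalIntegral.integral_of_le hr.le, intervalIntegral.integral_const_mul,
      integral_rpow (Or.inl (by norm_num)), Real.zero_rpow (by norm_num), sub_zero, mul_div_assoc',
      ← Real.rpow_add hr]
    norm_num
  · exact ((intervalIntegrable_iff_integrableOn_Ioc_of_le hr.le).1
      (intervalIntegral.intervalIntegrable_rpow' (by norm_num))).const_mul _
  · filter_upwards [ae_restrict_mem measurableSet_Ioc] with t ht
    have := ht.1
    simp only [Pi.zero_apply]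
    positivity

lemma lintegral_scale_far {r : ℝ} (hr : 0 < r) :
    ∫⁻ t in Set.Ioi r, ENNReal.ofReal t⁻¹ * ENNReal.ofReal (r / t) = 1 := by
  have h1 : ∀ t ∈ Set.Ioi r, ENNReal.ofReal t⁻¹ * ENNReal.ofReal (r / t) =
      ENNReal.ofReal (r * t ^ (-2 : ℝ)) := by
    intro t ht
    have ht0 : 0 < t := hr.trans ht
    rw [← ENNReal.ofReal_mul (by positivity), Real.rpow_neg ht0.le, Real.rpow_two]
    congr 1
    field_simp
  rw [setLIntegral_congr_fun measurableSet_Ioi h1, ← ofReal_integral_eq_lintegral_ofReal]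
  · rw [integral_const_mul, integral_Ioi_rpow_of_lt (by norm_num) hr]
    have : r * (-r ^ (-2 + 1 : ℝ) / (-2 + 1)) = 1 := by
      norm_num [Real.rpow_neg_one, hr.ne']
    rw [this, ENNReal.ofReal_one]
  · exact (integrableOn_Ioi_rpow_of_lt (by norm_num) hr).const_mul _
  · filter_upwards [ae_restrict_mem measurableSet_Ioi] with t ht
    have : 0 < t := hr.trans ht
    simp only [Pi.zero_apply]
    positivity

/-- The scales are separated at `t = r`. Against `dt/t`, the small scales contribute `∫₀^r
(t/r)^{1/2} dt/t = 2` and the large ones `∫_r^∞ (r/t) dt/t = 1`, so the bound does not depend on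
`δ`, `N` or the size of the ball. -/
lemma truncatedOp_cancellation (ha : Measurable a) (ha1 : ∀ t, 0 < t → |a t| ≤ 1)
    (hk : Measurable k) (hki : Integrable k) (hδ : 0 < δ) {M₁ M₂ : ℝ≥0∞}
    (hM₁ : ∫⁻ z, ∫⁻ y, ‖k y‖ₑ * ENNReal.ofReal (‖y + z‖ ^ (1 / 2 : ℝ)) ∂volume ∂ν ≤ M₁)
    (hM₂ : ∀ h : E, ∫⁻ y, ‖k (y + h) - k y‖ₑ ≤ M₂ * ‖h‖ₑ) {b : E → ℝ} (hb : IsTest b) {c : E}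
    {r : ℝ} (hr : 0 < r) (hbs : Function.support b ⊆ Metric.closedBall c r)
    (hb0 : ∫ x, b x = 0) :
    ∫⁻ x in (Metric.closedBall c (2 * r))ᶜ, ‖truncatedOp ν a k δ N b x‖ₑ ≤
      (2 * M₁ + M₂) * ∫⁻ x, ‖b x‖ₑ := by
  obtain ⟨C, hC⟩ := hb.bounded
  have hbm := hb.measurable
  set F := (Metric.closedBall c (2 * r))ᶜ with hF
  set U : ℝ → E → ℝ := fun t =>
    superpose (ν.prod volume) (fun w : E × E => k w.2) (fun w => t • (w.2 + w.1)) b with hU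
  have hUm : Measurable fun q : E × ℝ => U q.2 q.1 := by
    have : StronglyMeasurable fun q : (E × ℝ) × E × E =>
        k q.2.2 * b (q.1.1 + q.1.2 • (q.2.2 + q.2.1)) :=
      Measurable.stronglyMeasurable (by fun_prop)
    exact this.integral_prod_right.measurable
  have hpt : ∀ x, ‖truncatedOp ν a k δ N b x‖ₑ ≤
      ∫⁻ t in Set.Ioc δ N, ENNReal.ofReal t⁻¹ * ‖U t x‖ₑ := by
    intro x
    have hint := integrable_superpose (integrable_truncated_weight (ν := ν) (N := N) ha ha1 hki hδ)
      (Y := fun w : ℝ × E × E => w.1 • (w.2.2 + w.2.1)) (by fun_prop) hbm hC x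
    have e1 : truncatedOp ν a k δ N b x = ∫ t in Set.Ioc δ N, a t / t * U t x := by
      rw [truncatedOp, superpose, scaleMeasure, integral_prod _ hint]
      refine integral_congr_ae (Eventually.of_forall fun t => ?_)
      simp only [hU, superpose, mul_assoc, integral_const_mul]
    rw [e1]
    refine (enorm_integral_le_lintegral_enorm _).trans
      (setLIntegral_mono' measurableSet_Ioc fun t ht => ?_)
    have ht0 : 0 < t := hδ.trans ht.1
    rw [enorm_mul, Real.enorm_eq_ofReal_abs, abs_div, abs_of_pos ht0]
    gcongr
    rw [← one_div]
    gcongr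
    exact ha1 t ht0
  calc _ ≤ ∫⁻ x in F, ∫⁻ t in Set.Ioi 0, ENNReal.ofReal t⁻¹ * ‖U t x‖ₑ :=
        lintegral_mono fun x => (hpt x).trans
          (lintegral_mono_set fun t ht => hδ.trans ht.1)
    _ = ∫⁻ t in Set.Ioi 0, ENNReal.ofReal t⁻¹ * ∫⁻ x in F, ‖U t x‖ₑ := by
        rw [lintegral_lintegral_swap (Measurable.aemeasurable
          ((measurable_snd.inv.ennreal_ofReal).mul hUm.enorm))]
        refine lintegral_congr fun t => ?_
        rw [lintegral_const_mul' _ _ ENNReal.ofReal_ne_top]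
    _ = (∫⁻ t in Set.Ioc 0 r, ENNReal.ofReal t⁻¹ * ∫⁻ x in F, ‖U t x‖ₑ) +
        ∫⁻ t in Set.Ioi r, ENNReal.ofReal t⁻¹ * ∫⁻ x in F, ‖U t x‖ₑ := by
        rw [← lintegral_union measurableSet_Ioi (Set.Ioc_disjoint_Ioi le_rfl),
          Set.Ioc_union_Ioi_eq_Ioi hr.le]
    _ ≤ (∫⁻ t in Set.Ioc 0 r, ENNReal.ofReal t⁻¹ * ENNReal.ofReal ((t / r) ^ (1 / 2 : ℝ)) *
          (M₁ * ∫⁻ x, ‖b x‖ₑ)) +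
        ∫⁻ t in Set.Ioi r, ENNReal.ofReal t⁻¹ * ENNReal.ofReal (r / t) *
          (M₂ * ∫⁻ x, ‖b x‖ₑ) := by
        refine add_le_add (setLIntegral_mono' measurableSet_Ioc fun t ht => ?_)
          (setLIntegral_mono' measurableSet_Ioi fun t ht => ?_)
        · rw [mul_assoc]
          gcongr
          refine (lintegral_superpose_near hk hbm hr ht.1 hbs).trans ?_
          rw [mul_assoc]
          gcongr
        · rw [mul_assoc]
          gcongr
          refine (setLIntegral_le_lintegral _ _).trans
            ((lintegral_superpose_far hk hki hM₂ hb (hr.trans ht) hbs hb0).trans_eq ?_)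
          ring
    _ = _ := by
        rw [lintegral_mul_const _ (by fun_prop), lintegral_mul_const _ (by fun_prop),
          lintegral_scale_near hr, lintegral_scale_far hr]
        ring

/-- The `L^p` bound for the truncated singular integrals, with a constant depending only on the
dimension, `p`, and the bounds on the kernel. -/
theorem truncatedOp_eLpNorm_le [Nontrivial E] {p : ℝ} (hp : 1 < p) (A M₁ M₂ : ℝ≥0) :
    ∃ C : ℝ≥0, ∀ (ν : Measure E) [IsProbabilityMeasure ν] (a : ℝ → ℝ) (k : E → ℝ) (δ N : ℝ),
      Measurable a → (∀ t, 0 < t → |a t| ≤ 1) → Measurable k → Integrable k → 0 < δ →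
      ∫⁻ z, ∫⁻ y, ‖k y‖ₑ * ENNReal.ofReal (‖y + z‖ ^ (1 / 2 : ℝ)) ∂volume ∂ν ≤ M₁ →
      (∀ h : E, ∫⁻ y, ‖k (y + h) - k y‖ₑ ≤ M₂ * ‖h‖ₑ) →
      (∀ f : E → ℝ, ContDiff ℝ ∞ f → HasCompactSupport f →
        eLpNorm (truncatedOp ν a k δ N f) 2 volume ≤ A * eLpNorm f 2 volume) →
      ∀ f : E → ℝ, Continuous f → HasCompactSupport f →
        eLpNorm (truncatedOp ν a k δ N f) (ENNReal.ofReal p) volume ≤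
          C * eLpNorm f (ENNReal.ofReal p) volume := by
  -- The `L²` condition in `IsCalderonZygmund` is stated for squared norms, whence `A ^ 2`.
  set B : ℝ≥0 := max (A ^ 2) (2 * M₁ + M₂) with hB
  have hcz : ∀ (ν : Measure E) [IsProbabilityMeasure ν] (a : ℝ → ℝ) (k : E → ℝ) (δ N : ℝ),
      Measurable a → (∀ t, 0 < t → |a t| ≤ 1) → Measurable k → Integrable k → 0 < δ →
      ∫⁻ z, ∫⁻ y, ‖k y‖ₑ * ENNReal.ofReal (‖y + z‖ ^ (1 / 2 : ℝ)) ∂volume ∂ν ≤ M₁ →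
      (∀ h : E, ∫⁻ y, ‖k (y + h) - k y‖ₑ ≤ M₂ * ‖h‖ₑ) →
      (∀ f : E → ℝ, ContDiff ℝ ∞ f → HasCompactSupport f →
        eLpNorm (truncatedOp ν a k δ N f) 2 volume ≤ A * eLpNorm f 2 volume) →
      IsCalderonZygmund (truncatedOp ν a k δ N) B := by
    intro ν _ a k δ N ha ha1 hk hki hδ hM₁ hM₂ h2
    have hs := integrable_truncated_weight (ν := ν) (N := N) ha ha1 hki hδ
    have hsm := measurable_truncated_weight ha hk
    refine ⟨fun f g hf hg => superpose_add hs (by fun_prop) hf hg,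
      fun f hf => measurable_superpose hsm (by fun_prop) hf.measurable, fun f hf => ?_,
      fun c r f hr hf hfs hf0 => ?_⟩
    · have := eLpNorm_superpose_two_le_of_smooth hsm hs (by fun_prop) h2 hf
      rw [← eLpNorm_two_sq, ← eLpNorm_two_sq]
      refine (pow_le_pow_left₀ (zero_le) this 2).trans ?_
      rw [mul_pow]
      gcongr
      exact_mod_cast le_max_left _ _
    · refine (truncatedOp_cancellation ha ha1 hk hki hδ hM₁ hM₂ hf hr hfs hf0).trans ?_
      gcongr
      exact_mod_cast le_max_right _ _
  rcases lt_trichotomy p 2 with hp2 | hp2 | hp2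
  · refine ⟨(calderonZygmundConst (Module.finrank ℝ E) B p).toNNReal, ?_⟩
    intro ν _ a k δ N ha ha1 hk hki hδ hM₁ hM₂ h2 f hf hc
    rw [ENNReal.coe_toNNReal (calderonZygmundConst_ne_top _ _ (by linarith))]
    exact (hcz ν a k δ N ha ha1 hk hki hδ hM₁ hM₂ h2).eLpNorm_le hp hp2 hf hc
  · refine ⟨A, ?_⟩
    intro ν _ a k δ N ha ha1 hk hki hδ hM₁ hM₂ h2 f hf hc
    rw [hp2, ENNReal.ofReal_ofNat]
    exact eLpNorm_superpose_two_le_of_smooth (measurable_truncated_weight ha hk)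
      (integrable_truncated_weight ha ha1 hki hδ) (by fun_prop) h2 (IsTest.of_continuous hf hc)
  · have hpq := Real.HolderConjugate.conjExponent hp
    set q := p.conjExponent with hq
    have hq2 : q < 2 := by
      rw [hq, Real.conjExponent, div_lt_iff₀ (by linarith)]
      linarith
    refine ⟨(calderonZygmundConst (Module.finrank ℝ E) B q).toNNReal, ?_⟩
    intro ν _ a k δ N ha ha1 hk hki hδ hM₁ hM₂ h2 f hf hc
    rw [ENNReal.coe_toNNReal (calderonZygmundConst_ne_top _ _ hpq.symm.pos)]
    exact eLpNorm_superpose_le_of_conj (measurable_truncated_weight ha hk)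
      (integrable_truncated_weight ha ha1 hki hδ) (by fun_prop) hpq hp2.le
      (fun g hg hgc => (hcz ν a k δ N ha ha1 hk hki hδ hM₁ hM₂ h2).eLpNorm_le
        hpq.symm.lt hq2 hg hgc) hf hc

end Hormander
-- Fourier symbols, the kernel representation and the `L²` bound.
section Fourier

open FourierTransform
open scoped SchwartzMap LineDeriv

set_option linter.unusedSectionVars false

variable {E : Type*} [NormedAddCommGroup E] [InnerProductSpace ℝ E] [FiniteDimensional ℝ E]
  [MeasurableSpace E] [BorelSpace E]

lemma integral_smul_fourierInv (f h : E → ℂ) (hf : Integrable f) (hh : Integrable h) :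
    ∫ x, f x * 𝓕⁻ h x = ∫ ξ, 𝓕⁻ f ξ * h ξ := by
  have h1 := VectorFourier.integral_fourierIntegral_smul_eq_flip (L := -innerₗ E) (μ := volume)
    (ν := volume) Real.continuous_fourierChar (by
      simp only [LinearMap.neg_apply, innerₗ_apply_apply]; fun_prop) hf hh
  simp only [smul_eq_mul] at h1
  have h2 : (-innerₗ E).flip = -innerₗ E := by
    ext x y; simp [real_inner_comm]
  rw [h2] at h1
  exact h1.symm

/-- Plancherel's identity for the pointwise inverse Fourier transform of a function in
`L¹ ∩ L²`. -/
lemma eLpNorm_fourierInv {h : E → ℂ} (h1 : Integrable h) (h2 : MemLp h 2) :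
    eLpNorm (𝓕⁻ h) 2 volume = eLpNorm h 2 volume := by
  set H := h2.toLp h with hH
  set G : Lp ℂ 2 (volume : Measure E) := 𝓕⁻ H with hG
  have hcont : Continuous (𝓕⁻ h) := by
    have : 𝓕⁻ h = fun w => 𝓕 h (-w) := funext fun w => Real.fourierInv_eq_fourier_neg h w
    rw [this]
    have : Continuous (𝓕 h) := VectorFourier.fourierIntegral_continuous
      Real.continuous_fourierChar (by simp only [innerₗ_apply_apply]; fun_prop) h1
    exact this.comp continuous_neg
  -- The inverse transform on `L²` and the integral formula are identified by testing against smooth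
  -- compactly supported functions, where both reduce to moving the transform to the test function.
  have hae : ∀ᵐ x, G x = 𝓕⁻ h x := by
    refine ae_eq_of_integral_contDiff_smul_eq
      ((Lp.memLp G).locallyIntegrable (by norm_num)) hcont.locallyIntegrable fun g hg hgc => ?_
    have hgc' : HasCompactSupport fun x => (g x : ℂ) := hgc.comp_left (g := Complex.ofReal) rfl
    set φ : 𝓢(E, ℂ) := hgc'.toSchwartzMap (Complex.ofRealCLM.contDiff.comp hg) with hφ
    have e1 := Lp.fourierInv_toTemperedDistribution_eq H
    have e2 := DFunLike.congr_fun e1 φ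
    rw [TemperedDistribution.fourierInv_apply, Lp.toTemperedDistribution_apply,
      Lp.toTemperedDistribution_apply] at e2
    have e3 : ∫ x, g x • G x = ∫ x, φ x • (𝓕⁻ H : Lp ℂ 2 (volume : Measure E)) x := rfl
    rw [e3, ← e2]
    have e4 : ∫ x, (𝓕⁻ φ) x • H x = ∫ x, (𝓕⁻ (φ : E → ℂ)) x * h x := by
      refine integral_congr_ae ?_
      filter_upwards [h2.coeFn_toLp] with x hx
      rw [SchwartzMap.fourierInv_coe, hx, smul_eq_mul]
    rw [e4, ← integral_smul_fourierInv _ _ φ.integrable h1]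
    rfl
  have hn : ‖G‖ = ‖H‖ := by
    rw [← Lp.norm_fourier_eq G, hG, fourier_fourierInv_eq]
  rw [← eLpNorm_congr_ae hae, ← eLpNorm_congr_ae h2.coeFn_toLp]
  rw [Lp.norm_def, Lp.norm_def, ENNReal.toReal_eq_toReal_iff' (Lp.eLpNorm_ne_top _)
    (Lp.eLpNorm_ne_top _)] at hn
  exact hn

variable {W : Type*} [MeasurableSpace W] {π : Measure W} [SFinite π]

/-- The Fourier symbol of a superposition of translations. -/
noncomputable def symbol (π : Measure W) (s : W → ℂ) (Y : W → E) (ξ : E) : ℂ :=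
  ∫ w, s w * Complex.exp (2 * Real.pi * inner ℝ ξ (Y w) * Complex.I) ∂π

lemma norm_exp_inner (u v : E) :
    ‖Complex.exp (2 * Real.pi * inner ℝ u v * Complex.I)‖ = 1 := by
  have : (2 * Real.pi * inner ℝ u v * Complex.I : ℂ) =
      ((2 * Real.pi * inner ℝ u v : ℝ) : ℂ) * Complex.I := by push_cast; ring
  rw [this, Complex.norm_exp_ofReal_mul_I]

lemma measurable_symbol {s : W → ℂ} (hs : Measurable s) {Y : W → E} (hY : Measurable Y) :
    Measurable (symbol π s Y) := by
  have : StronglyMeasurable fun q : E × W =>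
      s q.2 * Complex.exp (2 * Real.pi * inner ℝ q.1 (Y q.2) * Complex.I) :=
    Measurable.stronglyMeasurable (by fun_prop)
  exact this.integral_prod_right.measurable

lemma norm_symbol_le {s : W → ℂ} {Y : W → E} (ξ : E) : ‖symbol π s Y ξ‖ ≤ ∫ w, ‖s w‖ ∂π := by
  refine (norm_integral_le_integral_norm _).trans_eq ?_
  simp only [norm_mul, norm_exp_inner, mul_one]

lemma integrable_symbol_mul {s : W → ℂ} (hsm : Measurable s) {Y : W → E} (hY : Measurable Y)
    (g : 𝓢(E, ℂ)) : Integrable fun ξ => symbol π s Y ξ * g ξ :=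
  g.integrable.bdd_mul (c := ∫ w, ‖s w‖ ∂π) (measurable_symbol hsm hY).aestronglyMeasurable
    (Eventually.of_forall fun ξ => norm_symbol_le ξ)

lemma integral_translate_eq_fourierInv {s : W → ℂ} (hs : Integrable s π)
    {Y : W → E} (hY : Measurable Y) (g : 𝓢(E, ℂ)) (x : E) :
    ∫ w, s w * g (x + Y w) ∂π = 𝓕⁻ (fun ξ => symbol π s Y ξ * 𝓕 g ξ) x := by
  have hg : ∀ u, g u = ∫ ξ, Complex.exp (2 * Real.pi * inner ℝ ξ u * Complex.I) * 𝓕 g ξ := by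
    intro u
    have h1 : (𝓕⁻ (𝓕 g)) u = g u := by rw [fourierInv_fourier_eq]
    rw [← h1, SchwartzMap.fourierInv_coe, Real.fourierInv_eq']
    refine integral_congr_ae (Eventually.of_forall fun ξ => ?_)
    simp only [smul_eq_mul]
    push_cast
    rfl
  rw [Real.fourierInv_eq']
  calc ∫ w, s w * g (x + Y w) ∂π = ∫ w, (∫ ξ, s w *
        (Complex.exp (2 * Real.pi * inner ℝ ξ (x + Y w) * Complex.I) * 𝓕 g ξ)) ∂π := by
        refine integral_congr_ae (Eventually.of_forall fun w => ?_)
        dsimp only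
        rw [hg, integral_const_mul]
    _ = ∫ ξ, ∫ w, s w *
        (Complex.exp (2 * Real.pi * inner ℝ ξ (x + Y w) * Complex.I) * 𝓕 g ξ) ∂π := by
        refine integral_integral_swap ?_
        have h1 : Integrable (fun q : W × E => s q.1 * 𝓕 g q.2) (π.prod volume) :=
          hs.mul_prod (𝓕 g).integrable
        refine (h1.mul_bdd (c := 1) (g := fun q : W × E =>
          Complex.exp (2 * Real.pi * inner ℝ q.2 (x + Y q.1) * Complex.I)) ?_
          (Eventually.of_forall fun q => (norm_exp_inner _ _).le)).congr
          (Eventually.of_forall fun q => by simp only [Function.uncurry]; ring)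
        exact Measurable.aestronglyMeasurable (by fun_prop)
    _ = _ := by
        refine integral_congr_ae (Eventually.of_forall fun ξ => ?_)
        simp only [symbol, smul_eq_mul]
        rw [← integral_mul_const, ← integral_const_mul]
        refine integral_congr_ae (Eventually.of_forall fun w => ?_)
        simp only [inner_add_right]
        push_cast
        rw [mul_add, add_mul, Complex.exp_add]
        ring

/-- The complexification of a smooth compactly supported function as a Schwartz function. -/
noncomputable def toComplexSchwartz {f : E → ℝ} (hf : ContDiff ℝ ∞ f) (hc : HasCompactSupport f) :
    𝓢(E, ℂ) :=
  HasCompactSupport.toSchwartzMap (f := fun x => (f x : ℂ)) (hc.comp_left (g := Complex.ofReal) rfl)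
    (Complex.ofRealCLM.contDiff.comp hf)

lemma toComplexSchwartz_apply {f : E → ℝ} (hf : ContDiff ℝ ∞ f) (hc : HasCompactSupport f) (x : E) :
    toComplexSchwartz hf hc x = f x := rfl

lemma lineDeriv_toComplexSchwartz_apply {f : E → ℝ} (hf : ContDiff ℝ ∞ f)
    (hc : HasCompactSupport f) (m x : E) :
    (∂_{m} (toComplexSchwartz hf hc) : 𝓢(E, ℂ)) x = (fderiv ℝ f x m : ℂ) := by
  rw [SchwartzMap.lineDerivOp_apply_eq_fderiv]
  have h1 : HasFDerivAt (toComplexSchwartz hf hc : E → ℂ)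
      (Complex.ofRealCLM.comp (fderiv ℝ f x)) x :=
    Complex.ofRealCLM.hasFDerivAt.comp x
      (hf.differentiable (by norm_num)).differentiableAt.hasFDerivAt
  rw [h1.fderiv]
  rfl

lemma fourier_lineDeriv_apply (g : 𝓢(E, ℂ)) (m ξ : E) :
    𝓕 (∂_{m} g : 𝓢(E, ℂ)) ξ = 2 * Real.pi * Complex.I * inner ℝ ξ m * 𝓕 g ξ := by
  have : (inner ℝ · m : E → ℝ).HasTemperateGrowth := ((innerSL ℝ).flip m).hasTemperateGrowth
  rw [SchwartzMap.fourier_lineDerivOp_eq, smul_apply,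
    SchwartzMap.smulLeftCLM_apply_apply this, Complex.real_smul, smul_eq_mul]
  ring

lemma symbol_eq_charFun (ρ : Measure E) (t : ℝ) (ξ : E) :
    symbol ρ (fun _ => 1) (fun y => t • y) ξ = charFun ρ ((2 * Real.pi * t) • ξ) := by
  rw [symbol, charFun_apply]
  refine integral_congr_ae (Eventually.of_forall fun y => ?_)
  simp only [inner_smul_right, one_mul]
  rw [real_inner_comm]
  push_cast
  congr 1
  ring

/-- Integration by parts in the law `ρ`, whose characteristic function factors through an
integrable kernel `K`. -/
lemma integral_fderiv_eq_kernel {ρ ν : Measure E} [IsProbabilityMeasure ρ] [IsProbabilityMeasure ν]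
    {K Φ : E → ℂ} (hK : Integrable K) (m : E)
    (h1 : ∀ η, charFun ρ ((2 * Real.pi) • η) = charFun ν ((2 * Real.pi) • η) * Φ η)
    (h2 : ∀ η, 𝓕⁻ K η = 2 * Real.pi * Complex.I * inner ℝ η m * Φ η)
    {f : E → ℝ} (hf : ContDiff ℝ ∞ f) (hc : HasCompactSupport f) {t : ℝ} (ht : 0 < t) (x : E) :
    ∫ y, (fderiv ℝ f (x + t • y) m : ℂ) ∂ρ =
      (t : ℂ)⁻¹ * ∫ w : E × E, K w.2 * (f (x + t • (w.2 + w.1)) : ℂ) ∂(ν.prod volume) := by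
  have e1 := integral_translate_eq_fourierInv (π := ρ) (s := fun _ => 1)
    (integrable_const _) (Y := fun y => t • y) (by fun_prop) (∂_{m} (toComplexSchwartz hf hc)) x
  have e2 := integral_translate_eq_fourierInv (π := ν.prod (volume : Measure E))
    (s := fun w => (t : ℂ)⁻¹ * K w.2) ((hK.comp_snd ν).const_mul _)
    (Y := fun w : E × E => t • (w.2 + w.1)) (by fun_prop) (toComplexSchwartz hf hc) x
  simp only [one_mul, lineDeriv_toComplexSchwartz_apply] at e1
  simp only [toComplexSchwartz_apply, mul_assoc, integral_const_mul] at e2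
  rw [e1, e2]
  -- Both sides are inverse Fourier transforms, so it suffices to compare symbols: the derivative
  -- produces `2πi ⟨ξ, m⟩`, while `K` at scale `t` produces `2πi ⟨tξ, m⟩`, hence the factor `t⁻¹`.
  refine congrFun (congrArg _ (funext fun ξ => ?_)) x
  rw [fourier_lineDeriv_apply, symbol_eq_charFun]
  have e3 : symbol (ν.prod volume) (fun w : E × E => (t : ℂ)⁻¹ * K w.2)
      (fun w => t • (w.2 + w.1)) ξ =
      (t : ℂ)⁻¹ * (charFun ν ((2 * Real.pi * t) • ξ) * 𝓕⁻ K (t • ξ)) := by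
    rw [← symbol_eq_charFun, symbol, symbol, Real.fourierInv_eq', ← integral_prod_mul,
      ← integral_const_mul]
    refine integral_congr_ae (Eventually.of_forall fun w => ?_)
    simp only [inner_smul_right, inner_add_right, smul_eq_mul, one_mul]
    rw [real_inner_comm ξ w.2]
    push_cast
    rw [mul_add, mul_add, add_mul, Complex.exp_add]
    ring
  rw [e3, mul_smul, h1, h2, real_inner_smul_left]
  have : (t : ℂ) ≠ 0 := by exact_mod_cast ht.ne'
  push_cast
  field_simp

lemma eLpNorm_ofReal_comp {X : Type*} [MeasurableSpace X] {μ : Measure X} (f : X → ℝ)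
    (p : ℝ≥0∞) : eLpNorm (fun x => (f x : ℂ)) p μ = eLpNorm f p μ :=
  eLpNorm_congr_norm_ae (Eventually.of_forall fun x => by simp)

/-- The `L²` bound for the truncated integrals of the derivatives of the semigroup. -/
lemma eLpNorm_two_integral_fderiv_le {ρ : Measure E} [IsProbabilityMeasure ρ] {κ : ℝ} (hκ : 0 < κ)
    (hρ : ∀ ξ, ‖charFun ρ ξ‖ ≤ Real.exp (-(κ⁻¹ * ‖ξ‖))) {a : ℝ → ℝ} (ha : Measurable a)
    (ha1 : ∀ t, 0 < t → |a t| ≤ 1) {δ N : ℝ} (hδ : 0 < δ) {m : E} (hm : ‖m‖ ≤ 1)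
    {f : E → ℝ} (hf : ContDiff ℝ ∞ f) (hc : HasCompactSupport f) :
    eLpNorm (fun x => ∫ t in Set.Ioc δ N, a t * ∫ y, fderiv ℝ f (x + t • y) m ∂ρ) 2 volume ≤
      ENNReal.ofReal κ * eLpNorm f 2 volume := by
  set g : 𝓢(E, ℂ) := ∂_{m} (toComplexSchwartz hf hc) with hg
  set π : Measure (ℝ × E) := (volume.restrict (Set.Ioc δ N)).prod ρ with hπ
  have hai : Integrable (fun t => (a t : ℂ)) (volume.restrict (Set.Ioc δ N)) := by
    refine Measure.integrableOn_of_bounded (M := 1) measure_Ioc_lt_top.ne (by fun_prop) ?_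
    filter_upwards [ae_restrict_mem measurableSet_Ioc] with t ht
    simpa using ha1 t (hδ.trans ht.1)
  have hs : Integrable (fun w : ℝ × E => (a w.1 : ℂ)) π := hai.comp_fst ρ
  have hsm : Measurable (fun w : ℝ × E => (a w.1 : ℂ)) := by fun_prop
  have hY : Measurable (fun w : ℝ × E => w.1 • w.2) := by fun_prop
  set h : E → ℂ := fun ξ => symbol π (fun w => (a w.1 : ℂ)) (fun w => w.1 • w.2) ξ * 𝓕 g ξ with hh
  obtain ⟨Cg, hCg⟩ : ∃ C, ∀ x, ‖g x‖ ≤ C := by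
    obtain ⟨C, hC⟩ := g.decay 0 0
    exact ⟨C, fun x => by simpa using hC.2 x⟩
  have e1 : ∀ x, ((∫ t in Set.Ioc δ N, a t * ∫ y, fderiv ℝ f (x + t • y) m ∂ρ : ℝ) : ℂ) =
      𝓕⁻ h x := by
    intro x
    rw [hh, ← integral_translate_eq_fourierInv hs hY g x, integral_prod]
    · rw [← integral_complex_ofReal]
      refine integral_congr_ae (Eventually.of_forall fun t => ?_)
      simp only [hg, lineDeriv_toComplexSchwartz_apply]
      rw [integral_const_mul, integral_complex_ofReal]
      push_cast
      rfl
    · exact hs.mul_bdd (c := Cg) (g := fun w : ℝ × E => g (x + w.1 • w.2))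
        (Continuous.aestronglyMeasurable (by fun_prop)) (Eventually.of_forall fun w => hCg _)
  have hsymb : ∀ ξ, ‖h ξ‖ ≤ κ * ‖𝓕 (toComplexSchwartz hf hc) ξ‖ := by
    intro ξ
    have e2 : symbol π (fun w => (a w.1 : ℂ)) (fun w => w.1 • w.2) ξ =
        ∫ t in Set.Ioc δ N, (a t : ℂ) * charFun ρ ((2 * Real.pi * t) • ξ) := by
      rw [symbol, integral_prod]
      · refine integral_congr_ae (Eventually.of_forall fun t => ?_)
        dsimp only
        rw [integral_const_mul, ← symbol_eq_charFun, symbol]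
        simp only [one_mul]
      · exact hs.mul_bdd (c := 1)
          (g := fun w : ℝ × E => Complex.exp (2 * Real.pi * inner ℝ ξ (w.1 • w.2) * Complex.I))
          (Continuous.aestronglyMeasurable (by fun_prop))
          (Eventually.of_forall fun w => (norm_exp_inner _ _).le)
    rcases eq_or_ne ξ 0 with rfl | hξ
    · simp only [hh, hg, fourier_lineDeriv_apply, inner_zero_left]
      simp only [Complex.ofReal_zero, mul_zero, zero_mul, norm_zero]
      positivity
    have hξ0 : 0 < ‖ξ‖ := norm_pos_iff.2 hξ
    set c := 2 * Real.pi * κ⁻¹ * ‖ξ‖ with hcdef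
    have hc0 : 0 < c := by positivity
    -- Integrating `e^{-ct}` over all scales gives `c⁻¹`, proportional to `‖ξ‖⁻¹`; this exactly
    -- offsets the factor `2π ‖ξ‖` of the derivative and leaves `κ`.
    have e3 : ‖symbol π (fun w => (a w.1 : ℂ)) (fun w => w.1 • w.2) ξ‖ ≤ c⁻¹ := by
      rw [e2]
      calc _ ≤ ∫ t in Set.Ioc δ N, Real.exp (-(c * t)) := by
            refine norm_integral_le_of_norm_le ?_ ?_
            · exact (Continuous.integrableOn_Icc (by fun_prop)).mono_set Set.Ioc_subset_Icc_self
            · filter_upwards [ae_restrict_mem measurableSet_Ioc] with t ht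
              have ht0 : 0 < t := hδ.trans ht.1
              rw [norm_mul, Complex.norm_real, Real.norm_eq_abs]
              refine (mul_le_mul (ha1 t ht0) (hρ _) (norm_nonneg _) zero_le_one).trans_eq ?_
              rw [one_mul, norm_smul, Real.norm_eq_abs, abs_of_pos (by positivity), hcdef]
              congr 1; ring
        _ ≤ ∫ t in Set.Ioi (0 : ℝ), Real.exp (-(c * t)) := by
            refine setIntegral_mono_set ?_ (Eventually.of_forall fun t => (Real.exp_pos _).le)
              (Eventually.of_forall fun t ht => hδ.trans ht.1)
            simpa only [neg_mul] using integrableOn_exp_mul_Ioi (neg_lt_zero.2 hc0) 0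
        _ = c⁻¹ := by
            have := integral_exp_mul_Ioi (neg_lt_zero.2 hc0) 0
            simp only [neg_mul] at this
            rw [this]; simp [neg_div_neg_eq]
    rw [hh]
    simp only [hg, fourier_lineDeriv_apply, norm_mul]
    have e4 : ‖((inner ℝ ξ m : ℝ) : ℂ)‖ ≤ ‖ξ‖ := by
      rw [Complex.norm_real]
      exact (norm_inner_le_norm _ _).trans (mul_le_of_le_one_right hξ0.le hm)
    simp only [Complex.norm_ofNat, Complex.norm_real, Complex.norm_I, mul_one, Real.norm_eq_abs,
      abs_of_pos Real.pi_pos] at e4 ⊢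
    calc _ ≤ c⁻¹ * (2 * Real.pi * ‖ξ‖ * ‖𝓕 (toComplexSchwartz hf hc) ξ‖) := by gcongr
      _ = κ * ‖𝓕 (toComplexSchwartz hf hc) ξ‖ := by rw [hcdef]; field_simp
  have hh1 : Integrable h := integrable_symbol_mul hsm hY (𝓕 g)
  have hF2 : MemLp (⇑(𝓕 (toComplexSchwartz hf hc) : 𝓢(E, ℂ))) 2 volume := SchwartzMap.memLp _ 2 _
  have hle : eLpNorm h 2 volume ≤ ENNReal.ofReal κ *
      eLpNorm (⇑(𝓕 (toComplexSchwartz hf hc) : 𝓢(E, ℂ))) 2 volume :=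
    eLpNorm_le_mul_eLpNorm_of_ae_le_mul (Eventually.of_forall hsymb) 2
  have hh2 : MemLp h 2 :=
    ⟨hh1.aestronglyMeasurable, hle.trans_lt (ENNReal.mul_lt_top ENNReal.ofReal_lt_top hF2.2)⟩
  have hpl : eLpNorm (⇑(𝓕 (toComplexSchwartz hf hc) : 𝓢(E, ℂ))) 2 volume = eLpNorm f 2 volume := by
    have h1 := SchwartzMap.norm_fourier_toL2_eq (toComplexSchwartz hf hc)
    rw [SchwartzMap.norm_toLp, SchwartzMap.norm_toLp, ENNReal.toReal_eq_toReal_iff'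
      (SchwartzMap.memLp _ 2 _).2.ne (SchwartzMap.memLp _ 2 _).2.ne] at h1
    rw [h1]
    exact eLpNorm_ofReal_comp f 2
  rw [← eLpNorm_ofReal_comp, ← hpl]
  simp only [e1]
  exact (eLpNorm_fourierInv hh1 hh2).trans_le hle

/-- The kernel representation turns the integrals of the derivatives of the semigroup into the
truncated singular integrals. -/
lemma truncatedOp_eq_integral_fderiv {ρ ν : Measure E} [IsProbabilityMeasure ρ]
    [IsProbabilityMeasure ν] {K Φ : E → ℂ} (hK : Integrable K) (m : E)
    (h1 : ∀ η, charFun ρ ((2 * Real.pi) • η) = charFun ν ((2 * Real.pi) • η) * Φ η)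
    (h2 : ∀ η, 𝓕⁻ K η = 2 * Real.pi * Complex.I * inner ℝ η m * Φ η) {a : ℝ → ℝ}
    (ha : Measurable a) (ha1 : ∀ t, 0 < t → |a t| ≤ 1) {δ N : ℝ} (hδ : 0 < δ)
    {f : E → ℝ} (hf : ContDiff ℝ ∞ f) (hc : HasCompactSupport f) (x : E) :
    truncatedOp ν a (fun y => (K y).re) δ N f x =
      ∫ t in Set.Ioc δ N, a t * ∫ y, fderiv ℝ f (x + t • y) m ∂ρ := by
  obtain ⟨C, hC⟩ := hc.exists_bound_of_continuous hf.continuous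
  have hint := integrable_superpose
    (integrable_truncated_weight (ν := ν) (N := N) (k := fun y => (K y).re) ha ha1 hK.re hδ)
    (Y := fun w : ℝ × E × E => w.1 • (w.2.2 + w.2.1)) (by fun_prop) hf.continuous.measurable hC x
  rw [truncatedOp, superpose, scaleMeasure, integral_prod _ hint]
  refine setIntegral_congr_fun measurableSet_Ioc fun t ht => ?_
  have ht0 : 0 < t := hδ.trans ht.1
  have e1 := integral_fderiv_eq_kernel hK m h1 h2 hf hc ht0 x
  rw [integral_complex_ofReal] at e1
  have hKf : Integrable (fun w : E × E => K w.2 * (f (x + t • (w.2 + w.1)) : ℂ))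
      (ν.prod volume) := by
    refine (hK.comp_snd ν).mul_bdd (c := C)
      (g := fun w : E × E => (f (x + t • (w.2 + w.1)) : ℂ)) ?_
      (Eventually.of_forall fun w => by simpa using hC _)
    have := hf.continuous
    exact Continuous.aestronglyMeasurable (by fun_prop)
  have e2 := congrArg Complex.re e1
  rw [Complex.ofReal_re, ← Complex.ofReal_inv, Complex.re_ofReal_mul,
    ← RCLike.re_eq_complex_re, ← integral_re hKf] at e2
  dsimp only
  rw [e2, ← mul_assoc, ← div_eq_mul_inv]
  simp only [mul_assoc, integral_const_mul]
  congr 2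
  ext w
  simp

end Fourier
-- The jump law with characteristic function `√(1 + s²) - |s|`.
section JumpLaw

/-- The mixing measure on `(v, u) ∈ (0, 1] × (0, ∞)` in the representation of
`√(1 + s²) - |s|` as a mixture of the Gaussian characteristic functions `exp (-u s²)`. -/
noncomputable def mixing : Measure (ℝ × ℝ) :=
  (volume.restrict (Set.Ioc 0 1 ×ˢ Set.Ioi 0)).withDensity fun q =>
    ENNReal.ofReal (2⁻¹ * (√Real.pi)⁻¹ * (q.2 ^ (-(1 / 2) : ℝ) * Real.exp (-(q.1 * q.2))))

lemma lintegral_rpow_mul_exp_neg {α r : ℝ} (hα : 0 < α) (hr : 0 < r) :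
    ∫⁻ u in Set.Ioi (0 : ℝ), ENNReal.ofReal (u ^ (α - 1) * Real.exp (-(r * u))) =
      ENNReal.ofReal (Real.Gamma α * r ^ (-α)) := by
  have h := Real.integral_rpow_mul_exp_neg_mul_Ioi hα hr
  have hpos : 0 < (1 / r) ^ α * Real.Gamma α := mul_pos (by positivity) (Real.Gamma_pos_of_pos hα)
  have hint : IntegrableOn (fun u : ℝ => u ^ (α - 1) * Real.exp (-(r * u))) (Set.Ioi 0) := by
    -- A nonintegrable function has integral zero by convention, which contradicts the positive
    -- value given by the Gamma integral.
    by_contra hcon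
    rw [integral_undef hcon] at h
    exact hpos.ne h
  rw [← ofReal_integral_eq_lintegral_ofReal hint, h]
  · rw [one_div, Real.inv_rpow hr.le, Real.rpow_neg hr.le, mul_comm]
  · filter_upwards [ae_restrict_mem measurableSet_Ioi] with u hu
    have : 0 < u := hu
    simp only [Pi.zero_apply]
    positivity

/-- The integral in `u` is a Gamma integral with value proportional to `(v + c) ^ (-(1/2 + β))`,
which is integrable over `v ∈ (0, 1]` down to `c = 0` because `β < 1/2`. The case `β = 0`, `c = s²`
gives the characteristic function, the case `β = 1/4`, `c = 0` the moment. -/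
lemma lintegral_mixing {β c : ℝ} (hβ : 0 ≤ β) (hβ1 : β < 1 / 2) (hc : 0 ≤ c) :
    ∫⁻ q, ENNReal.ofReal (q.2 ^ β * Real.exp (-(c * q.2))) ∂mixing =
      ENNReal.ofReal (2⁻¹ * (√Real.pi)⁻¹ * Real.Gamma (1 / 2 + β) *
        (((1 + c) ^ (1 / 2 - β) - c ^ (1 / 2 - β)) / (1 / 2 - β))) := by
  have hΓ : 0 < Real.Gamma (1 / 2 + β) := Real.Gamma_pos_of_pos (by linarith)
  rw [mixing, lintegral_withDensity_eq_lintegral_mul _ (by fun_prop) (by fun_prop),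
    Measure.volume_eq_prod, ← Measure.prod_restrict, lintegral_prod _ (by fun_prop)]
  have e1 : ∀ v ∈ Set.Ioc (0 : ℝ) 1, ∫⁻ u in Set.Ioi (0 : ℝ),
      ((fun q : ℝ × ℝ => ENNReal.ofReal (2⁻¹ * (√Real.pi)⁻¹ *
        (q.2 ^ (-(1 / 2) : ℝ) * Real.exp (-(q.1 * q.2))))) *
        fun q : ℝ × ℝ => ENNReal.ofReal (q.2 ^ β * Real.exp (-(c * q.2)))) (v, u) =
      ENNReal.ofReal (2⁻¹ * (√Real.pi)⁻¹ * Real.Gamma (1 / 2 + β) *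
        (v + c) ^ (-(1 / 2 + β))) := by
    intro v hv
    have hvc : 0 < v + c := by linarith [hv.1]
    rw [mul_assoc, ENNReal.ofReal_mul (by positivity),
      ← lintegral_rpow_mul_exp_neg (by linarith) hvc, ← lintegral_const_mul _ (by fun_prop)]
    refine setLIntegral_congr_fun measurableSet_Ioi fun u hu => ?_
    have hu0 : 0 < u := hu
    simp only [Pi.mul_apply]
    rw [← ENNReal.ofReal_mul (by positivity), ← ENNReal.ofReal_mul (by positivity)]
    congr 1
    have e2 : u ^ (1 / 2 + β - 1) = u ^ (-(1 / 2) : ℝ) * u ^ β := by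
      rw [← Real.rpow_add hu0]; congr 1; ring
    have e3 : Real.exp (-((v + c) * u)) = Real.exp (-(v * u)) * Real.exp (-(c * u)) := by
      rw [← Real.exp_add]; congr 1; ring
    rw [e2, e3]; ring
  rw [setLIntegral_congr_fun measurableSet_Ioc e1]
  have hint : IntervalIntegrable (fun x : ℝ => (x + c) ^ (-(1 / 2 + β))) volume 0 1 := by
    have := (intervalIntegral.intervalIntegrable_rpow' (a := 0 + c) (b := 1 + c)
      (r := -(1 / 2 + β)) (by linarith)).comp_add_right c
    simpa using this
  rw [← ofReal_integral_eq_lintegral_ofReal, ← intervalIntegral.integral_of_le zero_le_one,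
    intervalIntegral.integral_const_mul,
    intervalIntegral.integral_comp_add_right (fun x => x ^ (-(1 / 2 + β))),
    integral_rpow (Or.inl (by linarith))]
  · rw [zero_add]
    have : -(1 / 2 + β) + 1 = 1 / 2 - β := by ring
    rw [this]
  · exact ((intervalIntegrable_iff_integrableOn_Ioc_of_le zero_le_one).1 hint).const_mul _
  · filter_upwards [ae_restrict_mem measurableSet_Ioc] with v hv
    have : 0 < v + c := by linarith [hv.1]
    simp only [Pi.zero_apply]
    positivity

lemma ae_mixing : ∀ᵐ q ∂mixing, 0 < q.2 := by
  refine (withDensity_absolutelyContinuous _ _).ae_le ?_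
  filter_upwards [ae_restrict_mem (measurableSet_Ioc.prod measurableSet_Ioi)] with q hq
  exact hq.2

lemma lintegral_mixing_exp (s : ℝ) :
    ∫⁻ q, ENNReal.ofReal (Real.exp (-(s ^ 2 * q.2))) ∂mixing =
      ENNReal.ofReal (√(1 + s ^ 2) - |s|) := by
  have h := lintegral_mixing (β := 0) le_rfl (by norm_num) (sq_nonneg s)
  simp only [Real.rpow_zero, one_mul, add_zero, sub_zero, Real.Gamma_one_half_eq,
    ← Real.sqrt_eq_rpow, Real.sqrt_sq_eq_abs] at h
  rw [h]
  congr 1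
  have : √Real.pi ≠ 0 := (Real.sqrt_pos.2 Real.pi_pos).ne'
  field_simp

instance : IsProbabilityMeasure mixing := by
  constructor
  have := lintegral_mixing_exp 0
  simpa using this

lemma integral_mixing_exp (s : ℝ) :
    ∫ q, Real.exp (-(s ^ 2 * q.2)) ∂mixing = √(1 + s ^ 2) - |s| := by
  rw [integral_eq_lintegral_of_nonneg_ae (Eventually.of_forall fun q => (Real.exp_pos _).le)
    (by fun_prop), lintegral_mixing_exp, ENNReal.toReal_ofReal]
  rw [sub_nonneg, ← Real.sqrt_sq_eq_abs]
  exact Real.sqrt_le_sqrt (by linarith)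

/-- A probability measure on the line with characteristic function `√(1 + s²) - |s|`. -/
noncomputable def lineJump : Measure ℝ :=
  (mixing.prod (gaussianReal 0 1)).map fun w => √(2 * w.1.2) * w.2

instance : IsProbabilityMeasure lineJump :=
  Measure.isProbabilityMeasure_map (by fun_prop)

/-- Conditionally on `u`, the variable is centred Gaussian with variance `2u` and characteristic
function `exp (-u s²)`; the mixing measure averages these. -/
lemma charFun_lineJump (s : ℝ) : charFun lineJump s = ((√(1 + s ^ 2) - |s| : ℝ) : ℂ) := by
  rw [charFun_apply_real, lineJump, integral_map (by fun_prop) (by fun_prop), integral_prod,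
    ← integral_mixing_exp, ← integral_complex_ofReal]
  · refine integral_congr_ae ?_
    filter_upwards [ae_mixing] with q hq
    have h := charFun_gaussianReal (μ := 0) (v := 1) (s * √(2 * q.2))
    rw [charFun_apply_real] at h
    have e1 : ∀ y : ℝ, Complex.exp (↑s * ↑(√(2 * q.2) * y) * Complex.I) =
        Complex.exp (↑(s * √(2 * q.2)) * ↑y * Complex.I) := fun y => by push_cast; ring_nf
    simp only [e1]
    rw [h]
    push_cast
    congr 1
    have e2 : ((√(2 * q.2) : ℝ) : ℂ) ^ 2 = 2 * q.2 := by
      rw [← Complex.ofReal_pow, Real.sq_sqrt (by linarith)]; push_cast; ring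
    rw [mul_pow, e2]
    simp
    ring
  · refine (integrable_const (1 : ℝ)).mono' (Measurable.aestronglyMeasurable (by fun_prop))
      (Eventually.of_forall fun w => ?_)
    rw [← Complex.ofReal_mul, Complex.norm_exp_ofReal_mul_I]

/-- The moment of order `1/2` becomes a moment of order `1/4` of `u`. The first moment is infinite,
since the characteristic function has a corner at zero; this is why fractional moments are used
throughout. -/
lemma lintegral_lineJump_lt_top :
    ∫⁻ x, ENNReal.ofReal (|x| ^ (1 / 2 : ℝ)) ∂lineJump < ⊤ := by
  rw [lineJump, lintegral_map (by fun_prop) (by fun_prop), lintegral_prod _ (by fun_prop)]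
  have h1 : ∫⁻ q, ENNReal.ofReal ((2 * q.2) ^ (1 / 4 : ℝ)) ∂mixing < ⊤ := by
    have h := lintegral_mixing (β := 1 / 4) (by norm_num) (by norm_num) le_rfl
    simp only [zero_mul, neg_zero, Real.exp_zero, mul_one] at h
    have e1 : ∀ᵐ q ∂mixing, ENNReal.ofReal ((2 * q.2) ^ (1 / 4 : ℝ)) =
        ENNReal.ofReal (2 ^ (1 / 4 : ℝ)) * ENNReal.ofReal (q.2 ^ (1 / 4 : ℝ)) := by
      filter_upwards [ae_mixing] with q hq
      rw [Real.mul_rpow (by norm_num) hq.le, ENNReal.ofReal_mul (by positivity)]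
    rw [lintegral_congr_ae e1, lintegral_const_mul _ (by fun_prop), h]
    exact ENNReal.mul_lt_top ENNReal.ofReal_lt_top ENNReal.ofReal_lt_top
  have h2 : ∫⁻ y, ENNReal.ofReal (|y| ^ (1 / 2 : ℝ)) ∂(gaussianReal 0 1) < ⊤ := by
    have hi : Integrable (fun y : ℝ => 1 + |y|) (gaussianReal 0 1) := by
      refine (integrable_const _).add ?_
      have := (memLp_id_gaussianReal (μ := 0) (v := 1) 1).integrable le_rfl
      exact this.abs
    refine lt_of_le_of_lt (lintegral_mono fun y => ENNReal.ofReal_le_ofReal ?_)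
      ((ofReal_integral_eq_lintegral_ofReal hi (Eventually.of_forall fun y =>
        add_nonneg zero_le_one (abs_nonneg y))).symm.trans_lt ENNReal.ofReal_lt_top)
    calc |y| ^ (1 / 2 : ℝ) ≤ (1 + |y|) ^ (1 / 2 : ℝ) := by gcongr; linarith
      _ ≤ (1 + |y|) ^ (1 : ℝ) :=
        Real.rpow_le_rpow_of_exponent_le (by linarith [abs_nonneg y]) (by norm_num)
      _ = 1 + |y| := Real.rpow_one _
  have e2 : ∀ᵐ q ∂mixing, ∫⁻ y, ENNReal.ofReal (|√(2 * q.2) * y| ^ (1 / 2 : ℝ)) ∂(gaussianReal 0 1) =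
      ENNReal.ofReal ((2 * q.2) ^ (1 / 4 : ℝ)) *
        ∫⁻ y, ENNReal.ofReal (|y| ^ (1 / 2 : ℝ)) ∂(gaussianReal 0 1) := by
    filter_upwards [ae_mixing] with q hq
    rw [← lintegral_const_mul _ (by fun_prop)]
    refine lintegral_congr fun y => ?_
    rw [← ENNReal.ofReal_mul (by positivity), abs_mul, abs_of_nonneg (Real.sqrt_nonneg _),
      Real.mul_rpow (Real.sqrt_nonneg _) (abs_nonneg _), Real.sqrt_eq_rpow,
      ← Real.rpow_mul (by linarith)]
    norm_num
  dsimp only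
  rw [lintegral_congr_ae e2, lintegral_mul_const _ (by fun_prop)]
  exact ENNReal.mul_lt_top h1 h2

/-- The `1/2`-moment of `lineJump`. -/
noncomputable def lineJumpMoment : ℝ≥0 :=
  (∫⁻ x, ENNReal.ofReal (|x| ^ (1 / 2 : ℝ)) ∂lineJump).toNNReal

variable {E : Type*} [NormedAddCommGroup E] [InnerProductSpace ℝ E] [FiniteDimensional ℝ E]
  [MeasurableSpace E] [BorelSpace E] {X : Type*} [MeasurableSpace X]

/-- The jump measure of the large jumps with spectral measure `μ` in the directions `θ`. -/
noncomputable def jumpMeasure (μ : Measure X) (θ : X → E) : Measure E :=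
  (μ.prod lineJump).map fun w => w.2 • θ w.1

instance (μ : Measure X) [IsFiniteMeasure μ] (θ : X → E) : IsFiniteMeasure (jumpMeasure μ θ) := by
  unfold jumpMeasure; infer_instance

lemma jumpMeasure_univ (μ : Measure X) [IsFiniteMeasure μ] {θ : X → E} (hθ : Measurable θ) :
    jumpMeasure μ θ Set.univ = μ Set.univ := by
  rw [jumpMeasure, Measure.map_apply (by fun_prop) MeasurableSet.univ, Set.preimage_univ,
    ← Set.univ_prod_univ, Measure.prod_prod,
    (measure_univ : lineJump Set.univ = 1), mul_one]

lemma charFun_jumpMeasure (μ : Measure X) [IsFiniteMeasure μ] {θ : X → E} (hθ : Measurable θ)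
    (ξ : E) : charFun (jumpMeasure μ θ) ξ =
      ((∫ x, (√(1 + inner ℝ ξ (θ x) ^ 2) - |inner ℝ ξ (θ x)|) ∂μ : ℝ) : ℂ) := by
  rw [charFun_apply, jumpMeasure, integral_map (by fun_prop)
    (Measurable.aestronglyMeasurable (by fun_prop)), integral_prod, ← integral_complex_ofReal]
  · refine integral_congr_ae (Eventually.of_forall fun x => ?_)
    dsimp only
    rw [← charFun_lineJump, charFun_apply_real]
    refine integral_congr_ae (Eventually.of_forall fun r => ?_)
    simp only [real_inner_smul_left, real_inner_comm ξ (θ x)]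
    push_cast
    ring_nf
  · refine (integrable_const (1 : ℝ)).mono' (Measurable.aestronglyMeasurable (by fun_prop))
      (Eventually.of_forall fun w => ?_)
    rw [Complex.norm_exp_ofReal_mul_I]

lemma lintegral_jumpMeasure_le (μ : Measure X) [IsFiniteMeasure μ] {θ : X → E} (hθ : Measurable θ)
    (hθ1 : ∀ x, ‖θ x‖ ≤ 1) :
    ∫⁻ y, ENNReal.ofReal (‖y‖ ^ (1 / 2 : ℝ)) ∂(jumpMeasure μ θ) ≤
      μ Set.univ * lineJumpMoment := by
  rw [jumpMeasure, lintegral_map (by fun_prop) (by fun_prop), lintegral_prod _ (by fun_prop)]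
  calc _ ≤ ∫⁻ _, (lineJumpMoment : ℝ≥0∞) ∂μ := by
        refine lintegral_mono fun x => ?_
        rw [lineJumpMoment, ENNReal.coe_toNNReal lintegral_lineJump_lt_top.ne]
        refine lintegral_mono fun r => ENNReal.ofReal_le_ofReal ?_
        dsimp only
        gcongr
        rw [norm_smul, Real.norm_eq_abs]
        exact mul_le_of_le_one_right (abs_nonneg _) (hθ1 x)
    _ = _ := by rw [lintegral_const, mul_comm]

end JumpLaw

/-! ### Compound Poisson laws and their moments. -/

section CompoundPoisson

set_option linter.unusedSectionVars false

variable {E : Type*} [NormedAddCommGroup E] [InnerProductSpace ℝ E] [FiniteDimensional ℝ E]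
  [MeasurableSpace E] [BorelSpace E]

/-- Convolution powers of a measure. -/
noncomputable def convPow (ρ : Measure E) : ℕ → Measure E
  | 0 => Measure.dirac 0
  | n + 1 => convPow ρ n ∗ ρ

/-- The compound Poisson law with jump measure `ρ`. -/
noncomputable def compoundPoisson (ρ : Measure E) : Measure E :=
  Measure.sum fun n => ENNReal.ofReal (Real.exp (-ρ.real Set.univ) / n.factorial) • convPow ρ n

variable (ρ : Measure E) [IsFiniteMeasure ρ]

instance isFiniteMeasure_convPow (n : ℕ) : IsFiniteMeasure (convPow ρ n) := by
  induction n with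
  | zero => unfold convPow; infer_instance
  | succ n ih => unfold convPow; infer_instance

lemma charFun_convPow (n : ℕ) (ξ : E) : charFun (convPow ρ n) ξ = charFun ρ ξ ^ n := by
  induction n with
  | zero => simp [convPow]
  | succ n ih => rw [convPow, charFun_conv, ih, pow_succ]

lemma convPow_univ (n : ℕ) : convPow ρ n Set.univ = ρ Set.univ ^ n := by
  induction n with
  | zero => simp [convPow]
  | succ n ih =>
    rw [convPow, Measure.conv, Measure.map_apply (by fun_prop) MeasurableSet.univ,
      Set.preimage_univ, ← Set.univ_prod_univ, Measure.prod_prod, ih, pow_succ]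

lemma tsum_poisson_weights : ∑' n : ℕ, ENNReal.ofReal (Real.exp (-ρ.real Set.univ) / n.factorial) *
    ρ Set.univ ^ n = 1 := by
  have h := NormedSpace.expSeries_div_hasSum_exp (ρ.real Set.univ)
  rw [← Real.exp_eq_exp_ℝ] at h
  have e1 : ∀ n : ℕ, ENNReal.ofReal (Real.exp (-ρ.real Set.univ) / n.factorial) * ρ Set.univ ^ n =
      ENNReal.ofReal (Real.exp (-ρ.real Set.univ) * (ρ.real Set.univ ^ n / n.factorial)) := by
    intro n
    rw [← ofReal_measureReal (μ := ρ) (s := Set.univ), ← ENNReal.ofReal_pow measureReal_nonneg,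
      ← ENNReal.ofReal_mul (by positivity)]
    congr 1; ring
  simp_rw [e1]
  rw [← ENNReal.ofReal_tsum_of_nonneg (fun n => by positivity) (h.summable.mul_left _),
    tsum_mul_left, h.tsum_eq, ← Real.exp_add]
  simp

instance : IsProbabilityMeasure (compoundPoisson ρ) := by
  constructor
  rw [compoundPoisson, Measure.sum_apply _ MeasurableSet.univ]
  simp only [Measure.smul_apply, smul_eq_mul, convPow_univ]
  exact tsum_poisson_weights ρ

lemma charFun_compoundPoisson (ξ : E) :
    charFun (compoundPoisson ρ) ξ = Complex.exp (charFun ρ ξ - ρ.real Set.univ) := by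
  have hint : Integrable (fun y : E => Complex.exp (inner ℝ y ξ * Complex.I))
      (compoundPoisson ρ) := by
    refine (integrable_const (1 : ℝ)).mono' (Measurable.aestronglyMeasurable (by fun_prop))
      (Eventually.of_forall fun w => ?_)
    rw [Complex.norm_exp_ofReal_mul_I]
  have h1 := hasSum_integral_measure hint
  have h2 : HasSum (fun n : ℕ => (Real.exp (-ρ.real Set.univ) : ℂ) *
      (charFun ρ ξ ^ n / n.factorial)) (Complex.exp (charFun ρ ξ - ρ.real Set.univ)) := by
    have h := (NormedSpace.expSeries_div_hasSum_exp (charFun ρ ξ)).mul_left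
      (Real.exp (-ρ.real Set.univ) : ℂ)
    rwa [← Complex.exp_eq_exp_ℂ, Complex.ofReal_exp, ← Complex.exp_add, Complex.ofReal_neg,
      neg_add_eq_sub, ← Complex.ofReal_neg, ← Complex.ofReal_exp] at h
  have h3 : (fun n : ℕ => ∫ y, Complex.exp (inner ℝ y ξ * Complex.I)
      ∂(ENNReal.ofReal (Real.exp (-ρ.real Set.univ) / n.factorial) • convPow ρ n)) =
      fun n : ℕ => (Real.exp (-ρ.real Set.univ) : ℂ) * (charFun ρ ξ ^ n / n.factorial) := by
    funext n
    rw [integral_smul_measure, ← charFun_apply, charFun_convPow,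
      ENNReal.toReal_ofReal (by positivity), Complex.real_smul]
    push_cast
    ring
  rw [h3] at h1
  rw [charFun_apply]
  exact h1.unique h2

/-- The square root is subadditive, so each of the `n + 1` jumps contributes its own moment times
the mass of the others. -/
lemma lintegral_convPow_succ_le (n : ℕ) :
    ∫⁻ y, ENNReal.ofReal (‖y‖ ^ (1 / 2 : ℝ)) ∂(convPow ρ (n + 1)) ≤
      (n + 1) * ρ Set.univ ^ n * ∫⁻ y, ENNReal.ofReal (‖y‖ ^ (1 / 2 : ℝ)) ∂ρ := by
  have hstep : ∀ n : ℕ, ∫⁻ y, ENNReal.ofReal (‖y‖ ^ (1 / 2 : ℝ)) ∂(convPow ρ (n + 1)) ≤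
      (∫⁻ y, ENNReal.ofReal (‖y‖ ^ (1 / 2 : ℝ)) ∂(convPow ρ n)) * ρ Set.univ +
        ρ Set.univ ^ n * ∫⁻ y, ENNReal.ofReal (‖y‖ ^ (1 / 2 : ℝ)) ∂ρ := by
    intro n
    rw [convPow, Measure.lintegral_conv (by fun_prop)]
    calc _ ≤ ∫⁻ x, ∫⁻ y, (ENNReal.ofReal (‖x‖ ^ (1 / 2 : ℝ)) +
          ENNReal.ofReal (‖y‖ ^ (1 / 2 : ℝ))) ∂ρ ∂(convPow ρ n) := by
          refine lintegral_mono fun x => lintegral_mono fun y => ?_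
          rw [← ENNReal.ofReal_add (by positivity) (by positivity)]
          refine ENNReal.ofReal_le_ofReal (le_trans ?_ (Real.rpow_add_le_add_rpow (norm_nonneg x)
            (norm_nonneg y) (by norm_num) (by norm_num)))
          gcongr
          exact norm_add_le x y
      _ = _ := by
          simp only [lintegral_add_left measurable_const, lintegral_const]
          rw [lintegral_add_right _ measurable_const, lintegral_mul_const _ (by fun_prop),
            lintegral_const, convPow_univ, mul_comm (ρ Set.univ ^ n)]
  induction n with
  | zero =>
    refine (hstep 0).trans_eq ?_
    simp [convPow]
  | succ n ih =>
    refine (hstep (n + 1)).trans ?_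
    calc _ ≤ (n + 1) * ρ Set.univ ^ n * (∫⁻ y, ENNReal.ofReal (‖y‖ ^ (1 / 2 : ℝ)) ∂ρ) *
          ρ Set.univ + ρ Set.univ ^ (n + 1) * ∫⁻ y, ENNReal.ofReal (‖y‖ ^ (1 / 2 : ℝ)) ∂ρ := by
          gcongr
      _ = _ := by push_cast; ring

lemma lintegral_compoundPoisson_le :
    ∫⁻ y, ENNReal.ofReal (‖y‖ ^ (1 / 2 : ℝ)) ∂(compoundPoisson ρ) ≤
      ∫⁻ y, ENNReal.ofReal (‖y‖ ^ (1 / 2 : ℝ)) ∂ρ := by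
  -- The term without jumps is a Dirac mass at zero and has no moment. In the others the factor `n +
  -- 1` turns `1 / (n + 1)!` into `1 / n!`, so the remaining weights again sum to one.
  rw [compoundPoisson, lintegral_sum_measure, tsum_eq_zero_add' ENNReal.summable]
  simp only [lintegral_smul_measure, smul_eq_mul]
  have h0 : ∫⁻ y, ENNReal.ofReal (‖y‖ ^ (1 / 2 : ℝ)) ∂(convPow ρ 0) = 0 := by simp [convPow]
  rw [h0, mul_zero, zero_add]
  calc _ ≤ ∑' n : ℕ, ENNReal.ofReal (Real.exp (-ρ.real Set.univ) / n.factorial) * ρ Set.univ ^ n *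
        ∫⁻ y, ENNReal.ofReal (‖y‖ ^ (1 / 2 : ℝ)) ∂ρ := by
        refine ENNReal.tsum_le_tsum fun n => ?_
        refine (mul_le_mul_right (lintegral_convPow_succ_le ρ n) _).trans_eq ?_
        have e1 : ENNReal.ofReal (Real.exp (-ρ.real Set.univ) / (n + 1).factorial) * (n + 1) =
            ENNReal.ofReal (Real.exp (-ρ.real Set.univ) / n.factorial) := by
          have : ((n : ℝ≥0∞) + 1) = ENNReal.ofReal (n + 1) := by
            rw [ENNReal.ofReal_add (by positivity) zero_le_one]; simp
          rw [this, ← ENNReal.ofReal_mul (by positivity), Nat.factorial_succ]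
          congr 1
          push_cast
          field_simp
        rw [← mul_assoc, ← mul_assoc, e1]
    _ = _ := by rw [ENNReal.tsum_mul_right, tsum_poisson_weights, one_mul]

end CompoundPoisson
-- An algebra of bounded functions stable under derivation.
section RadicalAlgebra

/-- The algebra generated by `s / √(1 + s²)` and `1 / √(1 + s²)`; it is stable under derivation and
consists of bounded functions. -/
noncomputable def radicalAlgebra : Subalgebra ℝ (ℝ → ℝ) :=
  Algebra.adjoin ℝ {fun s => s / √(1 + s ^ 2), fun s => 1 / √(1 + s ^ 2)}

lemma hasDerivAt_sqrt_one_add_sq (s : ℝ) :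
    HasDerivAt (fun s : ℝ => √(1 + s ^ 2)) (s / √(1 + s ^ 2)) s := by
  have h : HasDerivAt (fun s : ℝ => 1 + s ^ 2) (2 * s) s := by
    simpa using (hasDerivAt_pow 2 s).const_add 1
  convert h.sqrt (by positivity) using 1
  field_simp

lemma abs_le_sqrt_one_add_sq (s : ℝ) : |s| ≤ √(1 + s ^ 2) := by
  rw [← Real.sqrt_sq_eq_abs]
  exact Real.sqrt_le_sqrt (by linarith)

lemma one_le_sqrt_one_add_sq (s : ℝ) : 1 ≤ √(1 + s ^ 2) := by
  rw [Real.one_le_sqrt]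
  nlinarith [sq_nonneg s]

lemma mem_radicalAlgebra_left : (fun s : ℝ => s / √(1 + s ^ 2)) ∈ radicalAlgebra :=
  Algebra.subset_adjoin (by simp)

lemma mem_radicalAlgebra_right : (fun s : ℝ => 1 / √(1 + s ^ 2)) ∈ radicalAlgebra :=
  Algebra.subset_adjoin (by simp)

lemma bounded_of_mem_radicalAlgebra {g : ℝ → ℝ} (hg : g ∈ radicalAlgebra) :
    ∃ B, 0 ≤ B ∧ ∀ s, |g s| ≤ B := by
  induction hg using Algebra.adjoin_induction with
  | mem g hg =>
    refine ⟨1, zero_le_one, fun s => ?_⟩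
    have h0 : 0 < √(1 + s ^ 2) := by positivity
    rcases hg with rfl | rfl
    · rw [abs_div, abs_of_pos h0, div_le_one h0]
      exact abs_le_sqrt_one_add_sq s
    · rw [abs_div, abs_of_pos h0, div_le_one h0, abs_one]
      exact one_le_sqrt_one_add_sq s
  | algebraMap r => exact ⟨|r|, abs_nonneg r, fun s => le_rfl⟩
  | add g h _ _ ihg ihh =>
    obtain ⟨B, hB, hg⟩ := ihg
    obtain ⟨B', hB', hh⟩ := ihh
    exact ⟨B + B', add_nonneg hB hB', fun s => (abs_add_le _ _).trans (add_le_add (hg s) (hh s))⟩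
  | mul g h _ _ ihg ihh =>
    obtain ⟨B, hB, hg⟩ := ihg
    obtain ⟨B', hB', hh⟩ := ihh
    refine ⟨B * B', mul_nonneg hB hB', fun s => ?_⟩
    rw [Pi.mul_apply, abs_mul]
    exact mul_le_mul (hg s) (hh s) (abs_nonneg _) hB

lemma hasDerivAt_of_mem_radicalAlgebra {g : ℝ → ℝ} (hg : g ∈ radicalAlgebra) :
    ∃ g' ∈ radicalAlgebra, ∀ s, HasDerivAt g (g' s) s := by
  induction hg using Algebra.adjoin_induction with
  | mem g hg =>
    rcases hg with rfl | rfl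
    · refine ⟨_, pow_mem mem_radicalAlgebra_right 3, fun s => ?_⟩
      refine ((hasDerivAt_id s).div (hasDerivAt_sqrt_one_add_sq s) (by positivity)).congr_deriv ?_
      change _ = (1 / √(1 + s ^ 2)) ^ 3
      simp only [id]
      have h1 : √(1 + s ^ 2) ^ 2 = 1 + s ^ 2 := Real.sq_sqrt (by positivity)
      field_simp
      rw [h1]; ring
    · refine ⟨_, neg_mem (mul_mem mem_radicalAlgebra_left (pow_mem mem_radicalAlgebra_right 2)),
        fun s => ?_⟩
      refine ((hasDerivAt_const s (1 : ℝ)).div (hasDerivAt_sqrt_one_add_sq s)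
        (by positivity)).congr_deriv ?_
      change _ = -(s / √(1 + s ^ 2) * (1 / √(1 + s ^ 2)) ^ 2)
      field_simp
      ring
  | algebraMap r => exact ⟨0, zero_mem _, fun s => hasDerivAt_const s r⟩
  | add g h _ _ ihg ihh =>
    obtain ⟨g', hg', hg⟩ := ihg
    obtain ⟨h', hh', hh⟩ := ihh
    exact ⟨_, add_mem hg' hh', fun s => (hg s).add (hh s)⟩
  | mul g h mg mh ihg ihh =>
    obtain ⟨g', hg', hg⟩ := ihg
    obtain ⟨h', hh', hh⟩ := ihh
    exact ⟨_, add_mem (mul_mem hg' mh) (mul_mem mg hh'), fun s => (hg s).mul (hh s)⟩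

end RadicalAlgebra

/-! ### Derivatives of superpositions of ridge functions. -/

section RidgeIntegral

variable {E : Type} [NormedAddCommGroup E] [InnerProductSpace ℝ E]
  {X : Type*} [MeasurableSpace X]

/-- The superposition `ξ ↦ ∫ g(⟨ξ, θ⟩) v(θ) dμ` of ridge functions. -/
noncomputable def ridgeIntegral {F : Type*} [NormedAddCommGroup F] [NormedSpace ℝ F]
    (μ : Measure X) (θ : X → E) (g : ℝ → ℝ) (v : X → F) (ξ : E) : F :=
  ∫ x, g (inner ℝ ξ (θ x)) • v x ∂μ

/-- Linear growth of `g` is allowed, with only its derivative bounded, so that the unbounded profile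
`√(1 + s²) - 1` is covered. -/
lemma hasFDerivAt_ridgeIntegral {F : Type*} [NormedAddCommGroup F] [NormedSpace ℝ F]
    {μ : Measure X} [IsFiniteMeasure μ] {θ : X → E} (hθ : StronglyMeasurable θ) {R : ℝ}
    (hR : ∀ x, ‖θ x‖ ≤ R)
    {g g' : ℝ → ℝ} {A B V : ℝ} (hA : ∀ s, |g s| ≤ A * (1 + |s|)) (hB : ∀ s, |g' s| ≤ B)
    (hg : ∀ s, HasDerivAt g (g' s) s) (hg' : Continuous g')
    {v : X → F} (hv : StronglyMeasurable v) (hV : ∀ x, ‖v x‖ ≤ V) (ξ : E) :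
    HasFDerivAt (ridgeIntegral μ θ g v)
      (ridgeIntegral μ θ g' (fun x => (innerSL ℝ (θ x)).smulRight (v x)) ξ) ξ := by
  have hA0 : 0 ≤ A := by simpa using (abs_nonneg _).trans (hA 0)
  have hB0 : 0 ≤ B := (abs_nonneg _).trans (hB 0)
  have hgc : Continuous g := continuous_iff_continuousAt.2 fun s => (hg s).continuousAt
  have hin : ∀ ξ : E, StronglyMeasurable fun x => (inner ℝ ξ (θ x) : ℝ) := fun ξ =>
    (continuous_const.inner continuous_id).comp_stronglyMeasurable hθ
  have hm : ∀ ξ : E, StronglyMeasurable fun x => g (inner ℝ ξ (θ x)) • v x := fun ξ =>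
    (hgc.comp_stronglyMeasurable (hin ξ)).smul hv
  have hw : StronglyMeasurable fun x => (innerSL ℝ (θ x)).smulRight (v x) := by
    have hc : Continuous fun q : E × F => (innerSL ℝ q.1).smulRight q.2 := by fun_prop
    exact hc.comp_stronglyMeasurable (hθ.prodMk hv)
  have habs : ∀ (ξ : E) x, |inner ℝ ξ (θ x)| ≤ ‖ξ‖ * R := fun ξ x =>
    (abs_real_inner_le_norm _ _).trans (mul_le_mul_of_nonneg_left (hR x) (norm_nonneg _))
  refine hasFDerivAt_integral_of_dominated_of_fderiv_le (bound := fun _ => B * (R * V))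
    (F' := fun ξ x => g' (inner ℝ ξ (θ x)) • (innerSL ℝ (θ x)).smulRight (v x)) (s := Set.univ) univ_mem (Eventually.of_forall fun ξ => (hm ξ).aestronglyMeasurable) ?_
    ((hg'.comp_stronglyMeasurable (hin ξ)).smul hw).aestronglyMeasurable
    (Eventually.of_forall fun x ξ _ => ?_) (integrable_const _)
    (Eventually.of_forall fun x ξ _ => ?_)
  · refine (integrable_const (A * (1 + ‖ξ‖ * R) * V)).mono' (hm ξ).aestronglyMeasurable
      (Eventually.of_forall fun x => ?_)
    rw [norm_smul, Real.norm_eq_abs]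
    refine mul_le_mul ((hA _).trans ?_) (hV x) (norm_nonneg _) ?_
    · gcongr; exact habs ξ x
    · exact ((abs_nonneg _).trans (hA _)).trans
        (mul_le_mul_of_nonneg_left (add_le_add_right (habs ξ x) 1) hA0)
  · rw [norm_smul, Real.norm_eq_abs, ContinuousLinearMap.norm_smulRight_apply, innerSL_apply_norm]
    refine mul_le_mul (hB _) (mul_le_mul (hR x) (hV x) (norm_nonneg _)
      ((norm_nonneg _).trans (hR x))) (by positivity) hB0
  · have h1 : HasFDerivAt (fun ξ : E => (inner ℝ ξ (θ x) : ℝ)) (innerSL ℝ (θ x)) ξ := by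
      have : (fun ξ : E => (inner ℝ ξ (θ x) : ℝ)) = innerSL ℝ (θ x) := by
        funext ξ; simp [real_inner_comm]
      rw [this]
      exact (innerSL ℝ (θ x)).hasFDerivAt
    have h2 := ((hg (inner ℝ ξ (θ x))).comp_hasFDerivAt ξ h1).smul_const (v x)
    exact h2.congr_fderiv (by ext w; simp [smul_smul])

lemma norm_ridgeIntegral_le {F : Type*} [NormedAddCommGroup F] [NormedSpace ℝ F]
    {μ : Measure X} [IsFiniteMeasure μ] {θ : X → E} {g : ℝ → ℝ} {B V : ℝ}
    (hB : ∀ s, |g s| ≤ B) {v : X → F} (hV : ∀ x, ‖v x‖ ≤ V) (ξ : E) :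
    ‖ridgeIntegral μ θ g v ξ‖ ≤ B * V * μ.real Set.univ := by
  refine norm_integral_le_of_norm_le_const (Eventually.of_forall fun x => ?_)
  rw [norm_smul, Real.norm_eq_abs]
  exact mul_le_mul (hB _) (hV x) (norm_nonneg _) ((abs_nonneg _).trans (hB 0))

lemma continuous_of_mem_radicalAlgebra {g : ℝ → ℝ} (hg : g ∈ radicalAlgebra) : Continuous g := by
  obtain ⟨g', _, h⟩ := hasDerivAt_of_mem_radicalAlgebra hg
  exact continuous_iff_continuousAt.2 fun s => (h s).continuousAt

/-- The derivative of a ridge integral is again one, with profile `g'` in the same algebra and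
weights in `E →L[ℝ] F`. The induction therefore has to range over all target spaces `F`, and `B` is
chosen before `μ`, `θ` and `v`. -/
lemma ridgeIntegral_contDiff_bound (n : ℕ) {R : ℝ} (hR0 : 0 ≤ R) : ∀ g ∈ radicalAlgebra,
    ∃ B, 0 ≤ B ∧ ∀ (F : Type) [NormedAddCommGroup F] [NormedSpace ℝ F]
      (μ : Measure X) [IsFiniteMeasure μ] (θ : X → E), StronglyMeasurable θ → (∀ x, ‖θ x‖ ≤ R) →
      ∀ (v : X → F) (V : ℝ), 0 ≤ V → StronglyMeasurable v → (∀ x, ‖v x‖ ≤ V) →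
        ContDiff ℝ n (ridgeIntegral μ θ g v) ∧
        ∀ ξ, ‖iteratedFDeriv ℝ n (ridgeIntegral μ θ g v) ξ‖ ≤ B * V * μ.real Set.univ := by
  induction n with
  | zero =>
    intro g hg
    obtain ⟨B, hB0, hB⟩ := bounded_of_mem_radicalAlgebra hg
    obtain ⟨g', hg', hd⟩ := hasDerivAt_of_mem_radicalAlgebra hg
    obtain ⟨B', hB0', hB'⟩ := bounded_of_mem_radicalAlgebra hg'
    refine ⟨B, hB0, fun F _ _ μ _ θ hθ hR v V hV0 hv hV => ⟨?_, fun ξ => ?_⟩⟩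
    · have hA : ∀ s, |g s| ≤ B * (1 + |s|) := fun s => (hB s).trans
        (le_mul_of_one_le_right hB0 (by linarith [abs_nonneg s]))
      refine contDiff_zero.2 (continuous_iff_continuousAt.2 fun ξ => ?_)
      exact (hasFDerivAt_ridgeIntegral hθ hR hA hB' hd (continuous_of_mem_radicalAlgebra hg') hv hV
        ξ).continuousAt
    · rw [norm_iteratedFDeriv_zero]
      exact norm_ridgeIntegral_le hB hV ξ
  | succ n ih =>
    intro g hg
    obtain ⟨B, hB0, hB⟩ := bounded_of_mem_radicalAlgebra hg
    obtain ⟨g', hg', hd⟩ := hasDerivAt_of_mem_radicalAlgebra hg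
    obtain ⟨B', hB0', hB'⟩ := bounded_of_mem_radicalAlgebra hg'
    obtain ⟨D, hD0, hD⟩ := ih g' hg'
    refine ⟨D * R, mul_nonneg hD0 hR0, fun F _ _ μ _ θ hθ hR v V hV0 hv hV => ?_⟩
    have hA : ∀ s, |g s| ≤ B * (1 + |s|) := fun s => (hB s).trans
      (le_mul_of_one_le_right hB0 (by linarith [abs_nonneg s]))
    have hfd := hasFDerivAt_ridgeIntegral (μ := μ) hθ hR hA hB' hd
      (continuous_of_mem_radicalAlgebra hg') hv hV
    have hfe : fderiv ℝ (ridgeIntegral μ θ g v) =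
        ridgeIntegral μ θ g' (fun x => (innerSL ℝ (θ x)).smulRight (v x)) :=
      funext fun ξ => (hfd ξ).fderiv
    have hw : StronglyMeasurable fun x => (innerSL ℝ (θ x)).smulRight (v x) := by
      have hc : Continuous fun q : E × F => (innerSL ℝ q.1).smulRight q.2 := by fun_prop
      exact hc.comp_stronglyMeasurable (hθ.prodMk hv)
    obtain ⟨h1, h2⟩ := hD (E →L[ℝ] F) μ θ hθ hR _ (R * V) (mul_nonneg hR0 hV0) hw fun x => by
      rw [ContinuousLinearMap.norm_smulRight_apply, innerSL_apply_norm]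
      exact mul_le_mul (hR x) (hV x) (norm_nonneg _) hR0
    refine ⟨?_, fun ξ => ?_⟩
    · rw [Nat.cast_add, Nat.cast_one, contDiff_succ_iff_fderiv, hfe]
      exact ⟨fun ξ => (hfd ξ).differentiableAt, by simp, h1⟩
    · rw [← norm_iteratedFDeriv_fderiv, hfe]
      refine (h2 ξ).trans_eq (by ring)

end RidgeIntegral
-- The smooth exponent and its exponential.
section SmoothExponent

variable {E : Type} [NormedAddCommGroup E] [InnerProductSpace ℝ E]
  {X : Type*} [MeasurableSpace X]

/-- The exponent `∫ (√(1 + ⟨ξ, θ⟩²) - 1) dμ`, a smooth substitute for `∫ |⟨ξ, θ⟩| dμ`. -/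
noncomputable def smoothExponent (μ : Measure X) (θ : X → E) (ξ : E) : ℝ :=
  ∫ x, (√(1 + inner ℝ ξ (θ x) ^ 2) - 1) ∂μ

lemma smoothExponent_eq_ridgeIntegral (μ : Measure X) (θ : X → E) :
    smoothExponent μ θ = ridgeIntegral μ θ (fun s => √(1 + s ^ 2) - 1) (fun _ => (1 : ℝ)) := by
  funext ξ
  simp [smoothExponent, ridgeIntegral]

lemma abs_sqrt_one_add_sq_sub_one_le (s : ℝ) : |√(1 + s ^ 2) - 1| ≤ 1 * (1 + |s|) := by
  have h1 := one_le_sqrt_one_add_sq s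
  rw [abs_of_nonneg (by linarith), one_mul, sub_le_iff_le_add, Real.sqrt_le_left (by positivity)]
  have := abs_nonneg s
  have h2 := sq_abs s
  nlinarith

/-- The profile itself is unbounded, but its derivative `s / √(1 + s²)` lies in the radical algebra,
so all derivatives of order at least one are bounded. The form `D ^ i` is the one needed to estimate
derivatives of a composition. -/
lemma smoothExponent_contDiff_bound (X : Type*) [MeasurableSpace X]
    (n : ℕ) {R m₀ : ℝ} (hR0 : 0 ≤ R) (hm0 : 0 ≤ m₀) :
    ∃ D, 1 ≤ D ∧ ∀ (μ : Measure X) [IsFiniteMeasure μ] (θ : X → E), StronglyMeasurable θ →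
      (∀ x, ‖θ x‖ ≤ R) → μ.real Set.univ ≤ m₀ →
        ContDiff ℝ n (smoothExponent μ θ) ∧
        ∀ i, 1 ≤ i → i ≤ n → ∀ ξ, ‖iteratedFDeriv ℝ i (smoothExponent μ θ) ξ‖ ≤ D ^ i := by
  choose B hB0 hB using fun j : ℕ =>
    ridgeIntegral_contDiff_bound (E := E) (X := X) j hR0 _ mem_radicalAlgebra_left
  have hpos : ∀ j, 0 ≤ B j * R * m₀ := fun j => mul_nonneg (mul_nonneg (hB0 j) hR0) hm0
  -- The sum dominates each separate bound, and the summand one ensures `D ≤ D ^ i`.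
  refine ⟨1 + ∑ j ∈ Finset.range n, B j * R * m₀,
    le_add_of_nonneg_right (Finset.sum_nonneg fun j _ => hpos j), ?_⟩
  intro μ _ θ hθ hθR hμ
  obtain ⟨g', hg', hd⟩ := hasDerivAt_of_mem_radicalAlgebra mem_radicalAlgebra_left
  obtain ⟨A, _, hA⟩ := bounded_of_mem_radicalAlgebra mem_radicalAlgebra_left
  have hfd := hasFDerivAt_ridgeIntegral (μ := μ) (v := fun _ => (1 : ℝ)) (V := 1) hθ hθR
    abs_sqrt_one_add_sq_sub_one_le hA
    (fun s => (hasDerivAt_sqrt_one_add_sq s).sub_const 1)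
    (continuous_of_mem_radicalAlgebra mem_radicalAlgebra_left) stronglyMeasurable_const (by simp)
  rw [← smoothExponent_eq_ridgeIntegral] at hfd
  have hfe := funext fun ξ => (hfd ξ).fderiv
  have hw : StronglyMeasurable fun x => (innerSL ℝ (θ x)).smulRight (1 : ℝ) := by
    have hc : Continuous fun q : E => (innerSL ℝ q).smulRight (1 : ℝ) := by fun_prop
    exact hc.comp_stronglyMeasurable hθ
  have hwR : ∀ x, ‖(innerSL ℝ (θ x)).smulRight (1 : ℝ)‖ ≤ R := fun x => by
    rw [ContinuousLinearMap.norm_smulRight_apply, innerSL_apply_norm, norm_one, mul_one]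
    exact hθR x
  have key := fun j => hB j (E →L[ℝ] ℝ) μ θ hθ hθR _ R hR0 hw hwR
  refine ⟨?_, fun i hi hin ξ => ?_⟩
  · refine ContDiff.of_le (n := ((n : ℕ) : WithTop ℕ∞) + 1) ?_ le_self_add
    rw [contDiff_succ_iff_fderiv, hfe]
    exact ⟨fun ξ => (hfd ξ).differentiableAt, by simp, (key n).1⟩
  · obtain ⟨j, rfl⟩ : ∃ j, i = j + 1 := ⟨i - 1, by omega⟩
    rw [← norm_iteratedFDeriv_fderiv, hfe]
    have h1 : B j * R * m₀ ≤ ∑ j ∈ Finset.range n, B j * R * m₀ :=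
      Finset.single_le_sum (f := fun j => B j * R * m₀) (fun j _ => hpos j)
        (Finset.mem_range.2 (by omega))
    have h2 := mul_le_mul_of_nonneg_left hμ (mul_nonneg (hB0 j) hR0)
    refine ((key j).2 ξ).trans (le_trans (by linarith) (le_self_pow₀ (a := 1 + _) ?_ (by omega)))
    exact le_add_of_nonneg_right (Finset.sum_nonneg fun j _ => hpos j)

lemma smoothExponent_ge {μ : Measure X} [IsFiniteMeasure μ] {θ : X → E}
    (hθ : StronglyMeasurable θ) {R : ℝ} (hR : ∀ x, ‖θ x‖ ≤ R) (ξ : E) :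
    ∫ x, |inner ℝ ξ (θ x)| ∂μ - μ.real Set.univ ≤ smoothExponent μ θ ξ := by
  have hin : StronglyMeasurable fun x => (inner ℝ ξ (θ x) : ℝ) :=
    (continuous_const.inner continuous_id).comp_stronglyMeasurable hθ
  have habs : ∀ x, |inner ℝ ξ (θ x)| ≤ ‖ξ‖ * R := fun x =>
    (abs_real_inner_le_norm _ _).trans (mul_le_mul_of_nonneg_left (hR x) (norm_nonneg _))
  have hi : Integrable (fun x => |inner ℝ ξ (θ x)|) μ :=
    (integrable_const (‖ξ‖ * R)).mono' (continuous_abs.comp_stronglyMeasurable hin).aestronglyMeasurable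
      (Eventually.of_forall fun x => by simpa using habs x)
  have hi2 : Integrable (fun x => √(1 + inner ℝ ξ (θ x) ^ 2) - 1) μ := by
    refine (integrable_const (1 * (1 + ‖ξ‖ * R))).mono' ?_ (Eventually.of_forall fun x => ?_)
    · have : Continuous fun s : ℝ => √(1 + s ^ 2) - 1 := by fun_prop
      exact (this.comp_stronglyMeasurable hin).aestronglyMeasurable
    · refine (abs_sqrt_one_add_sq_sub_one_le _).trans ?_
      have := habs x
      linarith
  have h1 : μ.real Set.univ = ∫ _, (1 : ℝ) ∂μ := by simp
  rw [h1, ← integral_sub hi (integrable_const _), smoothExponent]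
  refine integral_mono (hi.sub (integrable_const _)) hi2 fun x => ?_
  exact sub_le_sub_right (abs_le_sqrt_one_add_sq _) 1

/-- All derivatives of `r ↦ e^{-r}` have absolute value `e^{-r}`, so the decay of `exp (-G)` passes
to its derivatives. -/
lemma norm_iteratedFDeriv_exp_neg_le {G : E → ℝ} {n : ℕ} (hG : ContDiff ℝ n G) {D : ℝ} {ξ : E}
    (hD : ∀ i, 1 ≤ i → i ≤ n → ‖iteratedFDeriv ℝ i G ξ‖ ≤ D ^ i) :
    ‖iteratedFDeriv ℝ n (fun ξ => (Real.exp (-G ξ) : ℂ)) ξ‖ ≤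
      n.factorial * Real.exp (-G ξ) * D ^ n := by
  have h1 : ContDiff ℝ n fun ξ => Real.exp (-G ξ) := hG.neg.exp
  have h2 := Complex.ofRealLI.norm_iteratedFDeriv_comp_left (x := ξ) h1.contDiffAt le_rfl
  have h3 : (Complex.ofRealLI ∘ fun ξ => Real.exp (-G ξ)) = fun ξ => (Real.exp (-G ξ) : ℂ) := rfl
  rw [← h3, h2]
  have h4 : (fun ξ => Real.exp (-G ξ)) = (fun r => Real.exp (-r)) ∘ G := rfl
  rw [h4]
  refine norm_iteratedFDeriv_comp_le (N := n) (by fun_prop) hG le_rfl ξ (fun i hi => ?_) hD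
  rw [norm_iteratedFDeriv_eq_norm_iteratedDeriv, iteratedDeriv_comp_neg]
  simp [iteratedDeriv_eq_iterate]

end SmoothExponent
-- Decay and smoothness of the gradient kernel.
section KernelDecay

open FourierTransform

variable {E : Type} [NormedAddCommGroup E] [InnerProductSpace ℝ E] [FiniteDimensional ℝ E]
  [MeasurableSpace E] [BorelSpace E]

lemma one_add_pow_mul_exp_neg_le {c : ℝ} (hc : 0 < c) (m : ℕ) {t : ℝ} (ht : 0 ≤ t) :
    (1 + t) ^ m * Real.exp (-(c * t)) ≤ m.factorial / c ^ m * Real.exp c := by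
  have h := Real.pow_div_factorial_le_exp (c * (1 + t)) (by positivity) m
  have h1 : (1 + t) ^ m ≤ m.factorial / c ^ m * Real.exp (c * (1 + t)) := by
    rw [div_le_iff₀ (by positivity), mul_pow] at h
    rw [div_mul_eq_mul_div, le_div_iff₀ (by positivity)]
    linarith
  calc _ ≤ m.factorial / c ^ m * Real.exp (c * (1 + t)) * Real.exp (-(c * t)) := by gcongr
    _ = _ := by rw [mul_assoc, ← Real.exp_add]; congr 2; ring

lemma integrable_inv_one_add_norm_pow :
    Integrable (fun x : E => ((1 + ‖x‖) ^ (Module.finrank ℝ E + 1))⁻¹) volume := by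
  have h := integrable_one_add_norm (E := E) (μ := volume) (r := Module.finrank ℝ E + 1)
    (by linarith)
  refine h.congr (Eventually.of_forall fun x => ?_)
  have : 0 ≤ 1 + ‖x‖ := by positivity
  simp only
  rw [Real.rpow_neg this, ← Real.rpow_natCast]
  push_cast
  rfl

lemma integrable_norm_pow_mul_exp_neg {c : ℝ} (hc : 0 < c) (j : ℕ) :
    Integrable (fun x : E => ‖x‖ ^ j * Real.exp (-(c * ‖x‖))) volume := by
  set r := Module.finrank ℝ E + 1
  refine ((integrable_inv_one_add_norm_pow (E := E)).const_mul
    ((j + r).factorial / c ^ (j + r) * Real.exp c)).mono' (by fun_prop)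
    (Eventually.of_forall fun x => ?_)
  have hx : 0 < 1 + ‖x‖ := by positivity
  rw [Real.norm_eq_abs, abs_of_nonneg (by positivity), ← div_eq_mul_inv, le_div_iff₀ (by positivity)]
  calc ‖x‖ ^ j * Real.exp (-(c * ‖x‖)) * (1 + ‖x‖) ^ r
      ≤ (1 + ‖x‖) ^ j * Real.exp (-(c * ‖x‖)) * (1 + ‖x‖) ^ r := by
        gcongr; linarith
    _ = (1 + ‖x‖) ^ (j + r) * Real.exp (-(c * ‖x‖)) := by rw [pow_add]; ring
    _ ≤ _ := one_add_pow_mul_exp_neg_le hc _ (norm_nonneg x)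

/-- Powers of `‖x‖` cost derivatives of `Φ`, of which `N` are available; derivatives of the
transform cost powers of the frequency, which the exponential absorbs. The constant is fixed before
`Φ`, so it is common to all admissible spectral measures. -/
lemma fourier_decay {c : ℝ} (hc : 0 < c) {A : ℝ} (hA : 0 ≤ A) (N : ℕ) :
    ∃ C, 0 ≤ C ∧ ∀ Φ : E → ℂ, ContDiff ℝ N Φ →
      (∀ i ≤ N, ∀ ξ, ‖iteratedFDeriv ℝ i Φ ξ‖ ≤ A * Real.exp (-(c * ‖ξ‖))) →
      ∀ k ≤ 2, ∀ x, (1 + ‖x‖) ^ N * ‖iteratedFDeriv ℝ k (𝓕 Φ) x‖ ≤ C := by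
  set I : ℕ → ℝ := fun j => A * ∫ v : E, ‖v‖ ^ j * Real.exp (-(c * ‖v‖)) with hI
  have hI0 : ∀ j, 0 ≤ I j := fun j =>
    mul_nonneg hA (integral_nonneg fun v => by positivity)
  set S : ℕ → ℕ → ℝ := fun k n => (2 * Real.pi) ^ k * (2 * k + 2) ^ n *
    ∑ p ∈ Finset.range (k + 1) ×ˢ Finset.range (n + 1), I p.1 with hS
  have hS0 : ∀ k n, 0 ≤ S k n := fun k n =>
    mul_nonneg (by positivity) (Finset.sum_nonneg fun p _ => hI0 _)
  refine ⟨∑ k ∈ Finset.range 3, 2 ^ (N - 1) * (S k 0 + S k N), Finset.sum_nonneg fun k _ =>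
    mul_nonneg (by positivity) (add_nonneg (hS0 _ _) (hS0 _ _)), ?_⟩
  intro Φ hΦ hb k hk x
  have hint : ∀ j i : ℕ, i ≤ N →
      Integrable (fun v => ‖v‖ ^ j * ‖iteratedFDeriv ℝ i Φ v‖) volume := by
    intro j i hi
    have hcont : Continuous (iteratedFDeriv ℝ i Φ) :=
      hΦ.continuous_iteratedFDeriv (by exact_mod_cast hi)
    refine ((integrable_norm_pow_mul_exp_neg (E := E) hc j).const_mul A).mono'
      (by fun_prop) (Eventually.of_forall fun v => ?_)
    rw [Real.norm_eq_abs, abs_of_nonneg (by positivity), mul_left_comm]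
    exact mul_le_mul_of_nonneg_left (hb i hi v) (by positivity)
  have hle : ∀ j i : ℕ, i ≤ N → ∫ v, ‖v‖ ^ j * ‖iteratedFDeriv ℝ i Φ v‖ ≤ I j := by
    intro j i hi
    rw [hI]
    simp only
    rw [← integral_const_mul]
    refine integral_mono (hint j i hi)
      ((integrable_norm_pow_mul_exp_neg (E := E) hc j).const_mul A) fun v => ?_
    simp only
    rw [mul_left_comm]
    exact mul_le_mul_of_nonneg_left (hb i hi v) (by positivity)
  have hmain : ∀ n ≤ N, ‖x‖ ^ n * ‖iteratedFDeriv ℝ k (𝓕 Φ) x‖ ≤ S k n := by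
    intro n hn
    refine (Real.pow_mul_norm_iteratedFDeriv_fourier_le (K := (2 : ℕ∞)) (N := (N : ℕ∞)) hΦ
      (fun j i _ hi => hint j i (by exact_mod_cast hi)) (by exact_mod_cast hk)
      (by exact_mod_cast hn) x).trans ?_
    refine mul_le_mul_of_nonneg_left (Finset.sum_le_sum fun p hp => ?_) (by positivity)
    rw [Finset.mem_product, Finset.mem_range, Finset.mem_range] at hp
    exact hle p.1 p.2 (by omega)
  have h0 := hmain 0 (Nat.zero_le _)
  have hN := hmain N le_rfl
  rw [pow_zero, one_mul] at h0
  have h1 : (1 + ‖x‖) ^ N ≤ 2 ^ (N - 1) * (1 ^ N + ‖x‖ ^ N) :=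
    add_pow_le zero_le_one (norm_nonneg x) N
  rw [one_pow] at h1
  calc _ ≤ 2 ^ (N - 1) * (1 + ‖x‖ ^ N) * ‖iteratedFDeriv ℝ k (𝓕 Φ) x‖ := by gcongr
    _ = 2 ^ (N - 1) * (‖iteratedFDeriv ℝ k (𝓕 Φ) x‖ +
        ‖x‖ ^ N * ‖iteratedFDeriv ℝ k (𝓕 Φ) x‖) := by ring
    _ ≤ 2 ^ (N - 1) * (S k 0 + S k N) := by gcongr
    _ ≤ _ := Finset.single_le_sum (f := fun k => 2 ^ (N - 1) * (S k 0 + S k N)) (fun k _ =>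
        mul_nonneg (by positivity) (add_nonneg (hS0 _ _) (hS0 _ _))) (Finset.mem_range.2 (by omega))

/-- For `‖h‖ ≤ 1` the mean value inequality applies, and the polynomial weight changes by at most `2
^ n` along the segment. For `‖h‖ > 1` the triangle inequality is enough, twice the `L¹` norm being
at most a multiple of `‖h‖`. -/
lemma lintegral_translate_sub_le {K : E → ℂ} (hK : Differentiable ℝ K) {C : ℝ} (hC : 0 ≤ C)
    {n : ℕ} (hn : 1 ≤ n) (h0 : ∀ y, (1 + ‖y‖) ^ n * ‖K y‖ ≤ C)
    (h1 : ∀ y, (1 + ‖y‖) ^ n * ‖fderiv ℝ K y‖ ≤ C) (h : E) :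
    ∫⁻ y, ‖K (y + h) - K y‖ₑ ≤
      ENNReal.ofReal (C * 2 ^ n) * (∫⁻ y : E, ENNReal.ofReal ((1 + ‖y‖) ^ n)⁻¹) * ‖h‖ₑ := by
  have hdiv : ∀ {a : ℝ} (y : E), (1 + ‖y‖) ^ n * a ≤ C → a ≤ C * ((1 + ‖y‖) ^ n)⁻¹ := by
    intro a y ha
    rw [← div_eq_mul_inv, le_div_iff₀ (by positivity)]
    linarith
  rcases le_or_gt ‖h‖ 1 with hh | hh
  · have hpt : ∀ y, ‖K (y + h) - K y‖ₑ ≤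
        ENNReal.ofReal (C * 2 ^ n) * ENNReal.ofReal ((1 + ‖y‖) ^ n)⁻¹ * ‖h‖ₑ := by
      intro y
      have hmv : ‖K (y + h) - K y‖ ≤ C * 2 ^ n * ((1 + ‖y‖) ^ n)⁻¹ * ‖y + h - y‖ := by
        refine Convex.norm_image_sub_le_of_norm_fderiv_le (𝕜 := ℝ) (s := Metric.closedBall y ‖h‖)
          (fun z _ => hK z) (fun z hz => ?_) (convex_closedBall _ _) (by simp) (by simp)
        have hz' : ‖y - z‖ ≤ 1 := by
          rw [← dist_eq_norm, dist_comm]; exact (Metric.mem_closedBall.1 hz).trans hh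
        have h2 : 1 + ‖y‖ ≤ 2 * (1 + ‖z‖) := by
          have := norm_sub_norm_le y z
          have := norm_nonneg z
          linarith
        refine (hdiv z (h1 z)).trans ?_
        rw [mul_assoc]
        refine mul_le_mul_of_nonneg_left ?_ hC
        rw [← div_eq_mul_inv, le_div_iff₀ (by positivity), ← div_eq_inv_mul,
          div_le_iff₀ (by positivity), ← mul_pow]
        gcongr
      rw [add_sub_cancel_left] at hmv
      rw [← ofReal_norm, ← ofReal_norm, ← ENNReal.ofReal_mul (by positivity),
        ← ENNReal.ofReal_mul (by positivity)]
      exact ENNReal.ofReal_le_ofReal hmv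
    refine (lintegral_mono hpt).trans_eq ?_
    rw [lintegral_mul_const _ (by fun_prop), lintegral_const_mul _ (by fun_prop)]
  · have hpt : ∀ y, ‖K y‖ₑ ≤ ENNReal.ofReal C * ENNReal.ofReal ((1 + ‖y‖) ^ n)⁻¹ := by
      intro y
      rw [← ofReal_norm, ← ENNReal.ofReal_mul hC]
      exact ENNReal.ofReal_le_ofReal (hdiv y (h0 y))
    have hKi : ∫⁻ y, ‖K y‖ₑ ≤
        ENNReal.ofReal C * ∫⁻ y : E, ENNReal.ofReal ((1 + ‖y‖) ^ n)⁻¹ := by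
      refine (lintegral_mono hpt).trans_eq ?_
      rw [lintegral_const_mul _ (by fun_prop)]
    have hmeas : Measurable fun y => ‖K y‖ₑ := hK.continuous.measurable.enorm
    calc ∫⁻ y, ‖K (y + h) - K y‖ₑ ≤ ∫⁻ y, (‖K (y + h)‖ₑ + ‖K y‖ₑ) :=
          lintegral_mono fun y => enorm_sub_le
      _ = 2 * ∫⁻ y, ‖K y‖ₑ := by
          rw [lintegral_add_right _ hmeas, lintegral_add_right_eq_self (fun y => ‖K y‖ₑ) h, two_mul]
      _ ≤ ENNReal.ofReal (2 ^ n) *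
          (ENNReal.ofReal C * ∫⁻ y : E, ENNReal.ofReal ((1 + ‖y‖) ^ n)⁻¹) * 1 := by
          rw [mul_one]
          refine mul_le_mul' ?_ hKi
          rw [← ENNReal.ofReal_ofNat]
          exact ENNReal.ofReal_le_ofReal (le_self_pow₀ (by norm_num) (by omega))
      _ ≤ _ := by
          rw [← mul_assoc, ← ENNReal.ofReal_mul (by positivity), mul_comm (2 ^ n)]
          gcongr
          rw [← ofReal_norm]
          exact ENNReal.one_le_ofReal.2 hh.le

/-- The derivative of the Fourier transform of a rapidly decaying symbol in a given direction is an
integrable kernel with uniform moment and smoothness bounds. -/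
lemma exists_gradient_kernel {c : ℝ} (hc : 0 < c) {A : ℝ} (hA : 0 ≤ A) :
    ∃ M₁ M₂ : ℝ≥0, ∀ Φ : E → ℂ, ContDiff ℝ ((Module.finrank ℝ E + 2 : ℕ)) Φ →
      (∀ i ≤ Module.finrank ℝ E + 2, ∀ ξ,
        ‖iteratedFDeriv ℝ i Φ ξ‖ ≤ A * Real.exp (-(c * ‖ξ‖))) →
      ∀ e : E, ‖e‖ ≤ 1 → ∃ K : E → ℂ, Continuous K ∧ Integrable K volume ∧
        (∀ η, 𝓕⁻ K η = 2 * Real.pi * Complex.I * inner ℝ η e * Φ η) ∧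
        (∫⁻ y, ‖K y‖ₑ * ENNReal.ofReal (1 + ‖y‖) ≤ M₁) ∧
        ∀ h, ∫⁻ y, ‖K (y + h) - K y‖ₑ ≤ M₂ * ‖h‖ₑ := by
  set r := Module.finrank ℝ E with hr
  -- Order `r + 1` makes the weight integrable, and one more power pays for the factor `1 + ‖y‖` in
  -- the moment. The kernel uses the first derivative of the transform, its increments the second.
  obtain ⟨C, hC0, hC⟩ := fourier_decay (E := E) hc hA (r + 2)
  set W : ℝ≥0∞ := ∫⁻ y : E, ENNReal.ofReal ((1 + ‖y‖) ^ (r + 1))⁻¹ with hW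
  have hWt : W ≠ ⊤ := by
    have := (integrable_inv_one_add_norm_pow (E := E)).lintegral_lt_top
    exact this.ne
  refine ⟨(ENNReal.ofReal C * W).toNNReal, (ENNReal.ofReal (C * 2 ^ (r + 1)) * W).toNNReal, ?_⟩
  intro Φ hΦ hb e he
  rw [ENNReal.coe_toNNReal (ENNReal.mul_ne_top ENNReal.ofReal_ne_top hWt),
    ENNReal.coe_toNNReal (ENNReal.mul_ne_top ENNReal.ofReal_ne_top hWt)]
  have hdec := hC Φ hΦ hb
  have hΦc : Continuous Φ := hΦ.continuous
  have hΦi : ∀ n : ℕ, Integrable (fun v => ‖v‖ ^ n * ‖Φ v‖) volume := by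
    intro n
    refine ((integrable_norm_pow_mul_exp_neg (E := E) hc n).const_mul A).mono'
      (by fun_prop) (Eventually.of_forall fun v => ?_)
    rw [Real.norm_eq_abs, abs_of_nonneg (by positivity), mul_left_comm]
    have := hb 0 (Nat.zero_le _) v
    rw [norm_iteratedFDeriv_zero] at this
    exact mul_le_mul_of_nonneg_left this (by positivity)
  have hΦint : Integrable Φ volume := by
    rw [← integrable_norm_iff hΦc.aestronglyMeasurable]
    simpa using hΦi 0
  have hQ : ContDiff ℝ 2 (𝓕 Φ) := Real.contDiff_fourier (N := 2) fun n _ => hΦi n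
  have hdecay : ∀ {a : ℝ} (y : E), (1 + ‖y‖) ^ (r + 2) * a ≤ C →
      a * (1 + ‖y‖) ≤ C * ((1 + ‖y‖) ^ (r + 1))⁻¹ := by
    intro a y ha
    rw [← div_eq_mul_inv, le_div_iff₀ (by positivity)]
    calc _ = (1 + ‖y‖) ^ (r + 2) * a := by ring
      _ ≤ C := ha
  have hdecay' : ∀ {a : ℝ} (y : E), 0 ≤ a → (1 + ‖y‖) ^ (r + 2) * a ≤ C →
      (1 + ‖y‖) ^ (r + 1) * a ≤ C := by
    intro a y ha0 ha
    refine le_trans (mul_le_mul_of_nonneg_right ?_ ha0) ha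
    exact pow_le_pow_right₀ (by linarith [norm_nonneg y]) (by omega)
  have hintof : ∀ {F : Type} [NormedAddCommGroup F] {g : E → F}, Continuous g →
      (∀ y, (1 + ‖y‖) ^ (r + 2) * ‖g y‖ ≤ C) → Integrable g volume := by
    intro F _ g hg hgb
    refine (integrable_inv_one_add_norm_pow (E := E).const_mul C).mono' hg.aestronglyMeasurable
      (Eventually.of_forall fun y => ?_)
    refine le_trans ?_ (hdecay y (hgb y))
    exact le_mul_of_one_le_right (norm_nonneg _) (by linarith [norm_nonneg y])
  have hd1 : ∀ y, (1 + ‖y‖) ^ (r + 2) * ‖fderiv ℝ (𝓕 Φ) y‖ ≤ C := fun y => by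
    rw [← norm_iteratedFDeriv_one]; exact hdec 1 (by norm_num) y
  have hfQ : ContDiff ℝ 1 (fderiv ℝ (𝓕 Φ)) := hQ.fderiv_right (by norm_num)
  have hQi : Integrable (𝓕 Φ) volume := hintof hQ.continuous fun y => by
    rw [← norm_iteratedFDeriv_zero (𝕜 := ℝ)]; exact hdec 0 (by norm_num) y
  have hfQi : Integrable (fderiv ℝ (𝓕 Φ)) volume := hintof hfQ.continuous hd1
  have hKd : ∀ y, HasFDerivAt (fun y => -(fderiv ℝ (𝓕 Φ) y e))
      (-((fderiv ℝ (fderiv ℝ (𝓕 Φ)) y).flip e)) y := by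
    intro y
    have h1 := (hfQ.differentiable one_ne_zero y).hasFDerivAt
    exact (((ContinuousLinearMap.apply ℝ ℂ e).hasFDerivAt.comp y h1).neg).congr_fderiv
      (by ext w; simp)
  have hK0 : ∀ y, ‖-(fderiv ℝ (𝓕 Φ) y e)‖ ≤ ‖fderiv ℝ (𝓕 Φ) y‖ := fun y => by
    rw [norm_neg]
    exact (ContinuousLinearMap.le_opNorm _ _).trans (mul_le_of_le_one_right (norm_nonneg _) he)
  have hKb : ∀ y, (1 + ‖y‖) ^ (r + 2) * ‖-(fderiv ℝ (𝓕 Φ) y e)‖ ≤ C := fun y =>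
    (mul_le_mul_of_nonneg_left (hK0 y) (by positivity)).trans (hd1 y)
  have hKdiff : Differentiable ℝ fun y => -(fderiv ℝ (𝓕 Φ) y e) := fun y =>
    (hKd y).differentiableAt
  -- Differentiating `𝓕 Φ` in the direction `e` multiplies `Φ` by `-2πi ⟨η, e⟩`; hence the sign.
  refine ⟨fun y => -(fderiv ℝ (𝓕 Φ) y e), hKdiff.continuous, hintof hKdiff.continuous hKb,
    fun η => ?_, ?_, fun h => ?_⟩
  · have e1 := Real.fourier_fderiv hQi (hQ.differentiable two_ne_zero) hfQi
    have e2 := Real.fourier_continuousLinearMap_apply (f := fderiv ℝ (𝓕 Φ)) (a := e) (v := -η) hfQi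
    have e3 : 𝓕 (fun y => -(fderiv ℝ (𝓕 Φ) y e)) (-η) =
        -𝓕 (fun y => fderiv ℝ (𝓕 Φ) y e) (-η) := by
      rw [Real.fourier_eq, Real.fourier_eq, ← integral_neg]
      simp only [smul_neg]
    have e4 := congrFun (hΦc.fourierInv_fourier_eq hΦint hQi) η
    rw [Real.fourierInv_eq_fourier_neg] at e4 ⊢
    rw [e3, ← e2, e1, VectorFourier.fourierSMulRight_apply, e4]
    have e5 : ((-innerSL ℝ : E →L[ℝ] E →L[ℝ] ℝ) (-η)) e = inner ℝ η e := by
      rw [neg_apply, map_neg, neg_neg]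
      exact innerSL_apply_apply ℝ η e
    rw [e5, Complex.real_smul, smul_eq_mul]
    ring
  · refine (lintegral_mono fun y => ?_).trans_eq (lintegral_const_mul _ (by fun_prop))
    rw [← ofReal_norm, ← ENNReal.ofReal_mul (norm_nonneg _), ← ENNReal.ofReal_mul hC0]
    exact ENNReal.ofReal_le_ofReal (hdecay y (hKb y))
  · refine lintegral_translate_sub_le hKdiff hC0 (by omega)
      (fun y => hdecay' y (norm_nonneg _) (hKb y)) (fun y => hdecay' y (norm_nonneg _) ?_) h
    rw [(hKd y).fderiv, norm_neg]
    refine le_trans (mul_le_mul_of_nonneg_left ?_ (by positivity)) (hdec 2 le_rfl y)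
    rw [← norm_iteratedFDeriv_fderiv, norm_iteratedFDeriv_one]
    refine (ContinuousLinearMap.le_opNorm _ _).trans ?_
    rw [ContinuousLinearMap.opNorm_flip]
    exact mul_le_of_le_one_right (norm_nonneg (fderiv ℝ (fderiv ℝ (𝓕 Φ)) y)) he

end KernelDecay
-- Uniform bounds for the truncated gradient of a stable law with drift.
section FrozenBound

set_option linter.unusedSectionVars false

variable {E : Type} [NormedAddCommGroup E] [InnerProductSpace ℝ E] [FiniteDimensional ℝ E]
  [MeasurableSpace E] [BorelSpace E] {X : Type*} [MeasurableSpace X]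

lemma smoothExponent_smul (μ : Measure X) (θ : X → E) (c : ℝ) (ξ : E) :
    smoothExponent μ (fun x => c • θ x) ξ = smoothExponent μ θ (c • ξ) := by
  simp only [smoothExponent, real_inner_smul_right, real_inner_smul_left]

lemma integrable_abs_inner {μ : Measure X} [IsFiniteMeasure μ] {θ : X → E} (hθ : Measurable θ)
    (hθ1 : ∀ x, ‖θ x‖ ≤ 1) (ξ : E) : Integrable (fun x => |inner ℝ ξ (θ x)|) μ := by
  refine (integrable_const ‖ξ‖).mono' (by fun_prop) (Eventually.of_forall fun x => ?_)
  rw [Real.norm_eq_abs, abs_abs]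
  exact (abs_real_inner_le_norm _ _).trans
    (mul_le_of_le_one_right (norm_nonneg _) (hθ1 x))

/-- The stable law factors into a compound Poisson law and a law with a smooth exponent. -/
lemma charFun_compoundPoisson_mul_exp_smoothExponent {μ : Measure X} [IsFiniteMeasure μ]
    {θ : X → E} (hθ : Measurable θ) (hθ1 : ∀ x, ‖θ x‖ ≤ 1) (ξ : E) :
    charFun (compoundPoisson (jumpMeasure μ θ)) ξ * (Real.exp (-smoothExponent μ θ ξ) : ℂ) =
      (Real.exp (-∫ x, |inner ℝ ξ (θ x)| ∂μ) : ℂ) := by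
  have hi := integrable_abs_inner (μ := μ) hθ hθ1 ξ
  have hi2 : Integrable (fun x => √(1 + inner ℝ ξ (θ x) ^ 2)) μ := by
    refine ((integrable_const (1 : ℝ)).add hi).mono' (by fun_prop)
      (Eventually.of_forall fun x => ?_)
    rw [Real.norm_eq_abs, abs_of_nonneg (Real.sqrt_nonneg _)]
    change _ ≤ 1 + |inner ℝ ξ (θ x)|
    refine (Real.sqrt_le_left (by positivity)).2 ?_
    have := abs_nonneg (inner ℝ ξ (θ x))
    have h2 := sq_abs (inner ℝ ξ (θ x))
    nlinarith
  have h3 : (jumpMeasure μ θ).real Set.univ = μ.real Set.univ := by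
    rw [measureReal_def, jumpMeasure_univ μ hθ, measureReal_def]
  -- The mass of `μ` and the integral of `√(1 + ⟨ξ, θ⟩²)` occur with opposite signs in the two
  -- exponents, so only `-∫ |⟨ξ, θ⟩| dμ` remains.
  rw [charFun_compoundPoisson, charFun_jumpMeasure μ hθ, h3, ← Complex.ofReal_sub,
    ← Complex.ofReal_exp, ← Complex.ofReal_mul, ← Real.exp_add, smoothExponent,
    integral_sub hi2 hi, integral_sub hi2 (integrable_const _)]
  congr 2
  simp

lemma lintegral_map_const_add_compoundPoisson_le {μ : Measure X} [IsFiniteMeasure μ]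
    {θ : X → E} (hθ : Measurable θ) (hθ1 : ∀ x, ‖θ x‖ ≤ 1) (b : E) :
    ∫⁻ z, ENNReal.ofReal (‖z‖ ^ (1 / 2 : ℝ)) ∂((compoundPoisson (jumpMeasure μ θ)).map (b + ·)) ≤
      ENNReal.ofReal (‖b‖ ^ (1 / 2 : ℝ)) + μ Set.univ * lineJumpMoment := by
  rw [lintegral_map (by fun_prop) (by fun_prop)]
  calc _ ≤ ∫⁻ z, (ENNReal.ofReal (‖b‖ ^ (1 / 2 : ℝ)) + ENNReal.ofReal (‖z‖ ^ (1 / 2 : ℝ)))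
        ∂(compoundPoisson (jumpMeasure μ θ)) := by
        refine lintegral_mono fun z => ?_
        rw [← ENNReal.ofReal_add (by positivity) (by positivity)]
        refine ENNReal.ofReal_le_ofReal (le_trans ?_ (Real.rpow_add_le_add_rpow (norm_nonneg b)
          (norm_nonneg z) (by norm_num) (by norm_num)))
        gcongr
        exact norm_add_le b z
    _ ≤ _ := by
        rw [lintegral_add_left measurable_const, lintegral_const, measure_univ, mul_one]
        gcongr
        exact (lintegral_compoundPoisson_le _).trans (lintegral_jumpMeasure_le μ hθ hθ1)

/-- The inequality `‖y + z‖^{1/2} ≤ (1 + ‖y‖)(1 + ‖z‖^{1/2})` separates the variables: the kernel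
can afford a first moment, the rough law only one of order `1/2`. -/
lemma lintegral_kernel_moment_le {ν : Measure E} [IsProbabilityMeasure ν] {K : E → ℂ}
    (hK : Continuous K) :
    ∫⁻ z, ∫⁻ y, ‖(K y).re‖ₑ * ENNReal.ofReal (‖y + z‖ ^ (1 / 2 : ℝ)) ∂volume ∂ν ≤
      (∫⁻ y, ‖K y‖ₑ * ENNReal.ofReal (1 + ‖y‖)) *
        (1 + ∫⁻ z, ENNReal.ofReal (‖z‖ ^ (1 / 2 : ℝ)) ∂ν) := by
  have hpt : ∀ z y, ‖(K y).re‖ₑ * ENNReal.ofReal (‖y + z‖ ^ (1 / 2 : ℝ)) ≤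
      ‖K y‖ₑ * ENNReal.ofReal (1 + ‖y‖) * (1 + ENNReal.ofReal (‖z‖ ^ (1 / 2 : ℝ))) := by
    intro z y
    rw [mul_assoc]
    refine mul_le_mul' ?_ ?_
    · rw [← ofReal_norm, ← ofReal_norm]
      exact ENNReal.ofReal_le_ofReal (Complex.abs_re_le_norm _)
    · rw [← ENNReal.ofReal_one, ← ENNReal.ofReal_add zero_le_one (by positivity),
        ← ENNReal.ofReal_mul (by positivity)]
      refine ENNReal.ofReal_le_ofReal ?_
      have h1 : ‖y + z‖ ^ (1 / 2 : ℝ) ≤ ‖y‖ ^ (1 / 2 : ℝ) + ‖z‖ ^ (1 / 2 : ℝ) :=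
        le_trans (by gcongr; exact norm_add_le y z) (Real.rpow_add_le_add_rpow (norm_nonneg y)
          (norm_nonneg z) (by norm_num) (by norm_num))
      have h2 : ‖y‖ ^ (1 / 2 : ℝ) ≤ 1 + ‖y‖ :=
        calc ‖y‖ ^ (1 / 2 : ℝ) ≤ (1 + ‖y‖) ^ (1 / 2 : ℝ) := by gcongr; linarith
          _ ≤ (1 + ‖y‖) ^ (1 : ℝ) :=
            Real.rpow_le_rpow_of_exponent_le (by linarith [norm_nonneg y]) (by norm_num)
          _ = 1 + ‖y‖ := Real.rpow_one _
      have h3 : 0 ≤ ‖z‖ ^ (1 / 2 : ℝ) := by positivity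
      nlinarith [mul_nonneg (norm_nonneg y) h3]
  refine (lintegral_mono fun z => lintegral_mono (hpt z)).trans_eq ?_
  have hm : Measurable fun y => ‖K y‖ₑ * ENNReal.ofReal (1 + ‖y‖) :=
    hK.measurable.enorm.mul (by fun_prop)
  simp_rw [lintegral_mul_const _ hm]
  rw [lintegral_const_mul _ (by fun_prop), lintegral_add_left measurable_const, lintegral_const,
    measure_univ, mul_one]

/-- Uniform `L^p` bounds for the truncated gradient of the resolvent of a stable law with drift. -/
lemma eLpNorm_truncated_gradient_le (X : Type*) [MeasurableSpace X] [Nontrivial E] {p : ℝ}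
    (hp : 1 < p) {κ : ℝ} (hκ : 0 < κ) {m₀ : ℝ} (M : ℝ) (hm0 : 0 ≤ m₀) :
    ∃ C : ℝ≥0, ∀ (μ : Measure X) [IsFiniteMeasure μ] (θ : X → E), Measurable θ →
      (∀ x, ‖θ x‖ ≤ 1) → μ.real Set.univ ≤ m₀ →
      (∀ ξ, κ⁻¹ * ‖ξ‖ ≤ ∫ x, |inner ℝ ξ (θ x)| ∂μ) →
      ∀ b : E, ‖b‖ ≤ M → ∀ (ρ : Measure E) [IsProbabilityMeasure ρ],
      (∀ ξ, charFun ρ ξ = (Real.exp (-∫ x, |inner ℝ ξ (θ x)| ∂μ) : ℂ) *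
        Complex.exp (inner ℝ b ξ * Complex.I)) →
      ∀ a : ℝ → ℝ, Measurable a → (∀ t, 0 < t → |a t| ≤ 1) → ∀ δ N : ℝ, 0 < δ →
      ∀ e : E, ‖e‖ ≤ 1 → ∀ f : E → ℝ, ContDiff ℝ ∞ f → HasCompactSupport f →
        eLpNorm (fun x => ∫ t in Set.Ioc δ N, a t * ∫ y, fderiv ℝ f (x + t • y) e ∂ρ)
          (ENNReal.ofReal p) volume ≤ C * eLpNorm f (ENNReal.ofReal p) volume := by
  set n := Module.finrank ℝ E + 2 with hn
  have h2π : 0 < 2 * Real.pi := by positivity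
  -- The directions are rescaled by `2π` to pass from characteristic functions to the normalization
  -- of the Fourier transform, so the relevant radius is `2π`.
  obtain ⟨D, hD1, hD⟩ := smoothExponent_contDiff_bound (E := E) X n h2π.le hm0
  obtain ⟨K₁, K₂, hker⟩ := exists_gradient_kernel (E := E) (c := 2 * Real.pi * κ⁻¹) (by positivity)
    (A := n.factorial * Real.exp m₀ * D ^ n) (by positivity)
  -- The moment of `K` times one plus the `1/2`-moment of `ν`, which is at most that of the drift
  -- plus that of the jumps.
  set J : ℝ≥0 := K₁ * (1 + (Real.toNNReal (M ^ (1 / 2 : ℝ)) + Real.toNNReal m₀ * lineJumpMoment))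
    with hJ
  obtain ⟨C, hC⟩ := truncatedOp_eLpNorm_le (E := E) hp κ.toNNReal J K₂
  refine ⟨C, ?_⟩
  intro μ _ θ hθ hθ1 hμ hnd b hb ρ _ hρ a ha ha1 δ N hδ e he f hf hfc
  have hθ2 : ∀ x, ‖(2 * Real.pi) • θ x‖ ≤ 2 * Real.pi := fun x => by
    rw [norm_smul, Real.norm_eq_abs, abs_of_pos h2π]
    exact mul_le_of_le_one_right h2π.le (hθ1 x)
  have hθm : StronglyMeasurable fun x => (2 * Real.pi) • θ x :=
    (hθ.const_smul _).stronglyMeasurable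
  obtain ⟨hG, hGD⟩ := hD μ _ hθm hθ2 hμ
  set G := smoothExponent μ fun x => (2 * Real.pi) • θ x with hGdef
  have hGge : ∀ ξ, -G ξ ≤ m₀ + -(2 * Real.pi * κ⁻¹ * ‖ξ‖) := by
    intro ξ
    have h1 := smoothExponent_ge (μ := μ) hθm hθ2 ξ
    have h2 := hnd ((2 * Real.pi) • ξ)
    simp only [real_inner_smul_left, norm_smul, Real.norm_eq_abs, abs_of_pos h2π] at h2
    simp only [real_inner_smul_right] at h1
    linarith
  obtain ⟨K, hKc, hKi, hKF, hK1, hK2⟩ := hker (fun ξ => (Real.exp (-G ξ) : ℂ))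
    (Complex.ofRealCLM.contDiff.comp hG.neg.exp) (fun i hi ξ => by
      refine (norm_iteratedFDeriv_exp_neg_le (hG.of_le (by exact_mod_cast hi))
        (fun j hj hji => hGD j hj (hji.trans hi) ξ)).trans ?_
      calc (i.factorial : ℝ) * Real.exp (-G ξ) * D ^ i
          ≤ n.factorial * Real.exp (m₀ + -(2 * Real.pi * κ⁻¹ * ‖ξ‖)) * D ^ n := by
            gcongr
            exact hGge ξ
        _ = _ := by rw [Real.exp_add]; ring) e he
  -- The drift joins the rough factor, where it enters only through its contribution to the
  -- `1/2`-moment.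
  set ν := (compoundPoisson (jumpMeasure μ θ)).map (b + ·) with hν
  have : IsProbabilityMeasure ν := Measure.isProbabilityMeasure_map (by fun_prop)
  have hfac : ∀ η, charFun ρ ((2 * Real.pi) • η) =
      charFun ν ((2 * Real.pi) • η) * (Real.exp (-G η) : ℂ) := by
    intro η
    rw [hρ, hν, charFun_map_const_add, ← charFun_compoundPoisson_mul_exp_smoothExponent hθ hθ1,
      hGdef, smoothExponent_smul]
    ring
  have heq : ∀ f : E → ℝ, ContDiff ℝ ∞ f → HasCompactSupport f →
      truncatedOp ν a (fun y => (K y).re) δ N f =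
        fun x => ∫ t in Set.Ioc δ N, a t * ∫ y, fderiv ℝ f (x + t • y) e ∂ρ := fun f hf hfc =>
    funext fun x => truncatedOp_eq_integral_fderiv hKi e hfac hKF ha ha1 hδ hf hfc x
  rw [← heq f hf hfc]
  refine hC ν a (fun y => (K y).re) δ N ha ha1 (Complex.measurable_re.comp hKc.measurable) hKi.re hδ ?_ (fun h => ?_)
    (fun f hf hfc => ?_) f hf.continuous hfc
  · refine (lintegral_kernel_moment_le hKc).trans ?_
    rw [hJ]
    push_cast
    refine mul_le_mul' hK1 (add_le_add_right ?_ _)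
    refine (lintegral_map_const_add_compoundPoisson_le hθ hθ1 b).trans (add_le_add ?_ ?_)
    · exact ENNReal.ofReal_le_ofReal (by gcongr)
    · refine mul_le_mul' ?_ le_rfl
      rw [← ofReal_measureReal]
      exact ENNReal.ofReal_le_ofReal hμ
  · refine (lintegral_mono fun y => ?_).trans (hK2 h)
    rw [← Complex.sub_re, ← ofReal_norm, ← ofReal_norm]
    exact ENNReal.ofReal_le_ofReal (Complex.abs_re_le_norm _)
  · rw [heq f hf hfc]
    refine (eLpNorm_two_integral_fderiv_le hκ (fun ξ => ?_) ha ha1 hδ he hf hfc)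
    rw [hρ, norm_mul, Complex.norm_exp_ofReal_mul_I, mul_one, Complex.norm_real, Real.norm_eq_abs,
      abs_of_pos (Real.exp_pos _)]
    exact Real.exp_le_exp.2 (neg_le_neg (hnd ξ))

end FrozenBound
-- The self-similar resolvent and its gradient.
section Resolvent

set_option linter.unusedSectionVars false

variable {E : Type} [NormedAddCommGroup E] [InnerProductSpace ℝ E] [FiniteDimensional ℝ E]
  [MeasurableSpace E] [BorelSpace E]

/-- The resolvent of the self-similar semigroup `f ↦ ∫ f (· + t y) dρ(y)`. -/
noncomputable def selfSimilarResolvent (ρ : Measure E) (lam : ℝ) (f : E → ℝ) (x : E) : ℝ :=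
  ∫ t in Set.Ioi (0 : ℝ), Real.exp (-lam * t) * ∫ y, f (x + t • y) ∂ρ

variable {ρ : Measure E} [IsProbabilityMeasure ρ] {lam : ℝ} {f : E → ℝ}

lemma continuous_integral_comp_add_smul (hf : Continuous f) (hc : HasCompactSupport f) (x : E) :
    Continuous fun t : ℝ => ∫ y, f (x + t • y) ∂ρ := by
  obtain ⟨B, hB⟩ := hc.exists_bound_of_continuous hf
  exact continuous_of_dominated (bound := fun _ => B)
    (fun t => Continuous.aestronglyMeasurable (by fun_prop))
    (fun t => Eventually.of_forall fun y => hB _) (integrable_const B)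
    (Eventually.of_forall fun y => by fun_prop)

lemma integrableOn_exp_mul_integral (hlam : 0 < lam) (hf : Continuous f)
    (hc : HasCompactSupport f) (x : E) :
    IntegrableOn (fun t => Real.exp (-lam * t) * ∫ y, f (x + t • y) ∂ρ) (Set.Ioi 0) := by
  obtain ⟨B, hB⟩ := hc.exists_bound_of_continuous hf
  have hcont := continuous_integral_comp_add_smul (ρ := ρ) hf hc x
  refine ((exp_neg_integrableOn_Ioi 0 hlam).mul_const B).mono'
    (Continuous.aestronglyMeasurable (by fun_prop)) (Eventually.of_forall fun t => ?_)
  rw [norm_mul, Real.norm_eq_abs, Real.abs_exp]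
  refine mul_le_mul_of_nonneg_left ?_ (Real.exp_pos _).le
  refine (norm_integral_le_of_norm_le_const (Eventually.of_forall fun y => hB _)).trans_eq ?_
  simp

lemma integrable_exp_smul_prod {F : Type*} [NormedAddCommGroup F] [NormedSpace ℝ F]
    (hlam : 0 < lam) {g : E → F} (hg : Continuous g) (hgc : HasCompactSupport g) (x : E) :
    Integrable (fun q : ℝ × E => Real.exp (-lam * q.1) • g (x + q.1 • q.2))
      ((volume.restrict (Set.Ioi 0)).prod ρ) := by
  obtain ⟨B, hB⟩ := hgc.exists_bound_of_continuous hg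
  have h1 : Integrable (fun q : ℝ × E => Real.exp (-lam * q.1) * B)
      ((volume.restrict (Set.Ioi 0)).prod ρ) :=
    (exp_neg_integrableOn_Ioi 0 hlam).mul_prod (integrable_const B)
  refine h1.mono' (Continuous.aestronglyMeasurable (by fun_prop))
    (Eventually.of_forall fun q => ?_)
  rw [norm_smul, Real.norm_eq_abs, Real.abs_exp]
  exact mul_le_mul_of_nonneg_left (hB _) (Real.exp_pos _).le

lemma selfSimilarResolvent_eq_prod (hlam : 0 < lam) (hf : Continuous f)
    (hc : HasCompactSupport f) (x : E) :
    selfSimilarResolvent ρ lam f x =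
      ∫ q, Real.exp (-lam * q.1) • f (x + q.1 • q.2) ∂((volume.restrict (Set.Ioi 0)).prod ρ) := by
  rw [integral_prod _ (integrable_exp_smul_prod hlam hf hc x)]
  simp only [smul_eq_mul, integral_const_mul]
  rfl

lemma hasFDerivAt_selfSimilarResolvent (hlam : 0 < lam) (hf : ContDiff ℝ ∞ f)
    (hc : HasCompactSupport f) (x : E) :
    HasFDerivAt (selfSimilarResolvent ρ lam f)
      (∫ q, Real.exp (-lam * q.1) • fderiv ℝ f (x + q.1 • q.2)
        ∂((volume.restrict (Set.Ioi 0)).prod ρ)) x := by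
  have hf1 : Continuous (fderiv ℝ f) := hf.continuous_fderiv (by simp)
  have hc1 : HasCompactSupport (fderiv ℝ f) := hc.fderiv ℝ
  obtain ⟨B, hB⟩ := hc1.exists_bound_of_continuous hf1
  rw [funext (selfSimilarResolvent_eq_prod (ρ := ρ) hlam hf.continuous hc)]
  refine hasFDerivAt_integral_of_dominated_of_fderiv_le
    (bound := fun q : ℝ × E => Real.exp (-lam * q.1) * B) (s := Set.univ)
    (F' := fun x (q : ℝ × E) => Real.exp (-lam * q.1) • fderiv ℝ f (x + q.1 • q.2)) univ_mem
    (Eventually.of_forall fun x => (integrable_exp_smul_prod hlam hf.continuous hc x).1)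
    (integrable_exp_smul_prod hlam hf.continuous hc x)
    (integrable_exp_smul_prod hlam hf1 hc1 x).1
    (Eventually.of_forall fun q x _ => ?_)
    ((exp_neg_integrableOn_Ioi 0 hlam).mul_prod (integrable_const B))
    (Eventually.of_forall fun q x _ => ?_)
  · rw [norm_smul, Real.norm_eq_abs, Real.abs_exp]
    exact mul_le_mul_of_nonneg_left (hB _) (Real.exp_pos _).le
  · have h1 := (hf.differentiable (by simp) (x + q.1 • q.2)).hasFDerivAt
    exact ((hasFDerivAt_comp_add_right (q.1 • q.2)).2 h1).const_smul (Real.exp (-lam * q.1))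

lemma fderiv_selfSimilarResolvent_apply (hlam : 0 < lam) (hf : ContDiff ℝ ∞ f)
    (hc : HasCompactSupport f) (x e : E) :
    fderiv ℝ (selfSimilarResolvent ρ lam f) x e =
      ∫ t in Set.Ioi (0 : ℝ), Real.exp (-lam * t) * ∫ y, fderiv ℝ f (x + t • y) e ∂ρ := by
  have hf1 : Continuous (fderiv ℝ f) := hf.continuous_fderiv (by simp)
  have hc1 : HasCompactSupport (fderiv ℝ f) := hc.fderiv ℝ
  have hi := integrable_exp_smul_prod (ρ := ρ) hlam hf1 hc1 x
  rw [(hasFDerivAt_selfSimilarResolvent hlam hf hc x).fderiv, ContinuousLinearMap.integral_apply hi]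
  have hi2 := hi.apply_continuousLinearMap e
  rw [integral_prod _ hi2]
  simp only [smul_apply, smul_eq_mul, integral_const_mul]

/-- For smooth `f` the scale integral converges absolutely, so the truncations to `(1/(n+1), n]`
converge pointwise and Fatou's lemma transfers the uniform bound. -/
lemma eLpNorm_fderiv_selfSimilarResolvent_le (hlam : 0 < lam) (hf : ContDiff ℝ ∞ f)
    (hc : HasCompactSupport f) (e : E) {p B : ℝ≥0∞}
    (hB : ∀ δ N : ℝ, 0 < δ → eLpNorm (fun x => ∫ t in Set.Ioc δ N,
      Real.exp (-lam * t) * ∫ y, fderiv ℝ f (x + t • y) e ∂ρ) p volume ≤ B) :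
    eLpNorm (fun x => fderiv ℝ (selfSimilarResolvent ρ lam f) x e) p volume ≤ B := by
  have hf1 : Continuous fun x => fderiv ℝ f x e :=
    (hf.continuous_fderiv (by simp)).clm_apply continuous_const
  have hc1 : HasCompactSupport fun x => fderiv ℝ f x e :=
    (hc.fderiv ℝ).comp_left (g := fun L : E →L[ℝ] ℝ => L e) rfl
  set s : ℕ → Set ℝ := fun n => Set.Ioc (1 / ((n : ℝ) + 1)) n with hs
  have hmono : Monotone s := by
    intro i j hij
    refine Set.Ioc_subset_Ioc ?_ (by exact_mod_cast hij)
    exact one_div_le_one_div_of_le (by positivity) (by gcongr)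
  have hU : ⋃ n, s n = Set.Ioi 0 := by
    ext t
    simp only [hs, Set.mem_iUnion, Set.mem_Ioc, Set.mem_Ioi]
    constructor
    · rintro ⟨n, h1, _⟩
      exact lt_trans (by positivity) h1
    · intro ht
      obtain ⟨n, hn⟩ := exists_nat_one_div_lt ht
      obtain ⟨k, hk⟩ := exists_nat_ge t
      refine ⟨max n k, lt_of_le_of_lt ?_ hn, hk.trans (by exact_mod_cast le_max_right n k)⟩
      refine one_div_le_one_div_of_le (by positivity) ?_
      have : (n : ℝ) ≤ ((max n k : ℕ) : ℝ) := by exact_mod_cast le_max_left n k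
      linarith
  have hlim : ∀ x, Tendsto (fun n => ∫ t in s n,
      Real.exp (-lam * t) * ∫ y, fderiv ℝ f (x + t • y) e ∂ρ) atTop
      (𝓝 (fderiv ℝ (selfSimilarResolvent ρ lam f) x e)) := by
    intro x
    have h1 := integrableOn_exp_mul_integral (ρ := ρ) hlam hf1 hc1 x
    rw [fderiv_selfSimilarResolvent_apply hlam hf hc, ← hU]
    exact tendsto_setIntegral_of_monotone (fun n => measurableSet_Ioc) hmono (by rwa [hU])
  refine (Lp.eLpNorm_lim_le_liminf_eLpNorm (fun n => ?_) _ (Eventually.of_forall hlim)).trans ?_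
  · have h1 : StronglyMeasurable fun w : (E × ℝ) × E => fderiv ℝ f (w.1.1 + w.1.2 • w.2) e := by
      refine Continuous.stronglyMeasurable ?_
      exact hf1.comp (by fun_prop : Continuous fun w : (E × ℝ) × E => w.1.1 + w.1.2 • w.2)
    have h2 : StronglyMeasurable fun w : E × ℝ =>
        Real.exp (-lam * w.2) * ∫ y, fderiv ℝ f (w.1 + w.2 • y) e ∂ρ := by
      have h3 : StronglyMeasurable fun w : E × ℝ => Real.exp (-lam * w.2) :=
        Continuous.stronglyMeasurable (by fun_prop)
      exact h3.mul h1.integral_prod_right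
    exact h2.integral_prod_right.aestronglyMeasurable
  · refine liminf_le_of_le (by isBoundedDefault) fun b hb => ?_
    obtain ⟨n, hn⟩ := hb.exists
    exact hn.trans (hB _ _ (by positivity))

lemma selfSimilarResolvent_add (hlam : 0 < lam) {g : E → ℝ} (hf : Continuous f)
    (hfc : HasCompactSupport f) (hg : Continuous g) (hgc : HasCompactSupport g) :
    selfSimilarResolvent ρ lam (f + g) =
      selfSimilarResolvent ρ lam f + selfSimilarResolvent ρ lam g := by
  funext x
  rw [Pi.add_apply, selfSimilarResolvent_eq_prod hlam hf hfc,
    selfSimilarResolvent_eq_prod hlam hg hgc,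
    selfSimilarResolvent_eq_prod hlam (hf.add hg) (hfc.add hgc),
    ← integral_add (integrable_exp_smul_prod hlam hf hfc x)
      (integrable_exp_smul_prod hlam hg hgc x)]
  simp only [Pi.add_apply, smul_add]

lemma selfSimilarResolvent_smul (c : ℝ) :
    selfSimilarResolvent ρ lam (c • f) = c • selfSimilarResolvent ρ lam f := by
  funext x
  simp only [selfSimilarResolvent, Pi.smul_apply, smul_eq_mul, integral_const_mul]
  rw [← integral_const_mul]
  refine integral_congr_ae (Eventually.of_forall fun t => ?_)
  simp only
  ring

lemma norm_le_sum_abs_apply_basis {ι : Type*} [Fintype ι] (b : OrthonormalBasis ι ℝ E)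
    (L : E →L[ℝ] ℝ) (v : E) : |L v| ≤ ‖v‖ * ∑ i, |L (b i)| := by
  conv_lhs => rw [← b.sum_repr v, map_sum]
  refine (Finset.abs_sum_le_sum_abs _ _).trans ?_
  rw [Finset.mul_sum]
  refine Finset.sum_le_sum fun i _ => ?_
  rw [map_smul, smul_eq_mul, abs_mul]
  refine mul_le_mul_of_nonneg_right ?_ (abs_nonneg _)
  rw [b.repr_apply_apply]
  refine (abs_real_inner_le_norm _ _).trans ?_
  rw [b.norm_eq_one, one_mul]

/-- A pointwise small vector field applied to a gradient is small in `L^p` as soon as the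
directional derivatives are bounded. -/
lemma eLpNorm_inner_gradient_le {u : E → ℝ} {β : E → E} {ε : ℝ} (hε : 0 ≤ ε)
    (hβ : ∀ x, ‖β x‖ ≤ ε) {p B : ℝ≥0∞} (hp : 1 ≤ p)
    (hB : ∀ e : E, ‖e‖ ≤ 1 → eLpNorm (fun x => fderiv ℝ u x e) p volume ≤ B) :
    eLpNorm (fun x => inner ℝ (β x) (gradient u x)) p volume ≤
      ENNReal.ofReal ε * (Module.finrank ℝ E * B) := by
  set b := stdOrthonormalBasis ℝ E
  have hm : ∀ i, Measurable fun x => |fderiv ℝ u x (b i)| := fun i =>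
    (measurable_fderiv_apply_const ℝ u (b i)).abs
  calc _ ≤ eLpNorm (ε • ∑ i, fun x => |fderiv ℝ u x (b i)|) p volume := by
        refine eLpNorm_mono_real fun x => ?_
        rw [real_inner_comm, inner_gradient_left, Real.norm_eq_abs, Pi.smul_apply, smul_eq_mul,
          Finset.sum_apply]
        exact (norm_le_sum_abs_apply_basis b _ _).trans
          (mul_le_mul_of_nonneg_right (hβ x) (Finset.sum_nonneg fun i _ => abs_nonneg _))
    _ ≤ ENNReal.ofReal ε * ∑ i, eLpNorm (fun x => |fderiv ℝ u x (b i)|) p volume := by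
        rw [eLpNorm_const_smul, Real.enorm_eq_ofReal hε]
        gcongr
        exact eLpNorm_sum_le (fun i _ => (hm i).aestronglyMeasurable) hp
    _ ≤ ENNReal.ofReal ε * ∑ _i : Fin (Module.finrank ℝ E), B := by
        gcongr with i
        refine le_trans (le_of_eq ?_) (hB (b i) (b.norm_eq_one i).le)
        exact eLpNorm_norm (fun x => fderiv ℝ u x (b i))
    _ = _ := by simp

lemma measurable_inner_gradient {u : E → ℝ} {β : E → E} (hβ : Measurable β) :
    Measurable fun x => inner ℝ (β x) (gradient u x) := by
  refine hβ.inner ?_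
  exact (InnerProductSpace.toDual ℝ E).symm.continuous.measurable.comp (measurable_fderiv ℝ u)

end Resolvent
-- Extension from smooth functions to `L^p`.
section Extension

variable {E : Type} [NormedAddCommGroup E] [InnerProductSpace ℝ E] [FiniteDimensional ℝ E]
  [MeasurableSpace E] [BorelSpace E]

/-- The space of smooth compactly supported functions. -/
def smoothCompactlySupported (E : Type) [NormedAddCommGroup E] [InnerProductSpace ℝ E] :
    Submodule ℝ (E → ℝ) where
  carrier := {f | ContDiff ℝ ∞ f ∧ HasCompactSupport f}
  add_mem' hf hg := ⟨hf.1.add hg.1, hf.2.add hg.2⟩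
  zero_mem' := ⟨contDiff_const, HasCompactSupport.zero⟩
  smul_mem' c _ hf := ⟨contDiff_const.smul hf.1, hf.2.smul_left (f := fun _ => c)⟩

lemma memLp_of_mem_smoothCompactlySupported (f : smoothCompactlySupported E) (p : ℝ≥0∞) :
    MemLp (f : E → ℝ) p volume :=
  f.2.1.continuous.memLp_of_hasCompactSupport f.2.2

/-- A linear operator on smooth compactly supported functions with an `L^p` bound extends uniquely
to a bounded operator on `L^p`. -/
lemma exists_unique_extension {p : ℝ≥0∞} [Fact (1 ≤ p)] (hp : p ≠ ⊤) (R : (E → ℝ) → E → ℝ) {c : ℝ}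
    (hc : 0 ≤ c)
    (hmem : ∀ f, ContDiff ℝ ∞ f → HasCompactSupport f → MemLp (R f) p volume)
    (hle : ∀ f, ContDiff ℝ ∞ f → HasCompactSupport f →
      eLpNorm (R f) p volume ≤ ENNReal.ofReal c * eLpNorm f p volume)
    (hadd : ∀ f g, ContDiff ℝ ∞ f → HasCompactSupport f → ContDiff ℝ ∞ g → HasCompactSupport g →
      R (f + g) = R f + R g)
    (hsmul : ∀ (r : ℝ) f, ContDiff ℝ ∞ f → HasCompactSupport f → R (r • f) = r • R f) :
    ∃ T : Lp ℝ p (volume : Measure E) →L[ℝ] Lp ℝ p (volume : Measure E),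
      (∀ (f : E → ℝ) (hf : ContDiff ℝ ∞ f) (hfc : HasCompactSupport f),
        T ((hf.continuous.memLp_of_hasCompactSupport hfc).toLp f) =ᵐ[volume] R f) ∧
      (∀ T' : Lp ℝ p (volume : Measure E) →L[ℝ] Lp ℝ p (volume : Measure E),
        (∀ (f : E → ℝ) (hf : ContDiff ℝ ∞ f) (hfc : HasCompactSupport f),
          T' ((hf.continuous.memLp_of_hasCompactSupport hfc).toLp f) =ᵐ[volume] R f) → T' = T) ∧
      ‖T‖ ≤ c := by
  have memLp := fun f : smoothCompactlySupported E => memLp_of_mem_smoothCompactlySupported f p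
  obtain ⟨e, he⟩ : ∃ e : smoothCompactlySupported E →ₗ[ℝ] Lp ℝ p (volume : Measure E),
      ∀ f, e f = (memLp f).toLp f :=
    ⟨{ toFun := fun f => (memLp f).toLp f
       map_add' := fun f g => MemLp.toLp_add (memLp f) (memLp g)
       map_smul' := fun r f => MemLp.toLp_const_smul r (memLp f) }, fun _ => rfl⟩
  obtain ⟨S, hS⟩ : ∃ S : smoothCompactlySupported E →ₗ[ℝ] Lp ℝ p (volume : Measure E),
      ∀ f, S f = (hmem f f.2.1 f.2.2).toLp (R f) :=
    ⟨{ toFun := fun f => (hmem f f.2.1 f.2.2).toLp (R f)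
       map_add' := fun f g => by
        rw [← MemLp.toLp_add]
        exact MemLp.toLp_congr _ _ (Eventually.of_forall
          (congrFun (hadd f g f.2.1 f.2.2 g.2.1 g.2.2)))
       map_smul' := fun r f => by
        rw [RingHom.id_apply, ← MemLp.toLp_const_smul]
        exact MemLp.toLp_congr _ _ (Eventually.of_forall (congrFun (hsmul r f f.2.1 f.2.2))) },
      fun _ => rfl⟩
  have hdense : DenseRange e := by
    refine (Lp.dense_hasCompactSupport_contDiff (F := ℝ) (μ := (volume : Measure E)) hp).mono ?_
    rintro f ⟨g, hfg, hgc, hg⟩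
    refine ⟨⟨g, hg, hgc⟩, ?_⟩
    rw [he]
    refine Lp.ext ?_
    exact (MemLp.coeFn_toLp (memLp ⟨g, hg, hgc⟩)).trans hfg.symm
  have hbound : ∀ f, ‖S f‖ ≤ c * ‖e f‖ := by
    intro f
    rw [he, hS, Lp.norm_toLp, Lp.norm_toLp]
    calc _ ≤ (ENNReal.ofReal c * eLpNorm (f : E → ℝ) p volume).toReal :=
          ENNReal.toReal_mono (ENNReal.mul_ne_top ENNReal.ofReal_ne_top (memLp f).2.ne)
            (hle f f.2.1 f.2.2)
      _ = _ := by rw [ENNReal.toReal_mul, ENNReal.toReal_ofReal hc]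
  have hext := LinearMap.extendOfNorm_eq hdense ⟨c, hbound⟩
  refine ⟨S.extendOfNorm e, fun f hf hfc => ?_, fun T' hT' => ?_,
    LinearMap.opNorm_extendOfNorm_le hdense hc hbound⟩
  · have h := hext ⟨f, hf, hfc⟩
    rw [he, hS] at h
    rw [h]
    exact MemLp.coeFn_toLp (hmem f hf hfc)
  · refine ContinuousLinearMap.coeFn_injective
      (hdense.equalizer T'.continuous (S.extendOfNorm e).continuous (funext fun f => ?_))
    simp only [Function.comp_apply]
    rw [hext f, hS, he]
    refine Lp.ext ((hT' f f.2.1 f.2.2).trans ?_)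
    exact (MemLp.coeFn_toLp (hmem f f.2.1 f.2.2)).symm

end Extension

/-! ### The stable process with drift and its remainder operator. -/

section StableProcessResolvent

set_option linter.unusedSectionVars false

variable {d : ℕ} {Ω : Type*} [MeasurableSpace Ω] {m : Measure (USphere d)} {P : Measure Ω}
  {Z : ℝ≥0 → Ω → Euc d}

lemma norm_coe_uSphere (θ : USphere d) : ‖(θ : Euc d)‖ = 1 := by simp

/-- On the sphere `1 = ⟨θ, θ⟩ ≤ ∑ |⟨eᵢ, θ⟩|`; integrating and using the upper bound of the
nondegeneracy condition at each `eᵢ` controls the mass, which keeps the constants independent of the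
spectral measure. -/
lemma NonDegenerate.measureReal_univ_le [IsFiniteMeasure m] {κ : ℝ} (h : NonDegenerate m κ) :
    m.real Set.univ ≤ d * κ := by
  have hi := integrable_abs_inner (μ := m) (θ := fun θ : USphere d => (θ : Euc d))
    measurable_subtype_coe (fun θ => (norm_coe_uSphere θ).le)
  set b := EuclideanSpace.basisFun (Fin d) ℝ
  calc m.real Set.univ = ∫ _, (1 : ℝ) ∂m := by simp
    _ ≤ ∫ θ, ∑ i, |inner ℝ (b i) (θ : Euc d)| ∂m := by
        refine integral_mono (integrable_const _) (integrable_finsetSum _ fun i _ => hi _)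
          fun θ => ?_
        simp only
        have h1 := norm_le_sum_abs_apply_basis b (innerSL ℝ (θ : Euc d)) (θ : Euc d)
        simp only [innerSL_apply_apply] at h1
        rw [real_inner_self_eq_norm_sq, norm_coe_uSphere] at h1
        simpa [real_inner_comm] using h1
    _ = ∑ i, spectralExponent m (b i) := integral_finsetSum _ fun i _ => hi _
    _ ≤ ∑ _i : Fin d, κ := Finset.sum_le_sum fun i _ => by
        have := (h (b i)).2
        rwa [b.norm_eq_one, mul_one] at this
    _ = d * κ := by simp

lemma spectralExponent_smul {t : ℝ} (ht : 0 ≤ t) (ξ : Euc d) :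
    spectralExponent m (t • ξ) = t * spectralExponent m ξ := by
  simp only [spectralExponent, real_inner_smul_left, abs_mul, abs_of_nonneg ht,
    integral_const_mul]

variable [IsProbabilityMeasure P]

lemma IsStableProcess.charFun_map (h : IsStableProcess m P Z) (t : ℝ≥0) (ξ : Euc d) :
    charFun (P.map (Z t)) ξ = (Real.exp (-(t * spectralExponent m ξ)) : ℂ) := by
  have h1 := h.charFun_increment 0 t zero_le ξ
  have h2 : P.map (fun w => Z t w - Z 0 w) = P.map (Z t) := by
    refine Measure.map_congr ?_
    filter_upwards [h.zero] with w hw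
    rw [hw, sub_zero]
  rw [h2] at h1
  rw [h1]
  simp

/-- The exponent is homogeneous of degree one, so time and space scale alike. This makes `b₀ t +
Z_t` a dilation of one fixed law, drift included. -/
lemma IsStableProcess.map_eq (h : IsStableProcess m P Z) (t : ℝ≥0) :
    P.map (Z t) = (P.map (Z 1)).map ((t : ℝ) • ·) := by
  have := Measure.isProbabilityMeasure_map (μ := P) (h.measurable t).aemeasurable
  have := Measure.isProbabilityMeasure_map (μ := P) (h.measurable 1).aemeasurable
  refine Measure.ext_of_charFun (funext fun ξ => ?_)
  rw [charFun_map_smul, h.charFun_map, h.charFun_map, spectralExponent_smul t.coe_nonneg]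
  simp

/-- The law of `b₀ + Z₁`. -/
noncomputable def driftedLaw (P : Measure Ω) (Z : ℝ≥0 → Ω → Euc d) (b₀ : Euc d) :
    Measure (Euc d) :=
  (P.map (Z 1)).map (b₀ + ·)

lemma IsStableProcess.isProbabilityMeasure_driftedLaw (h : IsStableProcess m P Z) (b₀ : Euc d) :
    IsProbabilityMeasure (driftedLaw P Z b₀) := by
  have := Measure.isProbabilityMeasure_map (μ := P) (h.measurable 1).aemeasurable
  exact Measure.isProbabilityMeasure_map (by fun_prop)

lemma IsStableProcess.charFun_driftedLaw (h : IsStableProcess m P Z) (b₀ ξ : Euc d) :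
    charFun (driftedLaw P Z b₀) ξ =
      (Real.exp (-∫ θ : USphere d, |inner ℝ ξ (θ : Euc d)| ∂m) : ℂ) *
        Complex.exp (inner ℝ b₀ ξ * Complex.I) := by
  rw [driftedLaw, charFun_map_const_add, h.charFun_map, NNReal.coe_one, one_mul]
  rfl

lemma IsStableProcess.resolventIntegrand_eq (h : IsStableProcess m P Z) (b₀ : Euc d) (lam : ℝ)
    {f : Euc d → ℝ} (hf : Continuous f) (x : Euc d) {t : ℝ} (ht : 0 ≤ t) :
    resolventIntegrand P Z b₀ lam f x t =
      Real.exp (-lam * t) * ∫ y, f (x + t • y) ∂(driftedLaw P Z b₀) := by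
  have hm : ∀ g : Euc d → Euc d, Continuous g → ∀ μ : Measure (Euc d),
      AEStronglyMeasurable (fun y => f (g y)) μ := fun g hg μ =>
    (hf.comp hg).aestronglyMeasurable
  have h1 : ∫ y, f (x + t • y) ∂(driftedLaw P Z b₀) =
      ∫ z, f (x + t • (b₀ + z)) ∂(P.map (Z 1)) := by
    rw [driftedLaw, integral_map (by fun_prop) (hm _ (by fun_prop) _)]
  rw [resolventIntegrand, ← integral_map (φ := Z t.toNNReal) (f := fun z => f (x + t • b₀ + z))
      (h.measurable _).aemeasurable (hm _ (by fun_prop) _), h.map_eq,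
    integral_map (by fun_prop) (hm _ (by fun_prop) _), h1, Real.coe_toNNReal t ht]
  simp only [smul_add, add_assoc]

lemma IsStableProcess.resolvent_eq (h : IsStableProcess m P Z) (b₀ : Euc d) (lam : ℝ)
    {f : Euc d → ℝ} (hf : Continuous f) :
    resolvent P Z b₀ lam f = selfSimilarResolvent (driftedLaw P Z b₀) lam f :=
  funext fun x => setIntegral_congr_fun measurableSet_Ioi fun _ ht =>
    h.resolventIntegrand_eq b₀ lam hf x (le_of_lt ht)

/-- The gradient of the resolvent is bounded on `L^p`, uniformly in the spectral measure, the drift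
and the killing rate. -/
lemma exists_eLpNorm_remainder_le (hd : 1 ≤ d) {p : ℝ≥0∞} (hp : 1 < p) (hp' : p < ⊤) {κ : ℝ}
    (hκ : 1 ≤ κ) (M : ℝ) :
    ∃ C : ℝ, 0 ≤ C ∧ ∀ (m : Measure (USphere d)) [IsFiniteMeasure m], NonDegenerate m κ →
      ∀ (Ω : Type*) [MeasurableSpace Ω] (P : Measure Ω) [IsProbabilityMeasure P]
        (Z : ℝ≥0 → Ω → Euc d), IsStableProcess m P Z →
      ∀ (b : Euc d → Euc d) (b₀ : Euc d), ‖b₀‖ ≤ M → ∀ ε : ℝ, 0 ≤ ε → (∀ x, ‖b x - b₀‖ ≤ ε) →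
      ∀ lam : ℝ, 0 < lam → ∀ f : Euc d → ℝ, ContDiff ℝ ∞ f → HasCompactSupport f →
        eLpNorm (remainder P Z b b₀ lam f) p volume ≤
          ENNReal.ofReal (C * ε) * eLpNorm f p volume := by
  have : NeZero d := ⟨by omega⟩
  have hpr : 1 < p.toReal := by
    rw [← ENNReal.toReal_one]
    exact (ENNReal.toReal_lt_toReal ENNReal.one_ne_top hp'.ne).2 hp
  obtain ⟨C, hC⟩ := eLpNorm_truncated_gradient_le (E := Euc d) (USphere d) hpr
    (zero_lt_one.trans_le hκ) (m₀ := d * κ) M (by positivity)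
  rw [ENNReal.ofReal_toReal hp'.ne] at hC
  -- The gradient is estimated by the sum of its `d` coordinates in an orthonormal basis, each
  -- bounded with constant `C`.
  refine ⟨d * C, by positivity, ?_⟩
  intro m _ hm Ω _ P _ Z hZ b b₀ hb₀ ε hε hb lam hlam f hf hfc
  have := hZ.isProbabilityMeasure_driftedLaw b₀
  have hgrad : ∀ e : Euc d, ‖e‖ ≤ 1 → eLpNorm (fun x =>
      fderiv ℝ (resolvent P Z b₀ lam f) x e) p volume ≤ C * eLpNorm f p volume := by
    intro e he
    rw [hZ.resolvent_eq b₀ lam hf.continuous]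
    refine eLpNorm_fderiv_selfSimilarResolvent_le hlam hf hfc e fun δ N hδ => ?_
    exact hC m (fun θ => (θ : Euc d)) measurable_subtype_coe (fun θ => (norm_coe_uSphere θ).le)
      hm.measureReal_univ_le (fun ξ => (hm ξ).1) b₀ hb₀ _ (hZ.charFun_driftedLaw b₀)
      (fun t => Real.exp (-lam * t)) (by fun_prop)
      (fun t ht => by
        rw [Real.abs_exp, Real.exp_le_one_iff]
        nlinarith) δ N hδ e he f hf hfc
  refine (eLpNorm_inner_gradient_le hε hb hp.le hgrad).trans_eq ?_
  rw [finrank_euclideanSpace_fin, ← mul_assoc, ← mul_assoc, mul_comm ((d : ℝ) * C),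
    ENNReal.ofReal_mul hε, ENNReal.ofReal_mul (by positivity), ENNReal.ofReal_natCast,
    ENNReal.ofReal_coe_nnreal, mul_assoc (ENNReal.ofReal ε)]

lemma IsStableProcess.differentiable_resolvent (h : IsStableProcess m P Z) (b₀ : Euc d) {lam : ℝ}
    (hlam : 0 < lam) {f : Euc d → ℝ} (hf : ContDiff ℝ ∞ f) (hfc : HasCompactSupport f) :
    Differentiable ℝ (resolvent P Z b₀ lam f) := by
  have := h.isProbabilityMeasure_driftedLaw b₀
  rw [h.resolvent_eq b₀ lam hf.continuous]
  exact fun x => (hasFDerivAt_selfSimilarResolvent hlam hf hfc x).differentiableAt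

lemma IsStableProcess.integrableOn_resolventIntegrand (h : IsStableProcess m P Z) (b₀ : Euc d)
    {lam : ℝ} (hlam : 0 < lam) {f : Euc d → ℝ} (hf : Continuous f) (hfc : HasCompactSupport f)
    (x : Euc d) : IntegrableOn (resolventIntegrand P Z b₀ lam f x) (Set.Ioi 0) := by
  have := h.isProbabilityMeasure_driftedLaw b₀
  refine (integrableOn_congr_fun (fun t ht => ?_) measurableSet_Ioi).2
    (integrableOn_exp_mul_integral (ρ := driftedLaw P Z b₀) hlam hf hfc x)
  exact h.resolventIntegrand_eq b₀ lam hf x (le_of_lt ht)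

lemma IsStableProcess.remainder_add (h : IsStableProcess m P Z) (b : Euc d → Euc d) (b₀ : Euc d)
    {lam : ℝ} (hlam : 0 < lam) {f g : Euc d → ℝ} (hf : ContDiff ℝ ∞ f) (hfc : HasCompactSupport f)
    (hg : ContDiff ℝ ∞ g) (hgc : HasCompactSupport g) :
    remainder P Z b b₀ lam (f + g) = remainder P Z b b₀ lam f + remainder P Z b b₀ lam g := by
  have := h.isProbabilityMeasure_driftedLaw b₀
  have hadd : resolvent P Z b₀ lam (f + g) = resolvent P Z b₀ lam f + resolvent P Z b₀ lam g := by
    rw [h.resolvent_eq b₀ lam hf.continuous, h.resolvent_eq b₀ lam hg.continuous,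
      h.resolvent_eq b₀ lam (hf.continuous.add hg.continuous),
      selfSimilarResolvent_add hlam hf.continuous hfc hg.continuous hgc]
  funext x
  simp only [remainder, Pi.add_apply]
  rw [hadd]
  simp only [real_inner_comm _ (b x - b₀), inner_gradient_left]
  rw [fderiv_add (h.differentiable_resolvent b₀ hlam hf hfc x)
    (h.differentiable_resolvent b₀ hlam hg hgc x)]
  rfl

lemma IsStableProcess.remainder_smul (h : IsStableProcess m P Z) (b : Euc d → Euc d) (b₀ : Euc d)
    (lam r : ℝ) {f : Euc d → ℝ} (hf : Continuous f) :
    remainder P Z b b₀ lam (r • f) = r • remainder P Z b b₀ lam f := by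
  have := h.isProbabilityMeasure_driftedLaw b₀
  have hsmul : resolvent P Z b₀ lam (r • f) = r • resolvent P Z b₀ lam f := by
    rw [h.resolvent_eq b₀ lam hf, h.resolvent_eq b₀ lam (hf.const_smul r),
      selfSimilarResolvent_smul]
  funext x
  simp only [remainder, Pi.smul_apply]
  rw [hsmul]
  simp only [real_inner_comm _ (b x - b₀), inner_gradient_left]
  rw [fderiv_const_smul_field]
  rfl

end StableProcessResolvent

end CriticalStable

/-! ### The main theorem. -/

theorem theorem3 (d : ℕ) (hd : 1 ≤ d) (p : ℝ≥0∞) [Fact (1 ≤ p)] (hp : 1 < p) (hp' : p < ⊤)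
    (κ : ℝ) (hκ : 1 ≤ κ) (M : ℝ) (hM : 0 ≤ M) :
    ∃ C ε₀ : ℝ, 0 < C ∧ 0 < ε₀ ∧
      ∀ (m : Measure (CriticalStable.USphere d)) [IsFiniteMeasure m],
        CriticalStable.NonDegenerate m κ →
      ∀ (Ω : Type*) [MeasurableSpace Ω] (P : Measure Ω) [IsProbabilityMeasure P]
        (Z : ℝ≥0 → Ω → CriticalStable.Euc d), CriticalStable.IsStableProcess m P Z →
      ∀ (b : CriticalStable.Euc d → CriticalStable.Euc d), Continuous b → (∀ x, ‖b x‖ ≤ M) →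
      ∀ (b₀ : CriticalStable.Euc d) (ε : ℝ), 0 < ε → ε < 1 → (∀ x, ‖b x - b₀‖ ≤ ε) →
      ∀ lam : ℝ, 1 ≤ lam →
        (∀ f : CriticalStable.Euc d → ℝ, ContDiff ℝ ∞ f → HasCompactSupport f →
          (∀ x, IntegrableOn (CriticalStable.resolventIntegrand P Z b₀ lam f x) (Set.Ioi 0)) ∧
          Differentiable ℝ (CriticalStable.resolvent P Z b₀ lam f) ∧
          MemLp (CriticalStable.remainder P Z b b₀ lam f) p volume ∧
          eLpNorm (CriticalStable.remainder P Z b b₀ lam f) p volume ≤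
            ENNReal.ofReal (C * ε) * eLpNorm f p volume) ∧
        ∃ T : Lp ℝ p (volume : Measure (CriticalStable.Euc d)) →L[ℝ]
            Lp ℝ p (volume : Measure (CriticalStable.Euc d)),
          CriticalStable.ExtendsRemainder P Z b b₀ lam p T ∧
          (∀ T', CriticalStable.ExtendsRemainder P Z b b₀ lam p T' → T' = T) ∧
          ‖T‖ ≤ C * ε ∧
          (ε ≤ ε₀ → IsUnit (1 - T)) := by
  -- The bound `M + 1` covers every admissible `b₀`, since `‖b₀‖ ≤ ‖b 0‖ + ε` and `ε < 1`; the
  -- constant is thus independent of `b₀`.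
  obtain ⟨C, hC0, hC⟩ := CriticalStable.exists_eLpNorm_remainder_le hd hp hp' hκ (M + 1)
  -- Adding one makes the constant strictly positive; the threshold for `ε` brings the operator norm
  -- down to `1/2`, so that the Neumann series converges.
  refine ⟨C + 1, 1 / (2 * (C + 1)), by positivity, by positivity, ?_⟩
  intro m _ hm Ω _ P _ Z hZ b hbc hbM b₀ ε hε hε1 hb lam hlam
  have hlam0 : 0 < lam := zero_lt_one.trans_le hlam
  have hb₀ : ‖b₀‖ ≤ M + 1 := by
    calc ‖b₀‖ = ‖b 0 - (b 0 - b₀)‖ := by rw [sub_sub_cancel]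
      _ ≤ ‖b 0‖ + ‖b 0 - b₀‖ := norm_sub_le _ _
      _ ≤ M + 1 := add_le_add (hbM 0) ((hb 0).trans hε1.le)
  have hle : ∀ f : CriticalStable.Euc d → ℝ, ContDiff ℝ ∞ f → HasCompactSupport f →
      eLpNorm (CriticalStable.remainder P Z b b₀ lam f) p volume ≤
        ENNReal.ofReal ((C + 1) * ε) * eLpNorm f p volume := fun f hf hfc => by
    refine (hC m hm Ω P Z hZ b b₀ hb₀ ε hε.le hb lam hlam0 f hf hfc).trans ?_
    gcongr
    linarith
  have hmem : ∀ f : CriticalStable.Euc d → ℝ, ContDiff ℝ ∞ f → HasCompactSupport f →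
      MemLp (CriticalStable.remainder P Z b b₀ lam f) p volume := fun f hf hfc =>
    ⟨(CriticalStable.measurable_inner_gradient
      (hbc.sub continuous_const).measurable).aestronglyMeasurable, (hle f hf hfc).trans_lt
        (ENNReal.mul_lt_top ENNReal.ofReal_lt_top
          (hf.continuous.memLp_of_hasCompactSupport hfc).2)⟩
  refine ⟨fun f hf hfc => ⟨hZ.integrableOn_resolventIntegrand b₀ hlam0 hf.continuous hfc,
    hZ.differentiable_resolvent b₀ hlam0 hf hfc, hmem f hf hfc, hle f hf hfc⟩, ?_⟩
  obtain ⟨T, hT, huniq, hnorm⟩ := CriticalStable.exists_unique_extension hp'.ne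
    (CriticalStable.remainder P Z b b₀ lam) (c := (C + 1) * ε) (by positivity) hmem hle
    (fun f g hf hfc hg hgc => hZ.remainder_add b b₀ hlam0 hf hfc hg hgc)
    (fun r f hf _ => hZ.remainder_smul b b₀ lam r hf.continuous)
  refine ⟨T, hT, huniq, hnorm, fun hε₀ => isUnit_one_sub_of_norm_lt_one ?_⟩
  have : (C + 1) * ε ≤ 1 / 2 := by
    calc (C + 1) * ε ≤ (C + 1) * (1 / (2 * (C + 1))) := by gcongr
      _ = 1 / 2 := by field_simp
  linarith
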